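/- Let $K$ be a finite triangulation of the cube $[0,1]^d$, let $G\subset[0,1]^d$ be a connected finite geometric graph, and let $\rho$ be a piecewise-linear density on $K$, given by its values at the vertices. Let $\Omega\subseteq K$ be a subcomplex which is full (every simplex of $K$ all of whose vertices lie in $\Omega$ belongs to $\Omega$), and suppose that $G$ is contained in the underlying space $|\Omega|$, that every vertex of $\Omega$ is at distance at most $\omega$ from $G$, that $|\Omega|$ deformation retracts to $G$, that $\rho(v)\in[\beta,\beta+\nu]$ for every vertex $v$ of $\Omega$ and $\rho(v)\in[0,\nu]$ for every other vertex $v$ of $K$, and that $\beta>2\nu$. Let $\delta\in[\nu,\beta-\nu)$. Let $f=-\rho$, extended to simplices by $f(\sigma)=\max_{v\in\sigma}f(v)$, and consider the persistence pairs (homology with $\mathbb{Z}/2$ coefficients) of a lower-star filtration of $K$ with respect to $f$, ties being broken arbitrarily. A pair $(\sigma,\tau)$, and each of its two simplices, has persistence $f(\tau)-f(\sigma)$; an unpaired simplex has persistence $\infty$. Let $T$ be the graph with all vertices of $K$ whose edges are the edges $e$ of vertex-edge pairs $(v,e)$ of persistence at most $\delta$, and call a vertex of lowest $f$-value in a component of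 $T$, chosen once for each component, its sink. The reconstructed graph $\hat G$ is the union, over all edges $e=\{u,v\}$ of $K$ of persistence greater than $\delta$, of $e$ and the paths in $T$ from $u$ and from $v$ to the sinks of their components. Let $g$ be the first Betti number of $G$. Then exactly $g$ edges of $\Omega$ are paired (as positive edges) with triangles not in $\Omega$; the graph $\hat G$ also has first Betti number $g$; and if $g\ge 1$, then $\hat G$ is homotopy equivalent to $G$. -/

import Mathlib

noncomputable section

namespace GraphReconstruction

section Persistence

variable {V : Type*} {N : ℕ}

open Classical in
/-- The boundary operator on simplicial chains with coefficients in `ZMod 2`. A simplex is the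
finite set of its vertices; the boundary of a vertex is `0` (homology is not reduced). -/
def boundary : (Finset V →₀ ZMod 2) →ₗ[ZMod 2] (Finset V →₀ ZMod 2) :=
  Finsupp.linearCombination (ZMod 2) fun σ =>
    if 2 ≤ σ.card then ∑ v ∈ σ, Finsupp.single (σ.erase v) 1 else 0

/-- Chains supported on the simplices of `L` with `n` vertices, that is, of dimension `n - 1`. -/
def chains (L : Set (Finset V)) (n : ℕ) : Submodule (ZMod 2) (Finset V →₀ ZMod 2) :=
  Finsupp.supported (ZMod 2) (ZMod 2) {σ | σ ∈ L ∧ σ.card = n}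

/-- Cycles of `L` of dimension `n - 1`. -/
def cycles (L : Set (Finset V)) (n : ℕ) : Submodule (ZMod 2) (Finset V →₀ ZMod 2) :=
  chains L n ⊓ LinearMap.ker boundary

/-- The first `i` simplices of the sequence `S`; these subcomplexes form the filtration. -/
def prefixComplex (S : Fin N → Finset V) (i : ℕ) : Set (Finset V) :=
  {σ | ∃ j : Fin N, (j : ℕ) < i ∧ S j = σ}

/-- In `L`, the class of the cycle `z` (of simplices with `n` vertices) lies in the image of the
homology of `L₀`, i.e. `z` is homologous in `L` to a cycle of `L₀`. -/
def HomologousInto (L L₀ : Set (Finset V)) (n : ℕ) (z : Finset V →₀ ZMod 2) : Prop :=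
  ∃ w ∈ cycles L₀ n, ∃ c ∈ chains L (n + 1), z - w = boundary c

/-- `(S i, S j)` is a persistence pair of the simplex-wise filtration given by `S`: there is a
homology class, in dimension `dim (S i)`, which is born when `S i` is added and dies when `S j` is
added. That is, just before `S j` is added it is not in the image of the homology of the complex
preceding `S i`, and just after `S j` is added it is. -/
def PersistencePair (S : Fin N → Finset V) (i j : Fin N) : Prop :=
  i < j ∧ ∃ z ∈ cycles (prefixComplex S (i + 1)) (S i).card,
    ¬ HomologousInto (prefixComplex S j) (prefixComplex S i) (S i).card z ∧
    HomologousInto (prefixComplex S (j + 1)) (prefixComplex S i) (S i).card z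

/-- The extension of a function on vertices to simplices, `max_{v ∈ σ} f v`. -/
def simplexValue (f : V → ℝ) (σ : Finset V) : ℝ :=
  if h : σ.Nonempty then σ.sup' h f else 0

/-- `p` is the persistence of the simplex `S i`: the difference of function values in the
persistence pair containing it, and `∞` if it is unpaired. -/
def HasPersistence (S : Fin N → Finset V) (f : V → ℝ) (i : Fin N) (p : WithTop ℝ) : Prop :=
  (∃ j, PersistencePair S i j ∧
    p = ((simplexValue f (S j) - simplexValue f (S i) : ℝ) : WithTop ℝ)) ∨
  (∃ j, PersistencePair S j i ∧
    p = ((simplexValue f (S i) - simplexValue f (S j) : ℝ) : WithTop ℝ)) ∨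
  ((∀ j, ¬ PersistencePair S i j ∧ ¬ PersistencePair S j i) ∧ p = ⊤)

/-- `S` enumerates the simplices of `faces` as a lower-star filtration with respect to `f`: faces
precede cofaces, and for some enumeration `vs` of the vertices by non-decreasing `f`-value (ties
broken arbitrarily) the simplices are listed by non-decreasing index of their last vertex, so that
`S` consists of consecutive blocks, the `i`-th block being the lower star of `vs i`. -/
structure IsLowerStarFiltration (faces : Set (Finset V)) (f : V → ℝ)
    (S : Fin N → Finset V) : Prop where
  injective : Function.Injective S
  range_eq : Set.range S = faces
  face_lt : ∀ i j, S i ⊂ S j → i < j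
  exists_order : ∃ (n : ℕ) (vs : Fin n → V), Function.Injective vs ∧
    Set.range vs = {v | {v} ∈ faces} ∧ Monotone (fun a => f (vs a)) ∧
    ∀ i j, i ≤ j → ∀ a, vs a ∈ S i → ∃ b, a ≤ b ∧ vs b ∈ S j

end Persistence

section Graphs

/-- First Betti number of a finite (multi)graph with edges indexed by `ι` and endpoints `ends`:
the dimension over `ZMod 2` of the space of `1`-cycles, i.e. of `H₁`. -/
def firstBetti {ι V : Type*} (ends : ι → Sym2 V) : ℕ :=
  Module.finrank (ZMod 2) (LinearMap.ker
    (Finsupp.linearCombination (ZMod 2) (fun i => Sym2.lift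
      ⟨fun a b : V => (Finsupp.single a 1 + Finsupp.single b 1 : V →₀ ZMod 2),
        fun _ _ => add_comm _ _⟩ (ends i))))

/-- A finite graph embedded in a space `E`: finitely many points, joined by finitely many arcs
(loops and multiple arcs are allowed) whose interiors are embedded, pairwise disjoint, and avoid
the vertices. -/
structure GeometricGraph (E : Type*) [TopologicalSpace E] where
  vertices : Finset E
  numEdges : ℕ
  arc : Fin numEdges → C(unitInterval, E)
  arc_zero_mem : ∀ i, arc i 0 ∈ vertices
  arc_one_mem : ∀ i, arc i 1 ∈ vertices
  arc_notMem : ∀ i, ∀ t ∈ Set.Ioo (0 : unitInterval) 1, arc i t ∉ vertices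
  arc_injective : ∀ i j, ∀ s ∈ Set.Ioo (0 : unitInterval) 1, ∀ t ∈ Set.Ioo (0 : unitInterval) 1,
    arc i s = arc j t → i = j ∧ s = t

/-- The subset of `E` covered by the graph. -/
def GeometricGraph.space {E : Type*} [TopologicalSpace E] (G : GeometricGraph E) : Set E :=
  ↑G.vertices ∪ ⋃ i, Set.range (G.arc i)

/-- The first Betti number of a geometric graph. -/
def GeometricGraph.betti {E : Type*} [TopologicalSpace E] (G : GeometricGraph E) : ℕ :=
  firstBetti fun i => s(G.arc i 0, G.arc i 1)

/-- The subset covered by the edges of a straight-line graph whose vertices are points of `E`. -/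
def edgeSpace {E : Type*} [AddCommGroup E] [Module ℝ E] (H : SimpleGraph E) : Set E :=
  {x | ∃ u v, H.Adj u v ∧ x ∈ segment ℝ u v}

/-- The first Betti number of a (finite) simple graph. -/
def graphBetti {V : Type*} (H : SimpleGraph V) : ℕ :=
  firstBetti (fun e : H.edgeSet => (e : Sym2 V))

end Graphs

section Algorithm

variable {V : Type*} {N : ℕ}

open Classical in
/-- The graph `T` on the vertices whose edges are the edges `e` of vertex-edge persistence pairs
`(v, e)` of persistence at most `δ`. -/
def forest (S : Fin N → Finset V) (f : V → ℝ) (δ : ℝ) : SimpleGraph V :=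
  SimpleGraph.fromEdgeSet {e | ∃ u v, e = s(u, v) ∧ ∃ i j, PersistencePair S i j ∧
    (S i).card = 1 ∧ (S j).card = 2 ∧ S j = {u, v} ∧
    simplexValue f (S j) - simplexValue f (S i) ≤ δ}

/-- `sink` sends every vertex of the complex to the sink of its component in `T`: a vertex of
lowest `f`-value of that component, the same for all vertices of the component. -/
structure IsSinkMap (faces : Set (Finset V)) (f : V → ℝ) (T : SimpleGraph V)
    (sink : V → V) : Prop where
  reachable : ∀ u, {u} ∈ faces → T.Reachable u (sink u)
  lowest : ∀ u w, {u} ∈ faces → T.Reachable u w → f (sink u) ≤ f w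
  eq_of_reachable : ∀ u w, {u} ∈ faces → T.Reachable u w → sink u = sink w

open Classical in
/-- The output graph: the union, over all edges `{u, v}` of the complex with persistence larger than
`δ`, of the edge itself and of the paths in `T` from `u` and from `v` to their sinks. (The graph
has the edges given here and their endpoints as vertices.) -/
def outputGraph (S : Fin N → Finset V) (f : V → ℝ) (δ : ℝ) (sink : V → V) : SimpleGraph V :=
  SimpleGraph.fromEdgeSet {e | ∃ (i : Fin N) (u v : V) (p : WithTop ℝ),
    u ≠ v ∧ S i = {u, v} ∧ HasPersistence S f i p ∧ (δ : WithTop ℝ) < p ∧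
    (e = s(u, v) ∨ ∃ q : (forest S f δ).Walk u (sink u), q.IsPath ∧ e ∈ q.edges)}

end Algorithm

section NoiseModel

variable {d : ℕ}

/-- The unit cube `[0, 1]^d`. -/
def unitCube (d : ℕ) : Set (EuclideanSpace ℝ (Fin d)) :=
  {x | ∀ i, x i ∈ Set.Icc (0 : ℝ) 1}

/-- `X` deformation retracts to `A`: the identity of `X` is homotopic, through maps `X → X`, to a
retraction of `X` onto `A`. (The homotopy need not fix `A` at intermediate times.) -/
def DeformationRetractsTo {E : Type*} [TopologicalSpace E] (X A : Set E) : Prop :=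
  A ⊆ X ∧ ∃ H : C(X × unitInterval, X), (∀ x, H (x, 0) = x) ∧ (∀ x, (H (x, 1) : E) ∈ A) ∧
    ∀ x : X, (x : E) ∈ A → H (x, 1) = x

/-- The vertex values of `ρ` form a `(β, ν, ω)`-approximation of `G`, with the subcomplex `L` of the
triangulation `K` as the `ω`-neighborhood of `G`. The field `full` says that `L` is the subcomplex
of `K` spanned by its vertices, i.e. the complex of all simplices on which `ρ ≥ β`. -/
structure IsApproximation (K L : Geometry.SimplicialComplex ℝ (EuclideanSpace ℝ (Fin d)))
    (ρ : EuclideanSpace ℝ (Fin d) → ℝ) (G : Set (EuclideanSpace ℝ (Fin d)))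
    (β ν ω : ℝ) : Prop where
  subcomplex : L.faces ⊆ K.faces
  full : ∀ σ ∈ K.faces, (∀ v ∈ σ, v ∈ L.vertices) → σ ∈ L.faces
  subset_space : G ⊆ L.space
  dist_le : ∀ v ∈ L.vertices, Metric.infDist v G ≤ ω
  retract : DeformationRetractsTo L.space G
  density_inside : ∀ v ∈ L.vertices, ρ v ∈ Set.Icc β (β + ν)
  density_outside : ∀ v ∈ K.vertices, v ∉ L.vertices → ρ v ∈ Set.Icc 0 ν
  gap : 2 * ν < β

end NoiseModel

end GraphReconstruction

end

noncomputable section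

namespace GraphReconstruction

/-! ### Degree one cohomology by cochains on pairs of close points -/

section Coarse

variable {E : Type*} [PseudoMetricSpace E]

/-! Simplices of $\Omega$ have $f$-values in $[-\beta-\nu,-\beta]$ and all others have values in
$[-\nu,0]$. The filtration therefore exhausts $\Omega$ first, and `δ` separates pairs inside one of
these two levels from pairs crossing from the first to the second (`exists_isTwoLevel`). A
vertex-edge pair never crosses, because $\Omega$ is connected, and no edge is unpaired, because
$H_1$ of the cube vanishes. So the edges of persistence greater than `δ` are the critical ones: the
edges of $\Omega$ paired with a triangle outside $\Omega$ (`mem_critical_iff`).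

To count them, persistence is read off echelon forms. `leads` collects the last simplices of the
nonzero chains of a space; there are as many as its dimension (`ncard_leads`), and $(\sigma,\tau)$
is a pair exactly when $\sigma$ becomes a lead of the boundaries as $\tau$ is added
(`persistencePair_iff`). Every 1-cycle of $\Omega$ bounds in the cube, so the critical edges are the
leads of $Z_1(\Omega)$ which are not leads of $B_1(\Omega)$, and their number is $\dim H_1(\Omega)$.

Comparing this with the Betti number of $G$ needs a topological invariant. It is a degree one
cohomology in the style of Alexander and Spanier: functions of pairs of points satisfying the
cocycle identity on close triples, modulo differences of a function on close pairs. It is homotopy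
invariant on compact sets (`exists_coarse_homotopy`). Open stars of vertices identify it with the
dual of simplicial $H_1$ on a finite complex, and a cover subdividing each arc identifies it with
the dual of the cycle space on a graph. Duality of finite-dimensional spaces turns this into an
equality of dimensions (`finrank_map_mkQ_add_finrank`, `betti_add_finrank_boundaries`). The same
theory shows that the cube has no first homology.

As vertex-edge pairs all have small persistence and $K$ is connected, $T$ connects all vertices and
has a single sink. The output graph consists of the critical edges and of paths in $T$ to that sink.
A cycle never ends, in filtration order, with an edge of $T$, so it is determined by its
coefficients at critical edges; conversely each critical edge is closed up to a cycle by its two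
paths to the sink (`graphBetti_outputGraph`). If $g\ge 1$, the output is nonempty and connected, and
connected finite graphs of equal first Betti number are homotopy equivalent: collapse spanning trees
and match the remaining arcs (`nonempty_homotopyEquiv`). -/

/-- Functions of pairs of points which satisfy the cocycle identity on sufficiently close triples
of points of `X`. -/
def coarseCocycles (X : Set E) : Submodule (ZMod 2) (E → E → ZMod 2) where
  carrier := {φ | ∃ ε > 0, ∀ x ∈ X, ∀ y ∈ X, ∀ z ∈ X, dist x y < ε → dist y z < ε →
    dist x z < ε → φ x y + φ y z = φ x z}
  zero_mem' := ⟨1, one_pos, by simp⟩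
  add_mem' := by
    rintro φ ψ ⟨ε, hε, h⟩ ⟨η, hη, k⟩
    refine ⟨min ε η, lt_min hε hη, fun x hx y hy z hz a b c => ?_⟩
    have h1 := h x hx y hy z hz (a.trans_le (min_le_left _ _)) (b.trans_le (min_le_left _ _))
      (c.trans_le (min_le_left _ _))
    have h2 := k x hx y hy z hz (a.trans_le (min_le_right _ _)) (b.trans_le (min_le_right _ _))
      (c.trans_le (min_le_right _ _))
    simp only [Pi.add_apply]
    rw [← h1, ← h2]; abel
  smul_mem' := by
    rintro c φ ⟨ε, hε, h⟩
    refine ⟨ε, hε, fun x hx y hy z hz a b c => ?_⟩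
    simp only [Pi.smul_apply, ← smul_add, h x hx y hy z hz a b c]

/-- Functions of pairs of points which are differences of a function of points on sufficiently
close pairs of points of `X`. -/
def coarseCoboundaries (X : Set E) : Submodule (ZMod 2) (E → E → ZMod 2) where
  carrier := {φ | ∃ f : E → ZMod 2, ∃ ε > 0, ∀ x ∈ X, ∀ y ∈ X, dist x y < ε →
    φ x y = f x + f y}
  zero_mem' := ⟨0, 1, one_pos, by simp⟩
  add_mem' := by
    rintro φ ψ ⟨f, ε, hε, h⟩ ⟨g, η, hη, k⟩
    refine ⟨f + g, min ε η, lt_min hε hη, fun x hx y hy a => ?_⟩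
    have h1 := h x hx y hy (a.trans_le (min_le_left _ _))
    have h2 := k x hx y hy (a.trans_le (min_le_right _ _))
    simp only [Pi.add_apply]
    rw [h1, h2]; abel
  smul_mem' := by
    rintro c φ ⟨f, ε, hε, h⟩
    refine ⟨c • f, ε, hε, fun x hx y hy a => ?_⟩
    simp only [Pi.smul_apply, ← smul_add, h x hx y hy a]

/-- The form of the cocycle condition which is convenient for computations. -/
theorem exists_of_mem_coarseCocycles {X : Set E} {φ : E → E → ZMod 2}
    (h : φ ∈ coarseCocycles X) : ∃ ε > 0,
      (∀ x ∈ X, φ x x = 0) ∧ (∀ x ∈ X, ∀ y ∈ X, dist x y < ε → φ x y = φ y x) ∧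
      ∀ x ∈ X, ∀ y ∈ X, ∀ z ∈ X, dist x y < ε → dist y z < ε → dist x z < ε →
        φ x y + φ y z = φ x z := by
  obtain ⟨ε, hε, h⟩ := h
  have h0 : ∀ x ∈ X, φ x x = 0 := fun x hx => by
    have := h x hx x hx x hx (by simpa) (by simpa) (by simpa)
    simpa using this
  refine ⟨ε, hε, h0, fun x hx y hy hxy => ?_, h⟩
  have := h x hx y hy x hx hxy (by rwa [dist_comm]) (by simpa)
  rw [h0 x hx] at this
  exact CharTwo.add_eq_zero.1 this

theorem coarseCocycles_anti {X Y : Set E} (h : X ⊆ Y) : coarseCocycles Y ≤ coarseCocycles X := by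
  rintro φ ⟨ε, hε, k⟩
  exact ⟨ε, hε, fun x hx y hy z hz => k x (h hx) y (h hy) z (h hz)⟩

theorem coarseCoboundaries_anti {X Y : Set E} (h : X ⊆ Y) :
    coarseCoboundaries Y ≤ coarseCoboundaries X := by
  rintro φ ⟨f, ε, hε, k⟩
  exact ⟨f, ε, hε, fun x hx y hy => k x (h hx) y (h hy)⟩

/-- A function which takes the same value at sufficiently close points of a preconnected space is
constant. -/
theorem eq_of_forall_dist_lt {X : Type*} [PseudoMetricSpace X] [PreconnectedSpace X] {A : Type*}
    {f : X → A} {ε : ℝ} (hε : 0 < ε) (h : ∀ x y, dist x y < ε → f x = f y) (x y : X) :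
    f x = f y := by
  refine IsLocallyConstant.apply_eq_of_preconnectedSpace
    ((IsLocallyConstant.iff_eventually_eq f).2 fun a => ?_) x y
  filter_upwards [Metric.ball_mem_nhds a hε] with b hb
  exact h b a hb

/-- A function on a preconnected set taking the same value at sufficiently close points is
constant. -/
theorem eq_of_forall_dist_lt_of_isPreconnected {X : Set E} (hX : IsPreconnected X) {A : Type*}
    {f : E → A} {ε : ℝ} (hε : 0 < ε)
    (h : ∀ x ∈ X, ∀ y ∈ X, dist x y < ε → f x = f y) {x y : E} (hx : x ∈ X) (hy : y ∈ X) :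
    f x = f y := by
  have := isPreconnected_iff_preconnectedSpace.1 hX
  exact eq_of_forall_dist_lt (f := fun z : X => f z) hε (fun a b => h a a.2 b b.2)
    (⟨x, hx⟩ : X) ⟨y, hy⟩

/-- Homotopy invariance: the pullbacks of a cocycle under homotopic maps differ by a
coboundary. -/
theorem exists_coarse_homotopy {X : Type*} [PseudoMetricSpace X] [CompactSpace X] {Y : Set E}
    {φ : E → E → ZMod 2} (hφ : φ ∈ coarseCocycles Y) (H : X × unitInterval → E)
    (hH : Continuous H) (hY : ∀ p, H p ∈ Y) :
    ∃ f : X → ZMod 2, ∃ ε > 0, ∀ x y, dist x y < ε →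
      φ (H (x, 1)) (H (y, 1)) = φ (H (x, 0)) (H (y, 0)) + (f x + f y) := by
  obtain ⟨ε, hε, h0, hs, h⟩ := exists_of_mem_coarseCocycles hφ
  obtain ⟨η, hη, hu⟩ := Metric.uniformContinuous_iff.1
    (CompactSpace.uniformContinuous_of_continuous hH) (ε / 2) (half_pos hε)
  obtain ⟨n, hn⟩ := exists_nat_one_div_lt hη
  let t : ℕ → unitInterval := fun k => Set.projIcc 0 1 zero_le_one (k / (n + 1))
  have ht0 : t 0 = 0 := by
    simp only [t, Nat.cast_zero, zero_div]
    exact Set.projIcc_left zero_le_one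
  have ht1 : t (n + 1) = 1 := by
    simp only [t, Nat.cast_add, Nat.cast_one]
    rw [div_self (by positivity)]
    exact Set.projIcc_right zero_le_one
  have htd : ∀ k, dist (t k) (t (k + 1)) < η := fun k => by
    refine lt_of_le_of_lt ?_ hn
    have h1 := (LipschitzWith.projIcc (zero_le_one (α := ℝ))).dist_le_mul
      ((k : ℝ) / (n + 1)) (((k + 1 : ℕ) : ℝ) / (n + 1))
    refine h1.trans (le_of_eq ?_)
    rw [Real.dist_eq]
    have : (k : ℝ) / (n + 1) - ((k + 1 : ℕ) : ℝ) / (n + 1) = -(1 / (n + 1)) := by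
      push_cast; ring
    rw [this, abs_neg, abs_of_pos (by positivity)]
    simp
  -- Each time step adds to the primitive the value of `φ` on the short track of `x`. Sides shorter
  -- than `ε / 2` make the diagonal of the small quadrilateral shorter than `ε`, so the cocycle
  -- identity holds on both its triangles.
  have key : ∀ k, ∃ f : X → ZMod 2, ∀ x y, dist x y < η →
      φ (H (x, t k)) (H (y, t k)) = φ (H (x, 0)) (H (y, 0)) + (f x + f y) := by
    intro k
    induction k with
    | zero => exact ⟨0, fun x y _ => by simp [ht0]⟩
    | succ k ih =>
      obtain ⟨f, hf⟩ := ih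
      refine ⟨fun x => f x + φ (H (x, t k)) (H (x, t (k + 1))), fun x y hxy => ?_⟩
      have d1 : dist (H (x, t k)) (H (y, t k)) < ε / 2 :=
        hu (by simpa [Prod.dist_eq, hη] using hxy)
      have d2 : dist (H (x, t k)) (H (x, t (k + 1))) < ε / 2 :=
        hu (by simpa [Prod.dist_eq, hη] using htd k)
      have d3 : dist (H (y, t k)) (H (y, t (k + 1))) < ε / 2 :=
        hu (by simpa [Prod.dist_eq, hη] using htd k)
      have d4 : dist (H (x, t (k + 1))) (H (y, t (k + 1))) < ε / 2 :=
        hu (by simpa [Prod.dist_eq, hη] using hxy)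
      have d5 : dist (H (x, t k)) (H (y, t (k + 1))) < ε := by
        have := dist_triangle (H (x, t k)) (H (y, t k)) (H (y, t (k + 1)))
        linarith
      have e1 := h _ (hY (x, t k)) _ (hY (y, t k)) _ (hY (y, t (k + 1))) (by linarith)
        (by linarith) d5
      have e2 := h _ (hY (x, t k)) _ (hY (x, t (k + 1))) _ (hY (y, t (k + 1))) (by linarith)
        (by linarith) d5
      have e3 := hf x y hxy
      grind
  obtain ⟨f, hf⟩ := key (n + 1)
  rw [ht1] at hf
  exact ⟨f, η, hη, hf⟩

end Coarse

/-! ### Vanishing of coarse cohomology on compact convex sets -/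

section CoarseConvex

variable {E : Type*} [NormedAddCommGroup E] [NormedSpace ℝ E]

/-- On a compact convex set, every cocycle is a coboundary. -/
theorem coarseCocycles_le_coarseCoboundaries_of_convex {X : Set E} (hX : Convex ℝ X)
    (hc : IsCompact X) : coarseCocycles X ≤ coarseCoboundaries X := by
  classical
  intro φ hφ
  rcases X.eq_empty_or_nonempty with rfl | ⟨p, hp⟩
  · exact ⟨0, 1, one_pos, by simp⟩
  have := isCompact_iff_compactSpace.1 hc
  -- Straight-line contraction to `p`: at time 0 the pullback is the constant `φ p p = 0`, at time 1
  -- it is `φ` itself.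
  obtain ⟨f, ε, hε, hf⟩ := exists_coarse_homotopy hφ
    (fun q : X × unitInterval => AffineMap.lineMap p (q.1 : E) (q.2 : ℝ))
    (by simp only [AffineMap.lineMap_apply]; fun_prop)
    (fun q => hX.lineMap_mem hp q.1.2 q.2.2)
  obtain ⟨-, -, h0, -⟩ := exists_of_mem_coarseCocycles hφ
  refine ⟨fun x => if h : x ∈ X then f ⟨x, h⟩ else 0, ε, hε, fun x hx y hy hxy => ?_⟩
  have := hf ⟨x, hx⟩ ⟨y, hy⟩ hxy
  simpa [hx, hy, h0 p hp] using this

end CoarseConvex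

/-- A functional on `C` which vanishes on the kernel of `g` factors through `g`. -/
theorem exists_eq_comp_of_forall_inf_ker {F V W : Type*} [Field F] [AddCommGroup V] [Module F V]
    [AddCommGroup W] [Module F W] {C : Submodule F V} {g : V →ₗ[F] W} {l : V →ₗ[F] F}
    (h : ∀ z ∈ C, g z = 0 → l z = 0) : ∃ m : W →ₗ[F] F, ∀ z ∈ C, l z = m (g z) := by
  have hl : l ∘ₗ C.subtype ∈ (LinearMap.ker (g ∘ₗ C.subtype)).dualAnnihilator := by
    rw [Submodule.mem_dualAnnihilator]
    rintro ⟨z, hz⟩ hz0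
    exact h z hz hz0
  rw [← LinearMap.range_dualMap_eq_dualAnnihilator_ker] at hl
  obtain ⟨m, hm⟩ := hl
  exact ⟨m, fun z hz => (LinearMap.congr_fun hm ⟨z, hz⟩).symm⟩

/-! ### Simplicial chains -/

section Chains

variable {V : Type*}

/-- Boundaries of `L` of dimension `n - 1`. -/
def boundaries (L : Set (Finset V)) (n : ℕ) : Submodule (ZMod 2) (Finset V →₀ ZMod 2) :=
  (chains L (n + 1)).map boundary

theorem boundary_single [DecidableEq V] {σ : Finset V} (h : 2 ≤ σ.card) :
    boundary (Finsupp.single σ 1) = ∑ v ∈ σ, Finsupp.single (σ.erase v) 1 := by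
  simp only [boundary, Finsupp.linearCombination_single, one_smul, if_pos h]
  convert rfl

theorem boundary_single_of_card_le_one {σ : Finset V} (h : σ.card ≤ 1) (a : ZMod 2) :
    boundary (Finsupp.single σ a) = 0 := by
  simp [boundary, show ¬ 2 ≤ σ.card by omega]

theorem boundary_edge [DecidableEq V] {u v : V} (h : u ≠ v) :
    boundary (Finsupp.single ({u, v} : Finset V) 1) =
      Finsupp.single {u} 1 + Finsupp.single {v} 1 := by
  rw [boundary_single (by rw [Finset.card_pair h]), Finset.sum_pair h]
  have h1 : ({u, v} : Finset V).erase u = {v} := by grind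
  have h2 : ({u, v} : Finset V).erase v = {u} := by grind
  rw [h1, h2, add_comm]

theorem boundary_triangle [DecidableEq V] {u v w : V} (huv : u ≠ v) (huw : u ≠ w) (hvw : v ≠ w) :
    boundary (Finsupp.single ({u, v, w} : Finset V) 1) =
      Finsupp.single {v, w} 1 + (Finsupp.single {u, w} 1 + Finsupp.single {u, v} 1) := by
  rw [boundary_single (by rw [Finset.card_eq_three.2 ⟨u, v, w, huv, huw, hvw, rfl⟩]; omega),
    Finset.sum_insert (by grind), Finset.sum_pair hvw]
  have h1 : ({u, v, w} : Finset V).erase u = {v, w} := by grind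
  have h2 : ({u, v, w} : Finset V).erase v = {u, w} := by grind
  have h3 : ({u, v, w} : Finset V).erase w = {u, v} := by grind
  rw [h1, h2, h3]

theorem single_mem_chains {L : Set (Finset V)} {σ : Finset V} {n : ℕ} (h : σ ∈ L)
    (hn : σ.card = n) (a : ZMod 2) : Finsupp.single σ a ∈ chains L n :=
  Finsupp.single_mem_supported _ _ ⟨h, hn⟩

theorem chains_eq_span (L : Set (Finset V)) (n : ℕ) :
    chains L n = Submodule.span (ZMod 2)
      ((fun σ => Finsupp.single σ (1 : ZMod 2)) '' {σ | σ ∈ L ∧ σ.card = n}) :=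
  Finsupp.supported_eq_span_single _ _

/-- Two linear maps agree on chains if they agree on simplices. -/
theorem eqOn_chains {M : Type*} [AddCommGroup M] [Module (ZMod 2) M] {L : Set (Finset V)} {n : ℕ}
    {f g : (Finset V →₀ ZMod 2) →ₗ[ZMod 2] M}
    (h : ∀ σ ∈ L, σ.card = n → f (Finsupp.single σ 1) = g (Finsupp.single σ 1)) :
    ∀ z ∈ chains L n, f z = g z := by
  intro z hz
  rw [chains_eq_span] at hz
  refine LinearMap.eqOn_span (f := f) (g := g) ?_ hz
  rintro _ ⟨σ, ⟨hσ, hn⟩, rfl⟩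
  exact h σ hσ hn

theorem mem_dualAnnihilator_boundaries {L : Set (Finset V)} {n : ℕ}
    {l : Module.Dual (ZMod 2) (Finset V →₀ ZMod 2)} :
    l ∈ (boundaries L n).dualAnnihilator ↔
      ∀ σ ∈ L, σ.card = n + 1 → l (boundary (Finsupp.single σ 1)) = 0 := by
  rw [Submodule.mem_dualAnnihilator]
  constructor
  · intro h σ hσ hn
    exact h _ (Submodule.mem_map_of_mem (single_mem_chains hσ hn 1))
  · rintro h _ ⟨c, hc, rfl⟩
    exact eqOn_chains (f := l ∘ₗ boundary) (g := 0) (by simpa using h) c hc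

/-- A functional on edges vanishes on cycles if and only if it is the coboundary of a function on
vertices. -/
theorem mem_dualAnnihilator_cycles_two [DecidableEq V] {L : Set (Finset V)}
    {l : Module.Dual (ZMod 2) (Finset V →₀ ZMod 2)} :
    l ∈ (cycles L 2).dualAnnihilator ↔ ∃ b : V → ZMod 2, ∀ u v, u ≠ v → ({u, v} : Finset V) ∈ L →
      l (Finsupp.single {u, v} 1) = b u + b v := by
  rw [Submodule.mem_dualAnnihilator]
  constructor
  · intro h
    obtain ⟨m, hm⟩ := exists_eq_comp_of_forall_inf_ker (C := chains L 2) (g := boundary) (l := l)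
      fun z hz hz0 => h z ⟨hz, hz0⟩
    refine ⟨fun v => m (Finsupp.single {v} 1), fun u v huv hL => ?_⟩
    rw [hm _ (single_mem_chains hL (Finset.card_pair huv) 1), boundary_edge huv, map_add]
  · rintro ⟨b, hb⟩ z ⟨hz, hz0⟩
    have := eqOn_chains (f := l) (g := Finsupp.linearCombination (ZMod 2)
      (fun σ : Finset V => ∑ v ∈ σ, b v) ∘ₗ boundary) (L := L) (n := 2) (fun σ hσ hn => by
        obtain ⟨u, v, huv, rfl⟩ := Finset.card_eq_two.1 hn
        rw [LinearMap.comp_apply, boundary_edge huv, map_add, hb u v huv hσ]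
        simp) z hz
    rw [this, LinearMap.comp_apply, LinearMap.mem_ker.1 hz0, map_zero]

end Chains

/-! ### Comparison of simplicial and coarse cohomology -/

section CoarseOf

variable {E : Type*}

open Classical in
/-- The function of pairs of points which a functional on edges induces by means of a map `c` from
points to vertices. -/
def coarseOf (c : E → E) :
    Module.Dual (ZMod 2) (Finset E →₀ ZMod 2) →ₗ[ZMod 2] (E → E → ZMod 2) where
  toFun l x y := if c x = c y then 0 else l (Finsupp.single {c x, c y} 1)
  map_add' l m := by
    ext x y
    simp only [Pi.add_apply]
    split_ifs <;> simp
  map_smul' a l := by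
    ext x y
    simp only [Pi.smul_apply]
    split_ifs <;> simp

open Classical in
theorem coarseOf_apply (c : E → E) (l : Module.Dual (ZMod 2) (Finset E →₀ ZMod 2)) (x y : E) :
    coarseOf c l x y = if c x = c y then 0 else l (Finsupp.single {c x, c y} 1) := rfl

end CoarseOf

section Simplicial

variable {E : Type*} [NormedAddCommGroup E] [NormedSpace ℝ E]
  {K : Geometry.SimplicialComplex ℝ E}

theorem isCompact_convexHull_finset (s : Finset E) : IsCompact (convexHull ℝ (s : Set E)) :=
  s.finite_toSet.isCompact_convexHull ℝ

theorem isCompact_space (hK : K.faces.Finite) : IsCompact K.space :=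
  hK.isCompact_biUnion fun s _ => isCompact_convexHull_finset s

theorem mem_space_of_mem_convexHull {s : Finset E} (hs : s ∈ K.faces) {x : E}
    (hx : x ∈ convexHull ℝ (s : Set E)) : x ∈ K.space :=
  K.convexHull_subset_space hs hx

/-- A point of a simplicial complex has a vertex which belongs to all simplices containing the
point. -/
theorem exists_mem_all_faces {x : E} (hx : x ∈ K.space) :
    ∃ v, ∀ s ∈ K.faces, x ∈ convexHull ℝ (s : Set E) → v ∈ s := by
  classical
  obtain ⟨s₀, hs₀, hxs₀⟩ := Geometry.SimplicialComplex.mem_space_iff.1 hx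
  -- A smallest simplex containing `x` is contained in every other one, since its intersection with
  -- another is a face still containing `x`. Any of its vertices will do.
  obtain ⟨s, ⟨hs, hxs⟩, hmin⟩ := WellFounded.has_min (measure Finset.card).wf
    {s : Finset E | s ∈ K.faces ∧ x ∈ convexHull ℝ (s : Set E)} ⟨s₀, hs₀, hxs₀⟩
  obtain ⟨v, hv⟩ := K.nonempty_of_mem_faces hs
  refine ⟨v, fun t ht hxt => ?_⟩
  have hst := K.inter_subset_convexHull hs ht ⟨hxs, hxt⟩
  rw [← Finset.coe_inter] at hst
  have hne : (s ∩ t).Nonempty := by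
    rw [← Finset.coe_nonempty]
    exact convexHull_nonempty_iff.1 ⟨x, hst⟩
  have hcard := hmin (s ∩ t) ⟨K.down_closed hs Finset.inter_subset_left hne, hst⟩
  have : s ∩ t = s := Finset.eq_of_subset_of_card_le Finset.inter_subset_left (not_lt.1 hcard)
  exact Finset.mem_of_mem_inter_right (this.symm ▸ hv)

/-- `c` assigns to the points of the complex vertices in such a way that points at distance less
than `ε` from `x` lie in the open star of `c x`. -/
def IsVertexMap (K : Geometry.SimplicialComplex ℝ E) (c : E → E) (ε : ℝ) : Prop :=
  0 < ε ∧ ∀ x ∈ K.space, ∀ y ∈ K.space, dist x y < ε → ∀ s ∈ K.faces,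
    y ∈ convexHull ℝ (s : Set E) → c x ∈ s

/-- The open stars, complements of the unions of the closed simplices missing a given vertex, cover
the compact space; `ε` is a Lebesgue number of this cover. -/
theorem exists_isVertexMap (hK : K.faces.Finite) : ∃ c ε, IsVertexMap K c ε := by
  classical
  let U : E → Set E := fun v => (⋃ s ∈ {s | s ∈ K.faces ∧ v ∉ s}, convexHull ℝ (s : Set E))ᶜ
  have hU : ∀ v, IsOpen (U v) := fun v => by
    refine (Set.Finite.isClosed_biUnion (hK.subset fun s hs => hs.1) fun s _ => ?_).isOpen_compl
    exact (isCompact_convexHull_finset s).isClosed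
  have hmem : ∀ v x, x ∈ U v ↔ ∀ s ∈ K.faces, x ∈ convexHull ℝ (s : Set E) → v ∈ s := by
    intro v x
    simp only [U, Set.mem_compl_iff, Set.mem_iUnion, not_exists, Set.mem_ofPred_eq]
    constructor
    · intro h s hs hx
      by_contra hv
      exact h s ⟨hs, hv⟩ hx
    · intro h s hs hx
      exact hs.2 (h s hs.1 hx)
  obtain ⟨ε, hε, h⟩ := lebesgue_number_lemma_of_metric (isCompact_space hK) hU (fun x hx => by
    obtain ⟨v, hv⟩ := exists_mem_all_faces hx
    exact Set.mem_iUnion.2 ⟨v, (hmem v x).2 hv⟩)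
  choose! c hc using h
  refine ⟨c, ε, hε, fun x hx y hy hxy s hs hys => ?_⟩
  exact (hmem (c x) y).1 (hc x hx (by rwa [Metric.mem_ball, dist_comm])) s hs hys

theorem IsVertexMap.mem {c : E → E} {ε : ℝ} (hc : IsVertexMap K c ε) {s : Finset E}
    (hs : s ∈ K.faces) {x : E} (hx : x ∈ convexHull ℝ (s : Set E)) : c x ∈ s :=
  have h := mem_space_of_mem_convexHull hs hx
  hc.2 x h x h (by simpa using hc.1) s hs hx

theorem IsVertexMap.apply_vertex {c : E → E} {ε : ℝ} (hc : IsVertexMap K c ε) {v : E}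
    (hv : ({v} : Finset E) ∈ K.faces) : c v = v := by
  simpa using hc.mem hv (x := v) (by simp)

theorem singleton_mem_of_mem {s : Finset E} (hs : s ∈ K.faces) {v : E} (hv : v ∈ s) :
    ({v} : Finset E) ∈ K.faces :=
  K.down_closed hs (by simpa using hv) (by simp)

/-- A function on vertices which is constant on edges is constant if the complex is connected. -/
theorem eq_of_forall_edge [DecidableEq E] (hK : K.faces.Finite) (hconn : IsPreconnected K.space)
    {A : Type*} (b : E → A) (hb : ∀ u v, u ≠ v → ({u, v} : Finset E) ∈ K.faces → b u = b v)
    {u v : E} (hu : ({u} : Finset E) ∈ K.faces) (hv : ({v} : Finset E) ∈ K.faces) : b u = b v := by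
  obtain ⟨c, ε, hc⟩ := exists_isVertexMap hK
  -- The vertices chosen for two close points lie in a common simplex, so `b ∘ c` agrees on close
  -- points.
  have := eq_of_forall_dist_lt_of_isPreconnected hconn (f := b ∘ c) hc.1
    (fun x hx y hy hxy => by
      obtain ⟨s, hs, hys⟩ := Geometry.SimplicialComplex.mem_space_iff.1 hy
      have h1 := hc.2 x hx y hy hxy s hs hys
      have h2 := hc.mem hs hys
      by_cases h : c x = c y
      · simp [h]
      · exact hb _ _ h (K.down_closed hs (by grind) (by simp)))
    (mem_space_of_mem_convexHull hu (x := u) (by simp))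
    (mem_space_of_mem_convexHull hv (x := v) (by simp))
  simpa [hc.apply_vertex hu, hc.apply_vertex hv] using this

/-- For three close points, any simplex containing the first contains the vertices chosen for all
three. If these are distinct they span a triangle of the complex, and the cocycle identity says that
`l` vanishes on its boundary. -/
theorem coarseOf_mem_coarseCocycles {c : E → E} {ε : ℝ} (hc : IsVertexMap K c ε)
    {l : Module.Dual (ZMod 2) (Finset E →₀ ZMod 2)}
    (hl : l ∈ (boundaries K.faces 2).dualAnnihilator) :
    coarseOf c l ∈ coarseCocycles K.space := by
  classical
  rw [mem_dualAnnihilator_boundaries] at hl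
  refine ⟨ε, hc.1, fun x hx y hy z hz hxy hyz hxz => ?_⟩
  obtain ⟨s, hs, hxs⟩ := Geometry.SimplicialComplex.mem_space_iff.1 hx
  have h1 := hc.mem hs hxs
  have h2 := hc.2 y hy x hx (by rwa [dist_comm]) s hs hxs
  have h3 := hc.2 z hz x hx (by rwa [dist_comm]) s hs hxs
  simp only [coarseOf_apply]
  generalize c x = u at *
  generalize c y = v at *
  generalize c z = w at *
  by_cases huv : u = v
  · subst huv; simp
  by_cases hvw : v = w
  · subst hvw; simp [huv]
  by_cases huw : u = w
  · subst huw
    rw [if_neg huv, if_neg hvw, if_pos rfl, Finset.pair_comm v u]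
    exact CharTwo.add_self_eq_zero _
  have := hl {u, v, w} (K.down_closed hs (by grind) (by simp))
    (Finset.card_eq_three.2 ⟨u, v, w, huv, huw, hvw, rfl⟩)
  rw [boundary_triangle huv huw hvw, map_add, map_add] at this
  rw [if_neg huv, if_neg hvw, if_neg huw]
  grind

/-- A coarse primitive restricts to the vertices: along an edge it changes only where `c` switches
from one endpoint to the other, so after correction by the value of `l` it is constant there.
Conversely, a simplicial primitive is composed with `c`. -/
theorem coarseOf_mem_coarseCoboundaries_iff {c : E → E} {ε : ℝ} (hc : IsVertexMap K c ε)
    {l : Module.Dual (ZMod 2) (Finset E →₀ ZMod 2)} :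
    coarseOf c l ∈ coarseCoboundaries K.space ↔ l ∈ (cycles K.faces 2).dualAnnihilator := by
  classical
  rw [mem_dualAnnihilator_cycles_two]
  constructor
  · rintro ⟨f, η, hη, hf⟩
    refine ⟨f, fun u v huv hs => ?_⟩
    have hu := singleton_mem_of_mem hs (v := u) (by simp)
    have hv := singleton_mem_of_mem hs (v := v) (by simp)
    have := eq_of_forall_dist_lt_of_isPreconnected
      (convex_convexHull ℝ (({u, v} : Finset E) : Set E)).isPreconnected
      (f := fun x => f x + if c x = u then 0 else l (Finsupp.single {u, v} 1)) hη
      (fun x hx y hy hxy => by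
        have h1 := hc.mem hs hx
        have h2 := hc.mem hs hy
        have h3 := hf x (mem_space_of_mem_convexHull hs hx) y (mem_space_of_mem_convexHull hs hy)
          hxy
        rw [coarseOf_apply] at h3
        simp only [Finset.mem_insert, Finset.mem_singleton] at h1 h2
        rcases h1 with h1 | h1 <;> rcases h2 with h2 | h2
        · simp only [h1, h2, if_true] at h3 ⊢; grind
        · simp only [h1, h2, if_true, if_neg huv, if_neg huv.symm] at h3 ⊢; grind
        · simp only [h1, h2, if_true, if_neg huv.symm] at h3 ⊢
          rw [Finset.pair_comm] at h3; grind
        · simp only [h1, h2, if_true, if_neg huv.symm] at h3 ⊢; grind)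
      (x := u) (y := v) (subset_convexHull ℝ _ (by simp)) (subset_convexHull ℝ _ (by simp))
    simp only [hc.apply_vertex hu, hc.apply_vertex hv, if_true, if_neg huv.symm] at this
    grind
  · rintro ⟨b, hb⟩
    refine ⟨b ∘ c, ε, hc.1, fun x hx y hy hxy => ?_⟩
    obtain ⟨s, hs, hys⟩ := Geometry.SimplicialComplex.mem_space_iff.1 hy
    have h1 := hc.2 x hx y hy hxy s hs hys
    have h2 := hc.mem hs hys
    rw [coarseOf_apply]
    by_cases h : c x = c y
    · simp [h, CharTwo.add_self_eq_zero]
    · rw [if_neg h]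
      exact hb _ _ h (K.down_closed hs (by grind) (by simp))

theorem dist_lineMap_lineMap_le (x y p : E) (t : unitInterval) :
    dist (AffineMap.lineMap x p (t : ℝ)) (AffineMap.lineMap y p (t : ℝ)) ≤ dist x y := by
  have : (AffineMap.lineMap x p (t : ℝ) : E) - AffineMap.lineMap y p (t : ℝ) =
      (1 - (t : ℝ)) • (x - y) := by
    simp only [AffineMap.lineMap_apply_module]; module
  rw [dist_eq_norm, this, norm_smul, dist_eq_norm, Real.norm_eq_abs,
    abs_of_nonneg (sub_nonneg.2 t.2.2)]
  exact mul_le_of_le_one_left (norm_nonneg _) (by linarith [t.2.1])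

/-- Comparison of a cocycle on a complex along segments towards a common vertex. -/
theorem coarse_eq_of_segments {X A B : Set E} {φ : E → E → ZMod 2} {ε : ℝ}
    (hA : Convex ℝ A) (hB : Convex ℝ B) (hAX : A ⊆ X) (hBX : B ⊆ X)
    (hsymm : ∀ x ∈ X, φ x x = 0)
    (hφ : ∀ x ∈ X, ∀ y ∈ X, ∀ z ∈ X, dist x y < ε → dist y z < ε → dist x z < ε →
      φ x y + φ y z = φ x z)
    {f g : E → ZMod 2} {η : ℝ} (hη : 0 < η) (hf : ∀ x ∈ A, ∀ y ∈ A, dist x y < η → φ x y = f x + f y)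
    (hg : ∀ x ∈ B, ∀ y ∈ B, dist x y < η → φ x y = g x + g y)
    {x y p : E} (hx : x ∈ A) (hy : y ∈ B) (hpA : p ∈ A) (hpB : p ∈ B) (hxy : dist x y < ε / 2) :
    φ x y = (f x + f p) + (g y + g p) := by
  have hε : 0 < ε / 2 := dist_nonneg.trans_lt hxy
  let a : unitInterval → E := fun t => AffineMap.lineMap x p (t : ℝ)
  let b : unitInterval → E := fun t => AffineMap.lineMap y p (t : ℝ)
  have hac : Continuous a := by simp only [a, AffineMap.lineMap_apply]; fun_prop
  have hbc : Continuous b := by simp only [b, AffineMap.lineMap_apply]; fun_prop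
  have ha : ∀ t, a t ∈ A := fun t => hA.lineMap_mem hx hpA t.2
  have hb : ∀ t, b t ∈ B := fun t => hB.lineMap_mem hy hpB t.2
  obtain ⟨r, hr, hra⟩ := Metric.uniformContinuous_iff.1
    (CompactSpace.uniformContinuous_of_continuous hac) (min (ε / 2) η) (lt_min hε hη)
  obtain ⟨q, hq, hqb⟩ := Metric.uniformContinuous_iff.1
    (CompactSpace.uniformContinuous_of_continuous hbc) (min (ε / 2) η) (lt_min hε hη)
  -- Both points slide to `p` simultaneously. The displayed function of `t` is locally constant, and
  -- at time 1 its first term is `φ p p = 0`.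
  have := eq_of_forall_dist_lt (f := fun t => φ (a t) (b t) + f (a t) + g (b t)) (lt_min hr hq)
    (fun s t hst => by
      have d1 := hra (hst.trans_le (min_le_left _ _))
      have d2 := hqb (hst.trans_le (min_le_right _ _))
      have d3 : dist (a s) (b s) < ε / 2 := (dist_lineMap_lineMap_le x y p s).trans_lt hxy
      have d4 : dist (a t) (b t) < ε / 2 := (dist_lineMap_lineMap_le x y p t).trans_lt hxy
      have d1' := d1.trans_le (min_le_left _ _)
      have d2' := d2.trans_le (min_le_left _ _)
      have d5 : dist (a s) (b t) < ε := by
        have := dist_triangle (a s) (b s) (b t)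
        linarith
      have e1 := hφ _ (hAX (ha s)) _ (hBX (hb s)) _ (hBX (hb t)) (by linarith) (by linarith) d5
      have e2 := hφ _ (hAX (ha s)) _ (hAX (ha t)) _ (hBX (hb t)) (by linarith) (by linarith) d5
      have e3 := hf _ (ha s) _ (ha t) (d1.trans_le (min_le_right _ _))
      have e4 := hg _ (hb s) _ (hb t) (d2.trans_le (min_le_right _ _))
      grind) 0 1
  simp only [a, b, Set.Icc.coe_zero, Set.Icc.coe_one, AffineMap.lineMap_apply_zero,
    AffineMap.lineMap_apply_one, hsymm p (hAX hpA)] at this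
  grind

/-- Every coarse cocycle on a finite complex comes from a simplicial cocycle. -/
theorem exists_coarseOf_sub_mem {c : E → E} {ε : ℝ}
    (hc : IsVertexMap K c ε) {φ : E → E → ZMod 2} (hφ : φ ∈ coarseCocycles K.space) :
    ∃ l ∈ (boundaries K.faces 2).dualAnnihilator,
      φ - coarseOf c l ∈ coarseCoboundaries K.space := by
  classical
  have hloc : ∀ s ∈ K.faces, ∃ f : E → ZMod 2, ∃ η > 0, ∀ x ∈ convexHull ℝ (s : Set E),
      ∀ y ∈ convexHull ℝ (s : Set E), dist x y < η → φ x y = f x + f y := fun s hs =>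
    coarseCocycles_le_coarseCoboundaries_of_convex (convex_convexHull ℝ _)
      (isCompact_convexHull_finset s) (coarseCocycles_anti (K.convexHull_subset_space hs) hφ)
  choose! f e he hf using hloc
  -- primitives on different simplices differ by a constant on a common convex subset
  have hcmp : ∀ s ∈ K.faces, ∀ t ∈ K.faces, ∀ x y, x ∈ convexHull ℝ (s : Set E) →
      y ∈ convexHull ℝ (s : Set E) → x ∈ convexHull ℝ (t : Set E) →
      y ∈ convexHull ℝ (t : Set E) → f s x + f s y = f t x + f t y := by
    intro s hs t ht x y hxs hys hxt hyt
    have := eq_of_forall_dist_lt_of_isPreconnected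
      ((convex_convexHull ℝ (s : Set E)).inter (convex_convexHull ℝ (t : Set E))).isPreconnected
      (f := fun z => f s z + f t z) (lt_min (he s hs) (he t ht))
      (fun z hz w hw hzw => by
        have h1 := hf s hs z hz.1 w hw.1 (hzw.trans_le (min_le_left _ _))
        have h2 := hf t ht z hz.2 w hw.2 (hzw.trans_le (min_le_right _ _))
        grind) ⟨hxs, hxt⟩ ⟨hys, hyt⟩
    grind
  -- On an edge, `l` is the increment of the local primitive of that edge; by `hcmp`, the primitive
  -- of any simplex containing the edge gives the same increment.
  let l : Module.Dual (ZMod 2) (Finset E →₀ ZMod 2) :=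
    Finsupp.linearCombination (ZMod 2) fun σ => ∑ v ∈ σ, f σ v
  have hl : ∀ s ∈ K.faces, ∀ u v, u ∈ s → v ∈ s → u ≠ v →
      l (Finsupp.single {u, v} 1) = f s u + f s v := by
    intro s hs u v hu hv huv
    have h1 : l (Finsupp.single {u, v} 1) = f {u, v} u + f {u, v} v := by
      simp [l, Finset.sum_pair huv]
    rw [h1]
    refine hcmp {u, v} (K.down_closed hs (by grind) (by simp)) s hs u v ?_ ?_ ?_ ?_ <;>
    exact subset_convexHull ℝ _ (by simp [hu, hv])
  refine ⟨l, ?_, ?_⟩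
  · rw [mem_dualAnnihilator_boundaries]
    intro s hs hn
    obtain ⟨u, v, w, huv, huw, hvw, rfl⟩ := Finset.card_eq_three.1 hn
    rw [boundary_triangle huv huw hvw, map_add, map_add, hl _ hs v w (by simp) (by simp) hvw,
      hl _ hs u w (by simp) (by simp) huw, hl _ hs u v (by simp) (by simp) huv]
    grind
  · obtain ⟨ε', hε', h0, -, hco⟩ := exists_of_mem_coarseCocycles hφ
    have hσ : ∀ x ∈ K.space, ∃ s ∈ K.faces, x ∈ convexHull ℝ (s : Set E) := fun x hx =>
      Geometry.SimplicialComplex.mem_space_iff.1 hx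
    choose! σ hσK hσx using hσ
    -- The local primitives are glued by normalizing each to vanish at the chosen vertex `c x`. For
    -- close `x` and `y`, the vertex `c x` lies in both simplices and serves as the common endpoint
    -- of the segments.
    refine ⟨fun x => f (σ x) x + f (σ x) (c x), min ε (ε' / 2), lt_min hc.1 (half_pos hε'),
      fun x hx y hy hxy => ?_⟩
    have hxt := hc.2 x hx y hy (hxy.trans_le (min_le_left _ _)) _ (hσK y hy) (hσx y hy)
    have hxs := hc.mem (hσK x hx) (hσx x hx)
    have hyt := hc.mem (hσK y hy) (hσx y hy)
    have h1 := coarse_eq_of_segments (convex_convexHull ℝ _) (convex_convexHull ℝ _)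
      (K.convexHull_subset_space (hσK x hx)) (K.convexHull_subset_space (hσK y hy)) h0 hco
      (lt_min (he _ (hσK x hx)) (he _ (hσK y hy)))
      (fun a ha b hb hab => hf _ (hσK x hx) a ha b hb (hab.trans_le (min_le_left _ _)))
      (fun a ha b hb hab => hf _ (hσK y hy) a ha b hb (hab.trans_le (min_le_right _ _)))
      (hσx x hx) (hσx y hy) (subset_convexHull ℝ _ (Finset.mem_coe.2 hxs))
      (subset_convexHull ℝ _ (Finset.mem_coe.2 hxt)) (hxy.trans_le (min_le_right _ _))
    simp only [Pi.sub_apply, coarseOf_apply]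
    split_ifs with h
    · rw [h] at h1 ⊢; grind
    · rw [hl _ (hσK y hy) _ _ hxt hyt h]; grind

/-- The first homology of a triangulation of a convex set vanishes. -/
theorem cycles_two_le_boundaries_of_convex (hK : K.faces.Finite) (hconv : Convex ℝ K.space) :
    cycles K.faces 2 ≤ boundaries K.faces 2 := by
  obtain ⟨c, ε, hc⟩ := exists_isVertexMap hK
  -- Dually, it suffices that each functional vanishing on boundaries also vanishes on cycles.
  rw [← Subspace.dualAnnihilator_le_dualAnnihilator_iff]
  intro l hl
  rw [← coarseOf_mem_coarseCoboundaries_iff hc]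
  exact coarseCocycles_le_coarseCoboundaries_of_convex hconv (isCompact_space hK)
    (coarseOf_mem_coarseCocycles hc hl)

end Simplicial

/-! ### A dimension count -/

/-- Both images are the quotient of `D` by the same kernel. -/
theorem finrank_map_eq_of_forall_eq_zero_iff {F U V W : Type*} [Field F] [AddCommGroup U]
    [Module F U] [AddCommGroup V] [Module F V] [AddCommGroup W] [Module F W] (D : Submodule F U)
    (f : U →ₗ[F] V) (g : U →ₗ[F] W) (h : ∀ x ∈ D, f x = 0 ↔ g x = 0) :
    Module.finrank F (D.map f) = Module.finrank F (D.map g) := by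
  have hker : LinearMap.ker (f ∘ₗ D.subtype) = LinearMap.ker (g ∘ₗ D.subtype) := by
    ext x
    exact h x x.2
  rw [← LinearMap.range_domRestrict D f, ← LinearMap.range_domRestrict D g]
  exact ((f ∘ₗ D.subtype).quotKerEquivRange.symm ≪≫ₗ Submodule.quotEquivOfEq _ _ hker ≪≫ₗ
    (g ∘ₗ D.subtype).quotKerEquivRange).finrank_eq

/-- If the functionals vanishing on `B`, modulo those vanishing on `C`, are identified with a
subquotient of `W`, then the dimension of the latter is that of `C` modulo `B`. -/
theorem finrank_map_mkQ_add_finrank {F V W : Type*} [Field F] [AddCommGroup V] [Module F V]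
    [AddCommGroup W] [Module F W] {B C : Submodule F V} (hBC : B ≤ C) [FiniteDimensional F C]
    (Φ : Module.Dual F V →ₗ[F] W) (Z' B' : Submodule F W)
    (h1 : ∀ l ∈ B.dualAnnihilator, Φ l ∈ Z')
    (h2 : ∀ l ∈ B.dualAnnihilator, (Φ l ∈ B' ↔ l ∈ C.dualAnnihilator))
    (h3 : ∀ φ ∈ Z', ∃ l ∈ B.dualAnnihilator, φ - Φ l ∈ B') :
    Module.finrank F (Z'.map B'.mkQ) + Module.finrank F B = Module.finrank F C := by
  have hP : B.dualAnnihilator.map (B'.mkQ ∘ₗ Φ) = Z'.map B'.mkQ := by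
    ext q
    constructor
    · rintro ⟨l, hl, rfl⟩
      exact ⟨Φ l, h1 l hl, rfl⟩
    · rintro ⟨φ, hφ, rfl⟩
      obtain ⟨l, hl, h⟩ := h3 φ hφ
      refine ⟨l, hl, ?_⟩
      rw [LinearMap.comp_apply, eq_comm, ← sub_eq_zero, ← map_sub]
      exact (Submodule.Quotient.mk_eq_zero _).2 h
  -- Functionals on `C` vanishing on `B` extend to the whole space, so restriction to `C` is onto
  -- the annihilator of `B` inside the dual of `C`, which has dimension `dim C - dim B`.
  have hR : B.dualAnnihilator.map C.subtype.dualMap = (B.comap C.subtype).dualAnnihilator := by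
    ext m
    rw [Submodule.mem_dualAnnihilator]
    constructor
    · rintro ⟨l, hl, rfl⟩ w hw
      exact (Submodule.mem_dualAnnihilator l).1 hl w hw
    · intro h
      obtain ⟨l, hl⟩ : ∃ l : V →ₗ[F] F, l ∘ₗ C.subtype = m := LinearMap.exists_extend m
      refine ⟨l, (Submodule.mem_dualAnnihilator l).2 fun w hw => ?_, hl⟩
      rw [← h ⟨w, hBC hw⟩ hw]
      exact LinearMap.congr_fun hl ⟨w, hBC hw⟩
  have e := finrank_map_eq_of_forall_eq_zero_iff B.dualAnnihilator C.subtype.dualMap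
    (B'.mkQ ∘ₗ Φ) fun l hl => by
      rw [LinearMap.comp_apply, Submodule.mkQ_apply, Submodule.Quotient.mk_eq_zero, h2 l hl,
        Submodule.mem_dualAnnihilator]
      exact ⟨fun h w hw => LinearMap.congr_fun h ⟨w, hw⟩, fun h => LinearMap.ext fun w => h w w.2⟩
  have := Subspace.finrank_add_finrank_dualAnnihilator_eq (B.comap C.subtype)
  rw [← hR, e, hP, (Submodule.comapSubtypeEquivOfLe hBC).finrank_eq] at this
  omega

/-! ### Parametrization of a geometric graph -/

namespace GeometricGraph

section Param

variable {E : Type*} [TopologicalSpace E] (G : GeometricGraph E)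

theorem vertex_mem_space {v : E} (hv : v ∈ G.vertices) : v ∈ G.space := Or.inl hv

theorem arc_mem_space (i : Fin G.numEdges) (t : unitInterval) : G.arc i t ∈ G.space :=
  Or.inr (Set.mem_iUnion.2 ⟨i, t, rfl⟩)

/-- The parametrization of a geometric graph by its vertices and arcs. -/
def param : G.vertices ⊕ Fin G.numEdges × unitInterval → G.space :=
  Sum.elim (fun v => ⟨v, G.vertex_mem_space v.2⟩) (fun p => ⟨G.arc p.1 p.2, G.arc_mem_space _ _⟩)

theorem continuous_param : Continuous G.param := by
  refine Continuous.sumElim (by fun_prop) (Continuous.subtype_mk ?_ _)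
  rw [continuous_prod_of_discrete_left]
  exact fun i => (G.arc i).continuous

theorem surjective_param : Function.Surjective G.param := by
  rintro ⟨x, hx | hx⟩
  · exact ⟨Sum.inl ⟨x, hx⟩, rfl⟩
  · obtain ⟨i, t, rfl⟩ := Set.mem_iUnion.1 hx
    exact ⟨Sum.inr (i, t), rfl⟩

/-- The source is compact and the target Hausdorff. Hence continuity of maps out of the graph, and
properties near one of its points, can be tested on the parametrization. -/
theorem isClosedMap_param [T2Space E] : IsClosedMap G.param :=
  G.continuous_param.isClosedMap

theorem isQuotientMap_param [T2Space E] : Topology.IsQuotientMap G.param :=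
  G.isClosedMap_param.isQuotientMap G.continuous_param G.surjective_param

theorem isCompact_space : IsCompact G.space :=
  G.vertices.finite_toSet.isCompact.union
    (isCompact_iUnion fun i => isCompact_range (G.arc i).continuous)

theorem eq_zero_or_eq_one_of_arc_mem {i : Fin G.numEdges} {t : unitInterval}
    (h : G.arc i t ∈ G.vertices) : t = 0 ∨ t = 1 := by
  by_contra! h'
  exact G.arc_notMem i t ⟨unitInterval.pos_iff_ne_zero.2 h'.1, unitInterval.lt_one_iff_ne_one.2 h'.2⟩
    h

theorem eq_of_arc_eq {i j : Fin G.numEdges} {s t : unitInterval} (hs : G.arc i s ∉ G.vertices)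
    (h : G.arc i s = G.arc j t) : i = j ∧ s = t := by
  have key : ∀ {k : Fin G.numEdges} {r : unitInterval}, G.arc k r ∉ G.vertices →
      r ∈ Set.Ioo (0 : unitInterval) 1 := fun {k r} hr =>
    ⟨unitInterval.pos_iff_ne_zero.2 fun h0 => hr (h0 ▸ G.arc_zero_mem k),
      unitInterval.lt_one_iff_ne_one.2 fun h1 => hr (h1 ▸ G.arc_one_mem k)⟩
  exact G.arc_injective i j s (key hs) t (key (h ▸ hs)) h

/-- A function on the vertices and compatible functions on the arcs define a function on the
graph. -/
theorem exists_extension {A : Type*} [Inhabited A] (b : E → A)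
    (f : Fin G.numEdges → unitInterval → A)
    (h0 : ∀ i, f i 0 = b (G.arc i 0)) (h1 : ∀ i, f i 1 = b (G.arc i 1)) :
    ∃ F : E → A, (∀ v ∈ G.vertices, F v = b v) ∧ ∀ i t, F (G.arc i t) = f i t := by
  classical
  refine ⟨fun x => if x ∈ G.vertices then b x else
    if h : ∃ p : Fin G.numEdges × unitInterval, G.arc p.1 p.2 = x then f h.choose.1 h.choose.2
    else default, fun v hv => by simp [hv], fun i t => ?_⟩
  by_cases hx : G.arc i t ∈ G.vertices
  · simp only [hx, if_true]
    rcases G.eq_zero_or_eq_one_of_arc_mem hx with rfl | rfl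
    · exact (h0 i).symm
    · exact (h1 i).symm
  · have h : ∃ p : Fin G.numEdges × unitInterval, G.arc p.1 p.2 = G.arc i t := ⟨(i, t), rfl⟩
    simp only [hx, if_false, dif_pos h]
    obtain ⟨e1, e2⟩ := G.eq_of_arc_eq hx h.choose_spec.symm
    rw [← e1, ← e2]

end Param

/-! ### Coarse cohomology of a geometric graph -/

section Cohomology

variable {E : Type*} [MetricSpace E] (G : GeometricGraph E)

/-- A cocycle on the graph is a coboundary if it is one along the arcs, with primitives whose
differences at the end points come from a function on the vertices. -/
theorem mem_coarseCoboundaries_of_arcs {φ : E → E → ZMod 2} (hφ : φ ∈ coarseCocycles G.space)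
    (f : Fin G.numEdges → unitInterval → ZMod 2)
    (hf : ∀ i, ∃ η > 0, ∀ s t, dist s t < η → φ (G.arc i s) (G.arc i t) = f i s + f i t)
    (b : E → ZMod 2) (hb : ∀ i, f i 0 + f i 1 = b (G.arc i 0) + b (G.arc i 1)) :
    φ ∈ coarseCoboundaries G.space := by
  obtain ⟨ε, hε, h0, hs, hco⟩ := exists_of_mem_coarseCocycles hφ
  -- The primitive on each arc is shifted by a constant to agree with `b` at the initial point; `hb`
  -- then forces agreement at the final point.
  obtain ⟨F, hFv, hFa⟩ := G.exists_extension b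
    (fun i t => f i t + f i 0 + b (G.arc i 0)) (fun i => by grind) (fun i => by
      have := hb i; grind)
  -- Since the parametrization is closed, a property valid near every parameter of `p` holds near
  -- `p`; so only the arcs through `p` need inspection.
  have hnear : ∀ p : E, ∃ r > 0, p ∈ G.space → ∀ y ∈ G.space, dist y p < r →
      φ y p = F y + F p := by
    intro p
    by_cases hp : p ∈ G.space
    swap
    · exact ⟨1, one_pos, fun h => absurd h hp⟩
    have := G.isClosedMap_param.eventually_nhds_fiber
      (p := fun q => φ (G.param q) p = F (G.param q) + F p) ⟨p, hp⟩ (by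
        rintro (v | ⟨i, t⟩) hq
        · rw [nhds_inl]
          rw [Filter.eventually_map]
          have hvp : (v : E) = p := congrArg Subtype.val hq
          have : ∀ᶠ w in nhds v, w = v := by
            rw [nhds_discrete]; exact Filter.eventually_pure.2 rfl
          filter_upwards [this] with w hw
          subst hw
          simp only [param, Sum.elim_inl, hvp, h0 p hp]
          grind
        · have hvp : G.arc i t = p := congrArg Subtype.val hq
          rw [nhds_inr, Filter.eventually_map, nhds_prod_eq, nhds_discrete]
          obtain ⟨η, hη, hi⟩ := hf i
          rw [Filter.pure_prod, Filter.eventually_map]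
          filter_upwards [Metric.ball_mem_nhds t hη] with s hs
          simp only [param, Sum.elim_inr, ← hvp, hFa]
          rw [hi s t hs]; grind)
    rw [Metric.eventually_nhds_iff] at this
    obtain ⟨r, hr, h⟩ := this
    refine ⟨r, hr, fun _ y hy hyp => ?_⟩
    obtain ⟨q, hq⟩ := G.surjective_param ⟨y, hy⟩
    have := h (y := ⟨y, hy⟩) hyp q hq
    rwa [hq] at this
  choose r hr hnear using hnear
  -- The radius `r p` is not uniform in `p`. With a Lebesgue number, two close points share a center
  -- `p`, and the cocycle identity is applied through it; the bound `ε / 2` keeps their mutual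
  -- distance below `ε`.
  obtain ⟨δ, hδ, hleb⟩ := lebesgue_number_lemma_of_metric G.isCompact_space
    (c := fun p : G.space => Metric.ball (p : E) (min (r p) (ε / 2))) (fun _ => Metric.isOpen_ball)
    (fun x hx => Set.mem_iUnion.2 ⟨⟨x, hx⟩, Metric.mem_ball_self
      (lt_min (hr x) (half_pos hε))⟩)
  refine ⟨F, δ, hδ, fun x hx y hy hxy => ?_⟩
  obtain ⟨⟨p, hp⟩, hpx⟩ := hleb x hx
  have d1 : dist x p < min (r p) (ε / 2) := hpx (Metric.mem_ball_self hδ)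
  have d2 : dist y p < min (r p) (ε / 2) := hpx (by rwa [Metric.mem_ball, dist_comm])
  have e1 := d1.trans_le (min_le_right _ _)
  have e2 := d2.trans_le (min_le_right _ _)
  have d3 : dist x y < ε := by
    have := dist_triangle_right x y p
    linarith
  have k1 := hnear p hp x hx (d1.trans_le (min_le_left _ _))
  have k2 := hnear p hp y hy (d2.trans_le (min_le_left _ _))
  have k3 := hs y hy p hp (by linarith)
  have k4 := hco x hx p hp y hy (by linarith) (by rw [dist_comm]; linarith) d3
  grind

/-- A cover of the graph: a neighbourhood of the vertices, and the two halves of each arc. -/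
def coverSet : Option (Fin G.numEdges × Bool) → Set E
  | none => (⋃ i, G.arc i '' {t | 1 / 3 ≤ (t : ℝ) ∧ (t : ℝ) ≤ 2 / 3})ᶜ
  | some (i, false) => (G.vertices ∪ (⋃ j ∈ {j | j ≠ i}, Set.range (G.arc j)) ∪
      G.arc i '' {t | 2 / 3 ≤ (t : ℝ)})ᶜ
  | some (i, true) => (G.vertices ∪ (⋃ j ∈ {j | j ≠ i}, Set.range (G.arc j)) ∪
      G.arc i '' {t | (t : ℝ) ≤ 1 / 3})ᶜ

theorem isOpen_coverSet (p : Option (Fin G.numEdges × Bool)) : IsOpen (G.coverSet p) := by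
  have himg : ∀ i (s : Set unitInterval), IsClosed s → IsClosed (G.arc i '' s) := fun i s hs =>
    (hs.isCompact.image (G.arc i).continuous).isClosed
  have hrest : ∀ i, IsClosed ((G.vertices : Set E) ∪ (⋃ j ∈ {j | j ≠ i}, Set.range (G.arc j))) :=
    fun i => G.vertices.finite_toSet.isClosed.union ((Set.toFinite _).isClosed_biUnion fun j _ =>
      (isCompact_range (G.arc j).continuous).isClosed)
  rcases p with _ | ⟨i, _ | _⟩
  · refine (isClosed_iUnion_of_finite fun i => himg i _ ?_).isOpen_compl
    exact (isClosed_le continuous_const continuous_subtype_val).inter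
      (isClosed_le continuous_subtype_val continuous_const)
  · exact ((hrest i).union (himg i _
      (isClosed_le continuous_const continuous_subtype_val))).isOpen_compl
  · exact ((hrest i).union (himg i _
      (isClosed_le continuous_subtype_val continuous_const))).isOpen_compl

theorem eq_none_of_vertex_mem_coverSet {v : E} (hv : v ∈ G.vertices)
    {p : Option (Fin G.numEdges × Bool)} (h : v ∈ G.coverSet p) : p = none := by
  rcases p with _ | ⟨i, _ | _⟩
  · rfl
  · exact absurd (Or.inl (Or.inl hv)) h
  · exact absurd (Or.inl (Or.inl hv)) h

theorem vertex_mem_coverSet {v : E} (hv : v ∈ G.vertices) : v ∈ G.coverSet none := by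
  simp only [coverSet, Set.mem_compl_iff, Set.mem_iUnion, not_exists]
  rintro i ⟨t, ⟨h1, h2⟩, rfl⟩
  rcases G.eq_zero_or_eq_one_of_arc_mem hv with rfl | rfl
  · norm_num at h1
  · norm_num at h2

/-- Which sets of the cover contain a point of an open arc. -/
theorem arc_mem_coverSet {i : Fin G.numEdges} {t : unitInterval} (ht : G.arc i t ∉ G.vertices)
    {p : Option (Fin G.numEdges × Bool)} :
    G.arc i t ∈ G.coverSet p ↔ (p = none ∧ ((t : ℝ) < 1 / 3 ∨ 2 / 3 < (t : ℝ))) ∨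
      (p = some (i, false) ∧ (t : ℝ) < 2 / 3) ∨ (p = some (i, true) ∧ 1 / 3 < (t : ℝ)) := by
  have hinj : ∀ j (P : unitInterval → Prop), G.arc i t ∈ G.arc j '' {t | P t} ↔ i = j ∧ P t := by
    intro j P
    constructor
    · rintro ⟨s, hs, h⟩
      obtain ⟨rfl, rfl⟩ := G.eq_of_arc_eq ht h.symm
      exact ⟨rfl, hs⟩
    · rintro ⟨rfl, h⟩
      exact ⟨t, h, rfl⟩
  have hrest : ∀ j, G.arc i t ∈ (⋃ k ∈ {k | k ≠ j}, Set.range (G.arc k)) ↔ i ≠ j := by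
    intro j
    simp only [Set.mem_iUnion, Set.mem_ofPred_eq, exists_prop]
    constructor
    · rintro ⟨k, hk, s, h⟩
      obtain ⟨rfl, -⟩ := G.eq_of_arc_eq ht h.symm
      exact hk
    · intro h
      exact ⟨i, h, t, rfl⟩
  rcases p with _ | ⟨j, _ | _⟩
  · simp only [coverSet, Set.mem_compl_iff, Set.mem_iUnion, hinj]
    grind
  · simp only [coverSet, Set.mem_compl_iff, Set.mem_union, hinj, hrest, Finset.mem_coe, ht]
    grind
  · simp only [coverSet, Set.mem_compl_iff, Set.mem_union, hinj, hrest, Finset.mem_coe, ht]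
    grind

theorem space_subset_iUnion_coverSet : G.space ⊆ ⋃ p, G.coverSet p := by
  intro x hx
  by_cases hv : x ∈ G.vertices
  · exact Set.mem_iUnion.2 ⟨none, G.vertex_mem_coverSet hv⟩
  · rcases hx with hx | hx
    · exact absurd hx hv
    obtain ⟨i, t, rfl⟩ := Set.mem_iUnion.1 hx
    by_cases h : (t : ℝ) < 2 / 3
    · exact Set.mem_iUnion.2 ⟨some (i, false), (G.arc_mem_coverSet hv).2 (by grind)⟩
    · exact Set.mem_iUnion.2 ⟨some (i, true), (G.arc_mem_coverSet hv).2 (by grind)⟩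

/-- `c` selects for every point of the graph a set of the cover containing its
`ε`-neighbourhood. -/
def IsCoverMap (c : E → Option (Fin G.numEdges × Bool)) (ε : ℝ) : Prop :=
  0 < ε ∧ ∀ x ∈ G.space, ∀ y, dist x y < ε → y ∈ G.coverSet (c x)

theorem exists_isCoverMap : ∃ c ε, G.IsCoverMap c ε := by
  obtain ⟨ε, hε, h⟩ := lebesgue_number_lemma_of_metric G.isCompact_space G.isOpen_coverSet
    G.space_subset_iUnion_coverSet
  choose! c hc using h
  exact ⟨c, ε, hε, fun x hx y hxy => hc x hx (by rwa [Metric.mem_ball, dist_comm])⟩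

/-- The transition function of the cover which is defined by a value for each arc. -/
def transition {n : ℕ} (l : Module.Dual (ZMod 2) (Fin n →₀ ZMod 2)) :
    Option (Fin n × Bool) → Option (Fin n × Bool) → ZMod 2
  | some (i, a), some (j, b) => if i = j ∧ a ≠ b then l (Finsupp.single i 1) else 0
  | _, _ => 0

/-- The function of pairs of points which is defined by a value for each arc. -/
def coarseOf (c : E → Option (Fin G.numEdges × Bool)) :
    Module.Dual (ZMod 2) (Fin G.numEdges →₀ ZMod 2) →ₗ[ZMod 2] (E → E → ZMod 2) where
  toFun l x y := transition l (c x) (c y)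
  map_add' l m := by
    ext x y
    simp only [Pi.add_apply]
    rcases c x with _ | ⟨i, a⟩ <;> rcases c y with _ | ⟨j, b⟩ <;> simp only [transition, add_zero]
    split_ifs <;> simp
  map_smul' r l := by
    ext x y
    simp only [Pi.smul_apply]
    rcases c x with _ | ⟨i, a⟩ <;> rcases c y with _ | ⟨j, b⟩ <;> simp only [transition, smul_zero]
    split_ifs <;> simp

theorem coarseOf_apply (c : E → Option (Fin G.numEdges × Bool))
    (l : Module.Dual (ZMod 2) (Fin G.numEdges →₀ ZMod 2)) (x y : E) :
    G.coarseOf c l x y = transition l (c x) (c y) := rfl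

variable {G} in
-- The sets chosen for three close points all contain the first point, and no point of the graph
-- lies in more than two sets of the cover. So two of the three choices coincide and the identity is
-- trivial.
theorem IsCoverMap.coarseOf_mem {c : E → Option (Fin G.numEdges × Bool)} {ε : ℝ}
    (hc : G.IsCoverMap c ε) (l : Module.Dual (ZMod 2) (Fin G.numEdges →₀ ZMod 2)) :
    G.coarseOf c l ∈ coarseCocycles G.space := by
  refine ⟨ε, hc.1, fun x hx y hy z hz hxy hyz hxz => ?_⟩
  have h1 := hc.2 x hx x (by simpa using hc.1)
  have h2 := hc.2 y hy x (by rwa [dist_comm])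
  have h3 := hc.2 z hz x (by rwa [dist_comm])
  simp only [coarseOf_apply]
  by_cases hv : x ∈ G.vertices
  · rw [G.eq_none_of_vertex_mem_coverSet hv h1, G.eq_none_of_vertex_mem_coverSet hv h2,
      G.eq_none_of_vertex_mem_coverSet hv h3]
    simp [transition]
  · rcases hx with hx | hx
    · exact absurd hx hv
    obtain ⟨i, t, rfl⟩ := Set.mem_iUnion.1 hx
    rw [G.arc_mem_coverSet hv] at h1 h2 h3
    have := CharTwo.add_self_eq_zero (l (Finsupp.single i 1))
    rcases h1 with ⟨h1, k1⟩ | ⟨h1, k1⟩ | ⟨h1, k1⟩ <;>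
    rcases h2 with ⟨h2, k2⟩ | ⟨h2, k2⟩ | ⟨h2, k2⟩ <;>
    rcases h3 with ⟨h3, k3⟩ | ⟨h3, k3⟩ | ⟨h3, k3⟩ <;>
    rw [h1, h2, h3] <;> simp [transition, this] <;> grind

variable {G} in
/-- The cocycle defined by a value for each arc has a primitive along each arc which increases by
that value. -/
theorem IsCoverMap.exists_primitive {c : E → Option (Fin G.numEdges × Bool)} {ε : ℝ}
    (hc : G.IsCoverMap c ε) (l : Module.Dual (ZMod 2) (Fin G.numEdges →₀ ZMod 2))
    (i : Fin G.numEdges) : ∃ f : unitInterval → ZMod 2, f 0 + f 1 = l (Finsupp.single i 1) ∧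
      ∃ η > 0, ∀ s t, dist s t < η →
        G.coarseOf c l (G.arc i s) (G.arc i t) = f s + f t := by
  -- The neighbourhood of the vertices meets the arc near both ends, so there the midpoint `1 / 2`
  -- decides which end is meant.
  let f : unitInterval → ZMod 2 := fun t => match c (G.arc i t) with
    | none => if (t : ℝ) < 1 / 2 then 0 else l (Finsupp.single i 1)
    | some (_, false) => 0
    | some (_, true) => l (Finsupp.single i 1)
  have hself : ∀ t, G.arc i t ∈ G.coverSet (c (G.arc i t)) := fun t =>
    hc.2 _ (G.arc_mem_space i t) _ (by simpa using hc.1)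
  have h0 : c (G.arc i 0) = none :=
    G.eq_none_of_vertex_mem_coverSet (G.arc_zero_mem i) (hself 0)
  have h1 : c (G.arc i 1) = none :=
    G.eq_none_of_vertex_mem_coverSet (G.arc_one_mem i) (hself 1)
  obtain ⟨η, hη, hu⟩ := Metric.uniformContinuous_iff.1
    (CompactSpace.uniformContinuous_of_continuous (G.arc i).continuous) ε hc.1
  -- the sets of the cover containing a point of the arc
  have hcov : ∀ (t : unitInterval) p, G.arc i t ∈ G.coverSet p →
      (p = none ∧ ((t : ℝ) < 1 / 3 ∨ 2 / 3 < (t : ℝ))) ∨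
      (p = some (i, false) ∧ (t : ℝ) < 2 / 3) ∨ (p = some (i, true) ∧ 1 / 3 < (t : ℝ)) := by
    intro t p h
    by_cases hv : G.arc i t ∈ G.vertices
    · rw [G.eq_none_of_vertex_mem_coverSet hv h]
      rcases G.eq_zero_or_eq_one_of_arc_mem hv with rfl | rfl <;> norm_num
    · exact (G.arc_mem_coverSet hv).1 h
  -- Parameters less than `1 / 3` apart cannot lie in the parts `t < 1 / 3` and `t > 2 / 3` at
  -- opposite ends.
  refine ⟨f, ?_, min η (1 / 3), by positivity, fun s t hst => ?_⟩
  · simp only [f, h0, h1]; norm_num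
  · have d := hu (hst.trans_le (min_le_left _ _))
    have d' : |(s : ℝ) - t| < 1 / 3 := hst.trans_le (min_le_right _ _)
    rw [abs_lt] at d'
    have a1 := hcov s _ (hself s)
    have a2 := hcov t _ (hself t)
    have a3 := hcov t _ (hc.2 _ (G.arc_mem_space i s) _ d)
    have a4 := hcov s _ (hc.2 _ (G.arc_mem_space i t) _ (by rwa [dist_comm]))
    have := CharTwo.add_self_eq_zero (l (Finsupp.single i 1))
    simp only [coarseOf_apply, f]
    generalize c (G.arc i s) = p at *
    generalize c (G.arc i t) = q at *
    rcases a1 with ⟨rfl, k1⟩ | ⟨rfl, k1⟩ | ⟨rfl, k1⟩ <;>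
    rcases a2 with ⟨rfl, k2⟩ | ⟨rfl, k2⟩ | ⟨rfl, k2⟩ <;>
    simp [transition, this] at a3 a4 ⊢ <;> grind

/-- The boundary map of the graph. -/
def boundaryMap : (Fin G.numEdges →₀ ZMod 2) →ₗ[ZMod 2] (E →₀ ZMod 2) :=
  Finsupp.linearCombination (ZMod 2) (fun i => Sym2.lift
      ⟨fun a b : E => (Finsupp.single a 1 + Finsupp.single b 1 : E →₀ ZMod 2),
        fun _ _ => add_comm _ _⟩ s(G.arc i 0, G.arc i 1))

theorem boundaryMap_single (i : Fin G.numEdges) : G.boundaryMap (Finsupp.single i 1) =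
    Finsupp.single (G.arc i 0) 1 + Finsupp.single (G.arc i 1) 1 := by
  simp [boundaryMap]

theorem betti_eq : G.betti = Module.finrank (ZMod 2) (LinearMap.ker G.boundaryMap) := rfl

/-- A functional vanishing on cycles factors through the boundary map; `b` consists of the values of
the factor on vertices. -/
theorem mem_dualAnnihilator_ker_boundaryMap
    {l : Module.Dual (ZMod 2) (Fin G.numEdges →₀ ZMod 2)} :
    l ∈ (LinearMap.ker G.boundaryMap).dualAnnihilator ↔
      ∃ b : E → ZMod 2, ∀ i, l (Finsupp.single i 1) = b (G.arc i 0) + b (G.arc i 1) := by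
  rw [Submodule.mem_dualAnnihilator]
  constructor
  · intro h
    obtain ⟨m, hm⟩ := exists_eq_comp_of_forall_inf_ker (C := ⊤) (g := G.boundaryMap) (l := l)
      fun z _ hz0 => h z hz0
    refine ⟨fun v => m (Finsupp.single v 1), fun i => ?_⟩
    rw [hm _ trivial, boundaryMap_single, map_add]
  · rintro ⟨b, hb⟩ z hz0
    have : l = Finsupp.linearCombination (ZMod 2) b ∘ₗ G.boundaryMap := by
      refine Finsupp.lhom_ext' fun i => LinearMap.ext_ring ?_
      simp [boundaryMap_single, hb]
    rw [this, LinearMap.comp_apply, LinearMap.mem_ker.1 hz0, map_zero]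

variable {G} in
-- Two primitives along an arc differ by a constant, so a global primitive increases along each arc
-- by the value of `l`. Conversely, the primitives along the arcs are glued by means of `b`.
theorem IsCoverMap.coarseOf_mem_coarseCoboundaries_iff
    {c : E → Option (Fin G.numEdges × Bool)} {ε : ℝ} (hc : G.IsCoverMap c ε)
    (l : Module.Dual (ZMod 2) (Fin G.numEdges →₀ ZMod 2)) :
    G.coarseOf c l ∈ coarseCoboundaries G.space ↔
      l ∈ (LinearMap.ker G.boundaryMap).dualAnnihilator := by
  rw [mem_dualAnnihilator_ker_boundaryMap]
  choose f hf hf' using hc.exists_primitive l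
  constructor
  · rintro ⟨F, η, hη, hF⟩
    refine ⟨F, fun i => ?_⟩
    obtain ⟨r, hr, hi⟩ := hf' i
    obtain ⟨q, hq, hu⟩ := Metric.uniformContinuous_iff.1
      (CompactSpace.uniformContinuous_of_continuous (G.arc i).continuous) η hη
    have := eq_of_forall_dist_lt (f := fun t => f i t + F (G.arc i t)) (lt_min hr hq)
      (fun s t hst => by
        have h1 := hi s t (hst.trans_le (min_le_left _ _))
        have h2 := hF _ (G.arc_mem_space i s) _ (G.arc_mem_space i t)
          (hu (hst.trans_le (min_le_right _ _)))
        grind) 0 1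
    have := hf i
    grind
  · rintro ⟨b, hb⟩
    exact G.mem_coarseCoboundaries_of_arcs (hc.coarseOf_mem l) f hf' b fun i => by rw [hf, hb]

variable {G} in
theorem IsCoverMap.exists_coarseOf_sub_mem
    {c : E → Option (Fin G.numEdges × Bool)} {ε : ℝ} (hc : G.IsCoverMap c ε)
    {φ : E → E → ZMod 2} (hφ : φ ∈ coarseCocycles G.space) :
    ∃ l, φ - G.coarseOf c l ∈ coarseCoboundaries G.space := by
  have hloc : ∀ i, ∃ f : unitInterval → ZMod 2, ∃ η > 0, ∀ s t, dist s t < η →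
      φ (G.arc i s) (G.arc i t) = f s + f t := by
    intro i
    -- The homotopy contracts the arc to its initial point, which makes `φ` a coboundary along the
    -- arc.
    have hcont : Continuous fun p : unitInterval × unitInterval => G.arc i (p.1 * p.2) := by
      fun_prop
    obtain ⟨f, η, hη, hf⟩ := exists_coarse_homotopy hφ _ hcont (fun p => G.arc_mem_space i _)
    obtain ⟨-, -, h0, -⟩ := exists_of_mem_coarseCocycles hφ
    refine ⟨f, η, hη, fun s t hst => ?_⟩
    simpa [h0 _ (G.arc_mem_space i 0)] using hf s t hst
  choose f hf using hloc
  -- With these values the corrected primitives have equal values at both ends of each arc, so the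
  -- vertex function can be taken to be zero.
  let l : Module.Dual (ZMod 2) (Fin G.numEdges →₀ ZMod 2) :=
    Finsupp.linearCombination (ZMod 2) fun i => f i 0 + f i 1
  choose g hg hg' using hc.exists_primitive l
  refine ⟨l, G.mem_coarseCoboundaries_of_arcs (Submodule.sub_mem _ hφ (hc.coarseOf_mem l))
    (fun i t => f i t + g i t) (fun i => ?_) 0 fun i => ?_⟩
  · obtain ⟨r, hr, h1⟩ := hf i
    obtain ⟨q, hq, h2⟩ := hg' i
    refine ⟨min r q, lt_min hr hq, fun s t hst => ?_⟩
    have k1 := h1 s t (hst.trans_le (min_le_left _ _))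
    have k2 := h2 s t (hst.trans_le (min_le_right _ _))
    simp only [Pi.sub_apply]
    grind
  · have := hg i
    have h2 : l (Finsupp.single i 1) = f i 0 + f i 1 := by simp [l]
    simp only [Pi.zero_apply]
    grind

/-- The dimension of the first coarse cohomology of a graph is its first Betti number. -/
theorem finrank_coarse_eq_betti :
    Module.finrank (ZMod 2) ((coarseCocycles G.space).map (coarseCoboundaries G.space).mkQ) =
      G.betti := by
  obtain ⟨c, ε, hc⟩ := G.exists_isCoverMap
  -- A graph has no cells of dimension two, hence no boundaries in dimension one.
  have := finrank_map_mkQ_add_finrank (B := ⊥) (C := LinearMap.ker G.boundaryMap) bot_le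
    (G.coarseOf c) (coarseCocycles G.space) (coarseCoboundaries G.space)
    (fun l _ => hc.coarseOf_mem l) (fun l _ => hc.coarseOf_mem_coarseCoboundaries_iff l)
    (fun φ hφ => by
      obtain ⟨l, hl⟩ := hc.exists_coarseOf_sub_mem hφ
      exact ⟨l, by simp, hl⟩)
  rw [betti_eq, ← this, finrank_bot, add_zero]

end Cohomology

end GeometricGraph

/-! ### Deformation retractions -/

section Retract

variable {E : Type*} [MetricSpace E] {X A : Set E}

/-- By homotopy invariance, pulling back along the retraction changes a cocycle only by a
coboundary. The homotopy may move `A`, as only its two ends matter. -/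
theorem DeformationRetractsTo.exists_retraction (h : DeformationRetractsTo X A)
    (hX : IsCompact X) : ∃ r : E → E, ContinuousOn r X ∧ (∀ x ∈ X, r x ∈ A) ∧
      (∀ x ∈ A, r x = x) ∧ ∀ φ ∈ coarseCocycles X,
        φ - (fun x y => φ (r x) (r y)) ∈ coarseCoboundaries X := by
  classical
  obtain ⟨hAX, H, h0, h1, h2⟩ := h
  have := isCompact_iff_compactSpace.1 hX
  refine ⟨fun x => if hx : x ∈ X then H (⟨x, hx⟩, 1) else x, ?_, ?_, ?_, ?_⟩
  · rw [continuousOn_iff_continuous_domRestrict]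
    have : Continuous fun x : X => (H (x, 1) : E) := by fun_prop
    convert this using 2 with x
    simp
  · intro x hx
    simpa [hx] using h1 ⟨x, hx⟩
  · intro x hx
    simpa [hAX hx] using congrArg Subtype.val (h2 ⟨x, hAX hx⟩ hx)
  · intro φ hφ
    obtain ⟨f, ε, hε, hf⟩ := exists_coarse_homotopy hφ (fun p => (H p : E)) (by fun_prop)
      (fun p => (H p).2)
    refine ⟨fun x => if hx : x ∈ X then f ⟨x, hx⟩ else 0, ε, hε, fun x hx y hy hxy => ?_⟩
    have := hf ⟨x, hx⟩ ⟨y, hy⟩ hxy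
    simp only [h0] at this
    simp only [Pi.sub_apply, dif_pos hx, dif_pos hy, this]
    grind

/-- The track of each point under the homotopy joins it to `A`. -/
theorem DeformationRetractsTo.isPreconnected (h : DeformationRetractsTo X A)
    (hA : IsPreconnected A) : IsPreconnected X := by
  obtain ⟨hAX, H, h0, h1, h2⟩ := h
  refine isPreconnected_of_forall_pair fun x hx y hy => ?_
  let P : X → Set E := fun x => Set.range fun t : unitInterval => (H (x, t) : E)
  have hP : ∀ x, IsPreconnected (P x) := fun x => isPreconnected_range (by fun_prop)
  have e1 : (H (⟨x, hx⟩, 1) : E) ∈ P ⟨x, hx⟩ := ⟨1, rfl⟩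
  have e2 : (H (⟨y, hy⟩, 1) : E) ∈ P ⟨y, hy⟩ := ⟨1, rfl⟩
  refine ⟨(P ⟨x, hx⟩ ∪ A) ∪ P ⟨y, hy⟩, ?_, ?_, ?_, ?_⟩
  · rintro z ((⟨t, rfl⟩ | hz) | ⟨t, rfl⟩)
    exacts [(H _).2, hAX hz, (H _).2]
  · exact Or.inl (Or.inl ⟨0, by simp [h0]⟩)
  · exact Or.inr ⟨0, by simp [h0]⟩
  · exact IsPreconnected.union _ (Or.inr (h1 ⟨y, hy⟩)) e2
      (IsPreconnected.union _ e1 (h1 ⟨x, hx⟩) (hP _) hA) (hP _)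

end Retract

/-- The first homology of a finite simplicial complex which deformation retracts to a graph has the
dimension of the first homology of the graph. -/
theorem betti_add_finrank_boundaries {E : Type*} [NormedAddCommGroup E] [NormedSpace ℝ E]
    {L : Geometry.SimplicialComplex ℝ E} (hL : L.faces.Finite) {G : GeometricGraph E}
    (h : DeformationRetractsTo L.space G.space) (hBC : boundaries L.faces 2 ≤ cycles L.faces 2)
    [FiniteDimensional (ZMod 2) (cycles L.faces 2)] :
    G.betti + Module.finrank (ZMod 2) (boundaries L.faces 2) =
      Module.finrank (ZMod 2) (cycles L.faces 2) := by
  obtain ⟨c, ε, hc⟩ := exists_isVertexMap hL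
  obtain ⟨r, hr, hrA, hrid, hrφ⟩ := h.exists_retraction (isCompact_space hL)
  have hu := (isCompact_space hL).uniformContinuousOn_of_continuous hr
  rw [Metric.uniformContinuousOn_iff] at hu
  have hpullZ : ∀ φ ∈ coarseCocycles G.space,
      (fun x y => φ (r x) (r y)) ∈ coarseCocycles L.space := by
    rintro φ ⟨η, hη, hφ⟩
    obtain ⟨q, hq, hu⟩ := hu η hη
    exact ⟨q, hq, fun x hx y hy z hz hxy hyz hxz => hφ _ (hrA x hx) _ (hrA y hy) _ (hrA z hz)
      (hu x hx y hy hxy) (hu y hy z hz hyz) (hu x hx z hz hxz)⟩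
  have hpullB : ∀ φ ∈ coarseCoboundaries G.space,
      (fun x y => φ (r x) (r y)) ∈ coarseCoboundaries L.space := by
    rintro φ ⟨f, η, hη, hφ⟩
    obtain ⟨q, hq, hu⟩ := hu η hη
    exact ⟨fun x => f (r x), q, hq, fun x hx y hy hxy => hφ _ (hrA x hx) _ (hrA y hy)
      (hu x hx y hy hxy)⟩
  rw [← G.finrank_coarse_eq_betti]
  refine finrank_map_mkQ_add_finrank hBC (coarseOf c) _ _ (fun l hl => ?_) (fun l hl => ?_)
    fun φ hφ => ?_
  · exact coarseCocycles_anti h.1 (coarseOf_mem_coarseCocycles hc hl)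
  · rw [← coarseOf_mem_coarseCoboundaries_iff hc]
    -- A primitive on the graph is pulled back along `r`; the cocycle on `L` differs from the
    -- pullback of its restriction by a coboundary.
    refine ⟨fun hB => ?_, fun hB => coarseCoboundaries_anti h.1 hB⟩
    have := Submodule.add_mem _ (hrφ _ (coarseOf_mem_coarseCocycles hc hl)) (hpullB _ hB)
    simpa using this
  · obtain ⟨l, hl, hB⟩ := GraphReconstruction.exists_coarseOf_sub_mem hc (hpullZ φ hφ)
    refine ⟨l, hl, ?_⟩
    obtain ⟨f, η, hη, hf⟩ := coarseCoboundaries_anti h.1 hB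
    refine ⟨f, η, hη, fun x hx y hy hxy => ?_⟩
    have := hf x hx y hy hxy
    simpa [hrid x hx, hrid y hy] using this

/-! ### Persistence pairs and leading terms -/

section Leads

variable {V : Type*} {N : ℕ}

/-- The positions of the last simplices of the nonzero chains in `W`. -/
def leads (S : Fin N → Finset V) (W : Submodule (ZMod 2) (Finset V →₀ ZMod 2)) : Set (Fin N) :=
  {i | ∃ w ∈ W, w (S i) ≠ 0 ∧ ∀ k, i < k → w (S k) = 0}

theorem leads_mono (S : Fin N → Finset V) {W W' : Submodule (ZMod 2) (Finset V →₀ ZMod 2)}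
    (h : W ≤ W') : leads S W ⊆ leads S W' := fun _ ⟨w, hw, h1⟩ => ⟨w, h hw, h1⟩

theorem finiteDimensional_of_le_supported {s : Set (Finset V)} (hs : s.Finite)
    {W : Submodule (ZMod 2) (Finset V →₀ ZMod 2)}
    (hW : W ≤ Finsupp.supported (ZMod 2) (ZMod 2) s) : FiniteDimensional (ZMod 2) W := by
  have := hs.to_subtype
  have : FiniteDimensional (ZMod 2) (Finsupp.supported (ZMod 2) (ZMod 2) s) :=
    Module.Finite.equiv (Finsupp.supportedEquivFinsupp s).symm
  exact Submodule.finiteDimensional_of_le hW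

/-- The number of leading positions is the dimension. -/
theorem ncard_leads {S : Fin N → Finset V} {W : Submodule (ZMod 2) (Finset V →₀ ZMod 2)}
    (hW : W ≤ Finsupp.supported (ZMod 2) (ZMod 2) (Set.range S)) :
    (leads S W).ncard = Module.finrank (ZMod 2) W := by
  have hfd := finiteDimensional_of_le_supported (Set.finite_range S) hW
  -- `T k` consists of the chains of `W` living on positions below `k`. From `T k` to `T (k + 1)`
  -- the dimension grows by at most one, and it grows exactly when `k` is a lead.
  let T : ℕ → Submodule (ZMod 2) (Finset V →₀ ZMod 2) := fun k =>
    W ⊓ ⨅ j : {j : Fin N // k ≤ j}, LinearMap.ker (Finsupp.lapply (S j))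
  have hT : ∀ k w, w ∈ T k ↔ w ∈ W ∧ ∀ j : Fin N, k ≤ j → w (S j) = 0 := by
    intro k w
    simp [T, Submodule.mem_iInf]
  have hTle : ∀ k, T k ≤ W := fun k => inf_le_left
  have key : ∀ k ≤ N, (leads S W ∩ {i | (i : ℕ) < k}).ncard = Module.finrank (ZMod 2) (T k) := by
    intro k hk
    induction k with
    | zero =>
      have : T 0 = ⊥ := by
        rw [eq_bot_iff]
        intro w hw
        rw [hT] at hw
        rw [Submodule.mem_bot]
        ext σ
        by_contra h
        obtain ⟨j, rfl⟩ := hW hw.1 (Finsupp.mem_support_iff.2 h)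
        exact h (hw.2 j (Nat.zero_le _))
      rw [this, finrank_bot]
      simp
    | succ k ih =>
      let kk : Fin N := ⟨k, hk⟩
      have hfd' : FiniteDimensional (ZMod 2) (T (k + 1)) := Submodule.finiteDimensional_of_le (hTle _)
      let ev : T (k + 1) →ₗ[ZMod 2] ZMod 2 := Finsupp.lapply (S kk) ∘ₗ (T (k + 1)).subtype
      have hle : T k ≤ T (k + 1) := fun w hw =>
        (hT _ _).2 ⟨((hT _ _).1 hw).1, fun j hj => ((hT _ _).1 hw).2 j (by omega)⟩
      have hker : LinearMap.ker ev = (T k).comap (T (k + 1)).subtype := by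
        ext ⟨w, hw⟩
        rw [LinearMap.mem_ker, Submodule.mem_comap]
        simp only [ev, LinearMap.comp_apply, Submodule.subtype_apply, Finsupp.lapply_apply, hT]
        constructor
        · intro h
          refine ⟨((hT _ _).1 hw).1, fun j hj => ?_⟩
          rcases hj.eq_or_lt with h' | h'
          · rwa [show j = kk from Fin.ext h'.symm]
          · exact ((hT _ _).1 hw).2 j h'
        · intro h
          exact h.2 kk le_rfl
      have hrk := LinearMap.finrank_range_add_finrank_ker ev
      rw [hker, (Submodule.comapSubtypeEquivOfLe hle).finrank_eq, ← ih (by omega)] at hrk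
      rw [← hrk]
      by_cases hl : kk ∈ leads S W
      · have h1 : LinearMap.range ev = ⊤ := by
          obtain ⟨w, hw, h1, h2⟩ := hl
          have hwT : w ∈ T (k + 1) := (hT _ _).2 ⟨hw, fun j hj => h2 j (Fin.lt_def.2 hj)⟩
          refine LinearMap.range_eq_top.2 fun a => ⟨(a / w (S kk)) • ⟨w, hwT⟩, ?_⟩
          rw [map_smul]
          exact div_mul_cancel₀ a h1
        have h2 : leads S W ∩ {i | (i : ℕ) < k + 1} =
            insert kk (leads S W ∩ {i | (i : ℕ) < k}) := by
          ext i
          simp only [Set.mem_inter_iff, Set.mem_ofPred_eq, Set.mem_insert_iff]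
          constructor
          · rintro ⟨h3, h4⟩
            rcases Nat.lt_succ_iff_lt_or_eq.1 h4 with h5 | h5
            · exact Or.inr ⟨h3, h5⟩
            · exact Or.inl (Fin.ext h5)
          · rintro (rfl | ⟨h3, h4⟩)
            · exact ⟨hl, Nat.lt_succ_self k⟩
            · exact ⟨h3, by omega⟩
        rw [h1, finrank_top, Module.finrank_self, h2, Set.ncard_insert_of_notMem (by simp [kk]),
          add_comm]
      · have h1 : LinearMap.range ev = ⊥ := by
          rw [eq_bot_iff]
          rintro _ ⟨⟨w, hw⟩, rfl⟩
          rw [Submodule.mem_bot]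
          by_contra h
          exact hl ⟨w, ((hT _ _).1 hw).1, h, fun j hj => ((hT _ _).1 hw).2 j (Fin.lt_def.1 hj)⟩
        have h2 : leads S W ∩ {i | (i : ℕ) < k + 1} = leads S W ∩ {i | (i : ℕ) < k} := by
          ext i
          simp only [Set.mem_inter_iff, Set.mem_ofPred_eq]
          refine ⟨fun ⟨h3, h4⟩ => ⟨h3, ?_⟩, fun ⟨h3, h4⟩ => ⟨h3, by omega⟩⟩
          rcases Nat.lt_succ_iff_lt_or_eq.1 h4 with h5 | h5
          · exact h5
          · exact absurd (show kk ∈ leads S W from (Fin.ext h5 : i = kk) ▸ h3) hl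
        rw [h1, finrank_bot, h2, zero_add]
  have h1 : leads S W ∩ {i | (i : ℕ) < N} = leads S W :=
    Set.inter_eq_left.2 fun i _ => i.2
  have h2 : T N = W := le_antisymm (hTle _) fun w hw =>
    (hT _ _).2 ⟨hw, fun j hj => absurd j.2 (by omega)⟩
  rw [← h1, key N le_rfl, h2]

end Leads

/-! ### The boundary operator squares to zero -/

section Boundary

variable {V : Type*}

theorem chains_mono {L L' : Set (Finset V)} (h : L ⊆ L') (n : ℕ) : chains L n ≤ chains L' n :=
  Finsupp.supported_mono fun _ hσ => ⟨h hσ.1, hσ.2⟩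

theorem cycles_mono {L L' : Set (Finset V)} (h : L ⊆ L') (n : ℕ) : cycles L n ≤ cycles L' n :=
  inf_le_inf_right _ (chains_mono h n)

theorem boundaries_mono {L L' : Set (Finset V)} (h : L ⊆ L') (n : ℕ) :
    boundaries L n ≤ boundaries L' n :=
  Submodule.map_mono (chains_mono h _)

theorem boundary_boundary_single (σ : Finset V) :
    boundary (boundary (Finsupp.single σ 1)) = 0 := by
  classical
  by_cases h2 : 2 ≤ σ.card
  swap
  · rw [boundary_single_of_card_le_one (by omega), map_zero]
  rw [boundary_single h2, map_sum]
  by_cases h3 : 3 ≤ σ.card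
  swap
  · refine Finset.sum_eq_zero fun v hv => boundary_single_of_card_le_one ?_ _
    rw [Finset.card_erase_of_mem hv]; omega
  have : ∀ v ∈ σ, boundary (Finsupp.single (σ.erase v) 1) =
      ∑ w ∈ σ.erase v, Finsupp.single ((σ.erase v).erase w) 1 := fun v hv =>
    boundary_single (by rw [Finset.card_erase_of_mem hv]; omega)
  rw [Finset.sum_congr rfl this, Finset.sum_sigma']
  -- Removing two vertices in either order gives the same face, so the terms cancel in pairs.
  refine Finset.sum_involution (fun p _ => ⟨p.2, p.1⟩) ?_ ?_ ?_ ?_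
  · rintro ⟨v, w⟩ hp
    simp only
    rw [Finset.erase_right_comm, ← Finsupp.single_add, CharTwo.add_self_eq_zero,
      Finsupp.single_zero]
  · rintro ⟨v, w⟩ hp - h
    simp only [Finset.mem_sigma, Finset.mem_erase, Sigma.mk.injEq] at hp h
    exact hp.2.1 h.1
  · rintro ⟨v, w⟩ hp
    simp only [Finset.mem_sigma, Finset.mem_erase] at hp ⊢
    exact ⟨hp.2.2, hp.2.1.symm, hp.1⟩
  · rintro ⟨v, w⟩ hp
    rfl

theorem boundaries_le_cycles {L : Set (Finset V)}
    (hL : ∀ σ ∈ L, ∀ τ, τ ⊆ σ → τ.Nonempty → τ ∈ L) {n : ℕ} (hn : 1 ≤ n) :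
    boundaries L n ≤ cycles L n := by
  classical
  rw [boundaries, Submodule.map_le_iff_le_comap, chains_eq_span, Submodule.span_le]
  rintro _ ⟨σ, ⟨hσ, hc⟩, rfl⟩
  refine ⟨?_, boundary_boundary_single σ⟩
  rw [boundary_single (by omega)]
  refine Submodule.sum_mem _ fun v hv => single_mem_chains (hL σ hσ _ (Finset.erase_subset _ _) ?_)
    ?_ 1
  · rw [← Finset.card_pos, Finset.card_erase_of_mem hv]; omega
  · rw [Finset.card_erase_of_mem hv]; omega

end Boundary

/-- `S` enumerates the simplices of a simplicial complex, faces preceding cofaces. -/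
structure IsSimplexwise {V : Type*} {N : ℕ} (S : Fin N → Finset V) : Prop where
  injective : Function.Injective S
  face_lt : ∀ i j, S i ⊂ S j → i < j
  nonempty : ∀ i, (S i).Nonempty
  down_closed : ∀ i τ, τ ⊆ S i → τ.Nonempty → τ ∈ Set.range S

section Pairs

variable {V : Type*} {N : ℕ} {S : Fin N → Finset V}

theorem prefixComplex_mono (S : Fin N → Finset V) {a b : ℕ} (h : a ≤ b) :
    prefixComplex S a ⊆ prefixComplex S b := fun _ ⟨j, hj, e⟩ => ⟨j, by omega, e⟩

theorem prefixComplex_subset_range (S : Fin N → Finset V) (k : ℕ) :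
    prefixComplex S k ⊆ Set.range S := fun _ ⟨j, _, e⟩ => ⟨j, e⟩

theorem prefixComplex_length (S : Fin N → Finset V) : prefixComplex S N = Set.range S :=
  Set.Subset.antisymm (prefixComplex_subset_range S N) fun _ ⟨j, e⟩ => ⟨j, j.2, e⟩

theorem cycles_le_supported {L : Set (Finset V)} (hL : L ⊆ Set.range S) (n : ℕ) :
    cycles L n ≤ Finsupp.supported (ZMod 2) (ZMod 2) (Set.range S) :=
  inf_le_left.trans (Finsupp.supported_mono fun _ h => hL h.1)

namespace IsSimplexwise


theorem mem_prefixComplex (hS : IsSimplexwise S) {i : Fin N} {k : ℕ} : S i ∈ prefixComplex S k ↔ (i : ℕ) < k :=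
  ⟨fun ⟨_, hj, e⟩ => hS.injective e ▸ hj, fun h => ⟨i, h, rfl⟩⟩

theorem prefixComplex_down_closed (hS : IsSimplexwise S) (k : ℕ) : ∀ σ ∈ prefixComplex S k, ∀ τ, τ ⊆ σ → τ.Nonempty →
    τ ∈ prefixComplex S k := by
  rintro _ ⟨i, hi, rfl⟩ τ hτ hne
  obtain ⟨j, rfl⟩ := hS.down_closed i τ hτ hne
  rcases hτ.ssubset_or_eq with h | h
  · have := Fin.lt_def.1 (hS.face_lt j i h)
    exact ⟨j, by omega, rfl⟩
  · exact ⟨i, hi, h.symm⟩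

theorem boundaries_le_cycles (hS : IsSimplexwise S) (k : ℕ) {n : ℕ} (hn : 1 ≤ n) :
    boundaries (prefixComplex S k) n ≤ cycles (prefixComplex S k) n :=
  GraphReconstruction.boundaries_le_cycles (hS.prefixComplex_down_closed k) hn

theorem mem_chains_prefix_of_forall {z : Finset V →₀ ZMod 2} {n b k : ℕ}
    (hz : z ∈ chains (prefixComplex S b) n) (h : ∀ j : Fin N, k ≤ j → z (S j) = 0) :
    z ∈ chains (prefixComplex S k) n := by
  intro σ hσ
  obtain ⟨⟨j, -, rfl⟩, hn⟩ := hz hσ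
  refine ⟨⟨j, ?_, rfl⟩, hn⟩
  by_contra hj
  exact (Finsupp.mem_support_iff.1 hσ) (h j (not_lt.1 hj))

theorem apply_eq_zero_of_mem_chains_prefix (hS : IsSimplexwise S) {z : Finset V →₀ ZMod 2} {n k : ℕ}
    (hz : z ∈ chains (prefixComplex S k) n) {j : Fin N} (hj : k ≤ j) : z (S j) = 0 := by
  by_contra h
  have := (hS.mem_prefixComplex (i := j)).1 (hz (Finsupp.mem_support_iff.2 h)).1
  omega

theorem card_of_mem_leads {L : Set (Finset V)} {n : ℕ}
    {W : Submodule (ZMod 2) (Finset V →₀ ZMod 2)} (hW : W ≤ chains L n) {i : Fin N}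
    (hi : i ∈ leads S W) : S i ∈ L ∧ (S i).card = n := by
  obtain ⟨w, hw, h, -⟩ := hi
  exact hW hw (Finsupp.mem_support_iff.2 h)

/-- `S i` is paired with `S j` if and only if a chain with last simplex `S i` becomes a boundary
when `S j` is added. -/
theorem persistencePair_iff (hS : IsSimplexwise S) {i j : Fin N} : PersistencePair S i j ↔
    i ∈ leads S (boundaries (prefixComplex S (j + 1)) (S i).card) ∧
    i ∉ leads S (boundaries (prefixComplex S j) (S i).card) := by
  have hpos : 1 ≤ (S i).card := (hS.nonempty i).card_pos
  have hone : ∀ a : ZMod 2, a ≠ 0 → a = 1 := by decide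
  constructor
  · rintro ⟨hij, z, hz, hno, w, hw, c, hc, hzw⟩
    have hd : boundary c ∈ boundaries (prefixComplex S (j + 1)) (S i).card :=
      Submodule.mem_map_of_mem hc
    have hw0 : ∀ k : Fin N, i ≤ k → w (S k) = 0 := fun k hk =>
      hS.apply_eq_zero_of_mem_chains_prefix hw.1 (Fin.le_def.1 hk)
    -- Otherwise `z` itself would be a cycle of the complex preceding `S i`.
    have hzi : z (S i) ≠ 0 := by
      intro h0
      refine hno ⟨z, ⟨mem_chains_prefix_of_forall hz.1 fun k hk => ?_, hz.2⟩, 0,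
        Submodule.zero_mem _, by simp⟩
      rcases hk.eq_or_lt with h | h
      · rwa [show k = i from Fin.ext h.symm]
      · exact hS.apply_eq_zero_of_mem_chains_prefix hz.1 h
    refine ⟨⟨boundary c, hd, ?_, fun k hk => ?_⟩, ?_⟩
    · rw [← hzw, Finsupp.sub_apply, hw0 i le_rfl, sub_zero]
      exact hzi
    · rw [← hzw, Finsupp.sub_apply, hw0 k hk.le, sub_zero]
      exact hS.apply_eq_zero_of_mem_chains_prefix hz.1 (Fin.lt_def.1 hk)
    · rintro ⟨_, ⟨c', hc', rfl⟩, h1, h2⟩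
      -- If `S i` already led a boundary before stage `j`, subtracting it would cancel the leading
      -- term of `z`, as nonzero coefficients are `1`, and would make `z` homologous to an earlier
      -- cycle.
      have hcyc := hS.boundaries_le_cycles (j : ℕ) hpos (Submodule.mem_map_of_mem hc')
      have hz' := cycles_mono (prefixComplex_mono S (show (i : ℕ) + 1 ≤ j from hij)) _ hz
      have hsub : z - boundary c' ∈ cycles (prefixComplex S j) (S i).card :=
        Submodule.sub_mem _ hz' hcyc
      refine hno ⟨z - boundary c', ⟨mem_chains_prefix_of_forall hsub.1 fun k hk => ?_, hsub.2⟩,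
        c', hc', by abel⟩
      rw [Finsupp.sub_apply]
      rcases hk.eq_or_lt with h | h
      · rw [show k = i from Fin.ext h.symm, hone _ hzi, hone _ h1, sub_self]
      · rw [h2 k h, hS.apply_eq_zero_of_mem_chains_prefix hz.1 h, sub_zero]
  · rintro ⟨⟨_, ⟨c, hc, rfl⟩, h1, h2⟩, hno⟩
    have hcyc := hS.boundaries_le_cycles ((j : ℕ) + 1) hpos (Submodule.mem_map_of_mem hc)
    have hcyc' : boundary c ∈ cycles (prefixComplex S (i + 1)) (S i).card :=
      ⟨mem_chains_prefix_of_forall hcyc.1 fun k hk => h2 k (Fin.lt_def.2 hk), hcyc.2⟩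
    have hnotj : boundary c ∉ boundaries (prefixComplex S j) (S i).card := fun h =>
      hno ⟨boundary c, h, h1, h2⟩
    -- If `j ≤ i`, no simplex up to `S j` has `S i` as a face, so the boundary could not involve `S
    -- i`.
    have hij : i < j := by
      classical
      rw [chains_eq_span] at hc
      by_contra hji
      apply h1
      have : ∀ c ∈ Submodule.span (ZMod 2) ((fun σ => Finsupp.single σ (1 : ZMod 2)) ''
          {σ | σ ∈ prefixComplex S (j + 1) ∧ σ.card = (S i).card + 1}),
          (boundary c) (S i) = 0 := by
        intro c hc
        suffices h : _ ≤ LinearMap.ker (Finsupp.lapply (S i) ∘ₗ boundary) from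
          LinearMap.mem_ker.1 (h hc)
        refine Submodule.span_le.2 ?_
        rintro _ ⟨_, ⟨⟨k, hk, rfl⟩, hcard⟩, rfl⟩
        simp only [SetLike.mem_coe, LinearMap.mem_ker, LinearMap.comp_apply,
          Finsupp.lapply_apply]
        rw [boundary_single (by omega), Finsupp.finsetSum_apply]
        refine Finset.sum_eq_zero fun v hv => ?_
        rw [Finsupp.single_apply_eq_zero]
        intro h
        have h3 := hS.face_lt i k (h ▸ Finset.erase_ssubset hv)
        exact absurd (Fin.lt_def.1 h3) (by have := Fin.le_def.1 (not_lt.1 hji); omega)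
      exact this c hc
    refine ⟨hij, boundary c, hcyc', ?_, 0, Submodule.zero_mem _, c, hc, by simp⟩
    rintro ⟨w, hw, c', hc', h⟩
    have hw0 : ∀ k : Fin N, i ≤ k → w (S k) = 0 := fun k hk =>
      hS.apply_eq_zero_of_mem_chains_prefix hw.1 (Fin.le_def.1 hk)
    refine hno ⟨boundary c', Submodule.mem_map_of_mem hc', ?_, fun k hk => ?_⟩
    · rw [← h, Finsupp.sub_apply, hw0 i le_rfl, sub_zero]; exact h1
    · rw [← h, Finsupp.sub_apply, hw0 k hk.le, sub_zero]; exact h2 k hk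

theorem boundaries_succ_of_card_ne {j : Fin N} {n : ℕ} (h : (S j).card ≠ n + 1) :
    boundaries (prefixComplex S (j + 1)) n = boundaries (prefixComplex S j) n := by
  refine le_antisymm (Submodule.map_mono (Finsupp.supported_mono ?_))
    (boundaries_mono (prefixComplex_mono S (Nat.le_succ _)) n)
  rintro _ ⟨⟨k, hk, rfl⟩, hc⟩
  refine ⟨⟨k, ?_, rfl⟩, hc⟩
  rcases Nat.lt_succ_iff_lt_or_eq.1 hk with h' | h'
  · exact h'
  · exact absurd (Fin.ext h' ▸ hc) h

/-- Adding `S j` enlarges the boundaries only in dimension one less than that of `S j`. -/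
theorem card_of_persistencePair (hS : IsSimplexwise S) {i j : Fin N} (h : PersistencePair S i j) :
    (S j).card = (S i).card + 1 := by
  by_contra hne
  obtain ⟨h1, h2⟩ := hS.persistencePair_iff.1 h
  rw [boundaries_succ_of_card_ne hne] at h1
  exact h2 h1

theorem boundaries_succ_of_boundary_mem {j : Fin N} {n : ℕ}
    (h : boundary (Finsupp.single (S j) 1) ∈ boundaries (prefixComplex S j) n) :
    boundaries (prefixComplex S (j + 1)) n = boundaries (prefixComplex S j) n := by
  refine le_antisymm ?_ (boundaries_mono (prefixComplex_mono S (Nat.le_succ _)) n)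
  rw [boundaries, Submodule.map_le_iff_le_comap, chains_eq_span, Submodule.span_le]
  rintro _ ⟨_, ⟨⟨k, hk, rfl⟩, hc⟩, rfl⟩
  rcases Nat.lt_succ_iff_lt_or_eq.1 hk with h' | h'
  · exact Submodule.mem_map_of_mem (single_mem_chains (L := prefixComplex S j) ⟨k, h', rfl⟩ hc 1)
  · rw [show k = j from Fin.ext h']
    exact h

/-- The boundary of the second simplex of a pair is not a boundary of preceding simplices. -/
theorem boundary_notMem_of_persistencePair (hS : IsSimplexwise S) {i j : Fin N} (h : PersistencePair S i j) :
    boundary (Finsupp.single (S j) 1) ∉ boundaries (prefixComplex S j) (S i).card := by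
  intro hb
  obtain ⟨h1, h2⟩ := hS.persistencePair_iff.1 h
  rw [boundaries_succ_of_boundary_mem hb] at h1
  exact h2 h1

/-- A simplex whose boundary is not a boundary of preceding simplices is the second simplex of a
pair. -/
theorem exists_persistencePair_right (hS : IsSimplexwise S) {j : Fin N} {n : ℕ} (hn : 1 ≤ n) (hj : (S j).card = n + 1)
    (h : boundary (Finsupp.single (S j) 1) ∉ boundaries (prefixComplex S j) n) :
    ∃ i, PersistencePair S i j ∧ (S i).card = n := by
  have hle := boundaries_mono (prefixComplex_mono S (Nat.le_succ (j : ℕ))) n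
  have hsup : ∀ k, boundaries (prefixComplex S k) n ≤
      Finsupp.supported (ZMod 2) (ZMod 2) (Set.range S) := fun k =>
    (hS.boundaries_le_cycles k hn).trans (cycles_le_supported (prefixComplex_subset_range S k) n)
  have hfd := finiteDimensional_of_le_supported (Set.finite_range S) (hsup (j + 1))
  -- The space of boundaries grows strictly when `S j` is added; leads count dimensions, so a new
  -- one appears.
  have hne : ¬ leads S (boundaries (prefixComplex S (j + 1)) n) ⊆
      leads S (boundaries (prefixComplex S j) n) := by
    intro hsub
    have h1 := Set.ncard_le_ncard hsub (Set.toFinite _)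
    rw [ncard_leads (hsup _), ncard_leads (hsup _)] at h1
    have h2 := Submodule.eq_of_le_of_finrank_le hle h1
    apply h
    rw [h2]
    exact Submodule.mem_map_of_mem 
      (single_mem_chains (L := prefixComplex S (j + 1)) ⟨j, Nat.lt_succ_self _, rfl⟩ hj 1)
  obtain ⟨i, hi1, hi2⟩ := Set.not_subset.1 hne
  have hc := (card_of_mem_leads ((hS.boundaries_le_cycles _ hn).trans inf_le_left) hi1).2
  refine ⟨i, hS.persistencePair_iff.2 ?_, hc⟩
  rw [hc]
  exact ⟨hi1, hi2⟩

/-- A chain with last simplex `S i` which becomes a boundary between two stages gives a pair. -/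
theorem exists_persistencePair_left (hS : IsSimplexwise S) {i : Fin N} {a b : ℕ} (hb : b ≤ N)
    (h1 : i ∈ leads S (boundaries (prefixComplex S b) (S i).card))
    (h2 : i ∉ leads S (boundaries (prefixComplex S a) (S i).card)) :
    ∃ j : Fin N, a ≤ j ∧ (j : ℕ) < b ∧ PersistencePair S i j := by
  induction b with
  | zero =>
    exact absurd (leads_mono S (boundaries_mono (prefixComplex_mono S (Nat.zero_le a)) _) h1) h2
  | succ b ih =>
    by_cases h : i ∈ leads S (boundaries (prefixComplex S b) (S i).card)
    · obtain ⟨j, hj1, hj2, hj3⟩ := ih (by omega) h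
      exact ⟨j, hj1, by omega, hj3⟩
    · refine ⟨⟨b, hb⟩, ?_, Nat.lt_succ_self b, hS.persistencePair_iff.2 ⟨h1, h⟩⟩
      by_contra hab
      exact h2 (leads_mono S (boundaries_mono (prefixComplex_mono S (by simp at hab; omega)) _) h1)

/-- The first simplices of the pairs `(S i, S j)` with `i < m ≤ j`, in a dimension in which the
whole complex has no homology, are counted by the homology of the first `m` simplices. -/
theorem ncard_persistencePair (hS : IsSimplexwise S) {m n : ℕ} (hn : 1 ≤ n)
    (hacyc : cycles (Set.range S) n ≤ boundaries (Set.range S) n) :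
    {i : Fin N | (i : ℕ) < m ∧ (S i).card = n ∧ ∃ j : Fin N, m ≤ j ∧ PersistencePair S i j}.ncard +
      Module.finrank (ZMod 2) (boundaries (prefixComplex S m) n) =
      Module.finrank (ZMod 2) (cycles (prefixComplex S m) n) := by
  have hle := hS.boundaries_le_cycles m hn
  have hsup := cycles_le_supported (prefixComplex_subset_range S m) n
  rw [← ncard_leads (hle.trans hsup), ← ncard_leads hsup]
  -- A pair crossing stage `m` makes `S i` the lead of a cycle living in the first `m` simplices but
  -- not yet of a boundary there. Conversely, such a cycle bounds in the whole complex, so its lead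
  -- is paired at stage `m` or later.
  have hset : {i : Fin N | (i : ℕ) < m ∧ (S i).card = n ∧
      ∃ j : Fin N, m ≤ j ∧ PersistencePair S i j} =
      leads S (cycles (prefixComplex S m) n) \ leads S (boundaries (prefixComplex S m) n) := by
    ext i
    constructor
    · rintro ⟨him, hc, j, hmj, hp⟩
      obtain ⟨h1, h2⟩ := hS.persistencePair_iff.1 hp
      rw [hc] at h1 h2
      refine ⟨?_, fun h => h2 (leads_mono S (boundaries_mono (prefixComplex_mono S hmj) n) h)⟩
      obtain ⟨w, hw, h3, h4⟩ := h1
      have hw' := hS.boundaries_le_cycles _ hn hw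
      exact ⟨w, ⟨mem_chains_prefix_of_forall hw'.1 fun k hk => h4 k (Fin.lt_def.2 (by omega)),
        hw'.2⟩, h3, h4⟩
    · rintro ⟨h1, h2⟩
      obtain ⟨h3, hc⟩ := card_of_mem_leads inf_le_left h1
      have h4 := leads_mono S ((cycles_mono (prefixComplex_subset_range S m) n).trans hacyc) h1
      rw [← prefixComplex_length, ← hc] at h4
      rw [← hc] at h2
      obtain ⟨j, hj, -, hp⟩ := hS.exists_persistencePair_left le_rfl h4 h2
      exact ⟨hS.mem_prefixComplex.1 h3, hc, j, hj, hp⟩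
  rw [hset]
  exact Set.ncard_sdiff_add_ncard_of_subset (leads_mono S hle) (Set.toFinite _)

end IsSimplexwise

end Pairs

/-! ### Homotopy theory of graphs -/

section Square

variable {Y : Type*} [TopologicalSpace Y]

theorem Path.trans_apply_of_eq_half {a b c : Y} (p : Path a b) (q : Path b c)
    {s u : unitInterval} (h : (u : ℝ) = s / 2) : p.trans q u = p s := by
  have hs := s.2.2
  rw [Path.trans_apply, dif_pos (by rw [h]; linarith)]
  congr 1
  ext
  simp [h]; ring

theorem Path.trans_apply_of_eq_one_add_half {a b c : Y} (p : Path a b) (q : Path b c)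
    {s u : unitInterval} (h : (u : ℝ) = (1 + s) / 2) : p.trans q u = q s := by
  have hs := s.2.1
  rw [Path.trans_apply]
  split_ifs with h'
  · have hs0 : (s : ℝ) = 0 := by linarith
    have h0 : s = 0 := Subtype.ext hs0
    subst h0
    have h1 : (⟨2 * (u : ℝ), (unitInterval.mul_pos_mem_iff zero_lt_two).2 ⟨u.2.1, h'⟩⟩ :
        unitInterval) = 1 := by
      ext; simp [h]
    rw [h1]; simp
  · congr 1
    ext
    simp [h]; ring

/-- When `H` is constant on the slice at `u x`, compactness of the interval sends all nearby slices
into any given neighbourhood of that value. No continuity of `l` is required. -/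
theorem tendsto_of_forall_eq {X : Type*} [TopologicalSpace X]
    (H : C(unitInterval × unitInterval, Y)) (l u : X → unitInterval) {x : X} {y : Y}
    (hu : ContinuousAt u x) (hy : ∀ r, H (r, u x) = y) :
    Filter.Tendsto (fun z => H (l z, u z)) (nhds x) (nhds y) := by
  let c : C(unitInterval, C(unitInterval, Y)) := (H.comp ContinuousMap.prodSwap).curry
  rw [tendsto_nhds]
  intro W hW hyW
  have h1 : {g : C(unitInterval, Y) | Set.MapsTo g Set.univ W} ∈ nhds (c (u x)) :=
    (ContinuousMap.isOpen_setOfPred_mapsTo isCompact_univ hW).mem_nhds fun r _ => by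
      have : c (u x) r = y := hy r
      rw [this]; exact hyW
  filter_upwards [(c.continuous.continuousAt.comp hu) h1] with z hz
  exact hz (Set.mem_univ (l z))

/-- A homotopy between the two composites along the sides of a square fills the square. -/
theorem exists_square {a b c d : Y} {α : Path a b} {q' : Path b d} {q : Path a c} {γ : Path c d}
    (h : (α.trans q').Homotopic (q.trans γ)) :
    ∃ Q : C(unitInterval × unitInterval, Y), (∀ s, Q (s, 0) = α s) ∧ (∀ s, Q (s, 1) = γ s) ∧
      (∀ t, Q (0, t) = q t) ∧ ∀ t, Q (1, t) = q' t := by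
  obtain ⟨H⟩ := h
  -- `A` vanishes on the sides mapped by `α` and `q'`, `B` on the other two. The path parameter `u`
  -- increases along all sides, and `l = A / (A + B)` sends the two pairs of sides to the two ends
  -- of the homotopy.
  let A : unitInterval × unitInterval → ℝ := fun p => p.2 * (1 - p.1)
  let B : unitInterval × unitInterval → ℝ := fun p => p.1 * (1 - p.2)
  let l : unitInterval × unitInterval → unitInterval := fun p =>
    Set.projIcc 0 1 zero_le_one (A p / (A p + B p))
  let u : unitInterval × unitInterval → unitInterval := fun p =>
    ⟨((p.1 : ℝ) + p.2) / 2, by have := p.1.2.1; have := p.2.2.1; linarith,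
      by have := p.1.2.2; have := p.2.2.2; linarith⟩
  have hu : Continuous u := by fun_prop
  have hA : Continuous A := by fun_prop
  have hB : Continuous B := by fun_prop
  have hH0 : ∀ r, H (r, 0) = a := fun r => H.source r
  have hH1 : ∀ r, H (r, 1) = d := fun r => H.target r
  have hcorner : ∀ p, A p + B p = 0 → u p = 0 ∨ u p = 1 := by
    rintro ⟨s, t⟩ h0
    have hs := s.2.1; have hs' := s.2.2; have ht := t.2.1; have ht' := t.2.2
    have e1 : (t : ℝ) * (1 - s) = 0 := by simp only [A, B] at h0; nlinarith
    have e2 : (s : ℝ) * (1 - t) = 0 := by simp only [A, B] at h0; nlinarith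
    rcases mul_eq_zero.1 e1 with h1 | h1
    · left
      rw [h1] at e2
      ext; simp only [u, h1, Set.Icc.coe_zero]; linarith
    · right
      have h2 : (s : ℝ) = 1 := by linarith
      rw [h2] at e2
      ext; simp only [u, h2, Set.Icc.coe_one]; linarith
  -- The quotient defining `l` degenerates only at the corners $(0,0)$ and $(1,1)$, where `u` is `0`
  -- or `1` and `H` does not depend on its first argument.
  have hcont : Continuous fun p => H (l p, u p) := by
    rw [continuous_iff_continuousAt]
    intro p
    by_cases h0 : A p + B p = 0
    · rcases hcorner p h0 with h1 | h1
      · have := tendsto_of_forall_eq (H : C(unitInterval × unitInterval, Y)) l u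
          hu.continuousAt (x := p) (y := a) (by rw [h1]; exact hH0)
        rw [ContinuousAt, h1, hH0]
        exact this
      · have := tendsto_of_forall_eq (H : C(unitInterval × unitInterval, Y)) l u
          hu.continuousAt (x := p) (y := d) (by rw [h1]; exact hH1)
        rw [ContinuousAt, h1, hH1]
        exact this
    · refine (map_continuous H).continuousAt.comp (ContinuousAt.prodMk ?_ hu.continuousAt)
      exact continuous_projIcc.continuousAt.comp
        (hA.continuousAt.div (hA.add hB).continuousAt h0)
  have hl0 : ∀ p, A p = 0 → l p = 0 := fun p hp => by
    simp only [l, hp, zero_div]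
    exact Set.projIcc_left zero_le_one
  have hl1 : ∀ p, B p = 0 → l p = 1 ∨ A p + B p = 0 := fun p hp => by
    by_cases h0 : A p = 0
    · right; rw [hp, h0, add_zero]
    · left
      simp only [l, hp, add_zero, div_self h0]
      exact Set.projIcc_right zero_le_one
  have hval1 : ∀ p, B p = 0 → H (l p, u p) = q.trans γ (u p) := fun p hp => by
    rcases hl1 p hp with h1 | h1
    · rw [h1]; exact H.apply_one _
    · rcases hcorner p h1 with h2 | h2
      · rw [h2, hH0]; simp
      · rw [h2, hH1]; simp
  have hval0 : ∀ p, A p = 0 → H (l p, u p) = α.trans q' (u p) := fun p hp => by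
    rw [hl0 p hp]; exact H.apply_zero _
  refine ⟨⟨_, hcont⟩, fun s => ?_, fun s => ?_, fun t => ?_, fun t => ?_⟩
  · exact (hval0 (s, 0) (by simp [A])).trans
      (Path.trans_apply_of_eq_half _ _ (by simp [u]))
  · exact (hval1 (s, 1) (by simp [B])).trans
      (Path.trans_apply_of_eq_one_add_half _ _ (by simp [u, add_comm]))
  · exact (hval1 (0, t) (by simp [B])).trans
      (Path.trans_apply_of_eq_half _ _ (by simp [u]))
  · exact (hval0 (1, t) (by simp [A])).trans
      (Path.trans_apply_of_eq_one_add_half _ _ (by simp [u]))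

end Square

namespace GeometricGraph

section Maps

variable {E : Type*} [TopologicalSpace E] (G : GeometricGraph E)

/-- The initial vertex of an arc. -/
def src (i : Fin G.numEdges) : G.vertices := ⟨G.arc i 0, G.arc_zero_mem i⟩

/-- The final vertex of an arc. -/
def tgt (i : Fin G.numEdges) : G.vertices := ⟨G.arc i 1, G.arc_one_mem i⟩

/-- A vertex as a point of the graph. -/
def vertexPoint (v : G.vertices) : G.space := ⟨v, G.vertex_mem_space v.2⟩

/-- An arc as a path in the graph. -/
def arcPath (i : Fin G.numEdges) : Path (G.vertexPoint (G.src i)) (G.vertexPoint (G.tgt i)) where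
  toFun t := ⟨G.arc i t, G.arc_mem_space i t⟩
  source' := rfl
  target' := rfl

theorem cases_space (x : G.space) :
    (∃ v, x = G.vertexPoint v) ∨ ∃ i t, x = G.arcPath i t := by
  obtain ⟨v | ⟨i, t⟩, rfl⟩ := G.surjective_param x
  · exact Or.inl ⟨v, rfl⟩
  · exact Or.inr ⟨i, t, rfl⟩

/-- A map out of a graph is defined by the images of the vertices and paths joining them. -/
theorem exists_map [T2Space E] {Y : Type*} [TopologicalSpace Y] (y : G.vertices → Y)
    (p : ∀ i, Path (y (G.src i)) (y (G.tgt i))) :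
    ∃ f : C(G.space, Y), (∀ v, f (G.vertexPoint v) = y v) ∧ ∀ i t, f (G.arcPath i t) = p i t := by
  let F : G.vertices ⊕ Fin G.numEdges × unitInterval → Y :=
    Sum.elim y fun q => p q.1 q.2
  have hF : Continuous F := by
    refine Continuous.sumElim (by fun_prop) ?_
    rw [continuous_prod_of_discrete_left]
    exact fun i => (p i).continuous
  have hv : ∀ (v : G.vertices) i t, (v : E) = G.arc i t → y v = p i t := by
    rintro ⟨_, hv⟩ i t rfl
    rcases G.eq_zero_or_eq_one_of_arc_mem hv with rfl | rfl
    · exact (p i).source.symm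
    · exact (p i).target.symm
  have hfac : ∀ a b, G.param a = G.param b → F a = F b := by
    rintro (v | ⟨i, s⟩) (w | ⟨j, t⟩) h <;> replace h := congrArg Subtype.val h
    · exact congrArg y (Subtype.ext h)
    · exact hv v j t h
    · exact (hv w i s h.symm).symm
    · replace h : G.arc i s = G.arc j t := h
      by_cases hx : G.arc i s ∈ G.vertices
      · have hx' : G.arc j t ∈ G.vertices := h ▸ hx
        exact (hv ⟨_, hx⟩ i s rfl).symm.trans (hv ⟨_, hx⟩ j t h)
      · obtain ⟨rfl, rfl⟩ := G.eq_of_arc_eq hx h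
        rfl
  let f : C(G.space, Y) := Topology.IsQuotientMap.lift (f := ⟨G.param, G.continuous_param⟩)
    G.isQuotientMap_param ⟨F, hF⟩ hfac
  have hf : ∀ a, f (G.param a) = F a := fun a => by
    have := Topology.IsQuotientMap.lift_comp (f := ⟨G.param, G.continuous_param⟩)
      G.isQuotientMap_param ⟨F, hF⟩ hfac
    exact DFunLike.congr_fun this a
  exact ⟨f, fun v => hf (Sum.inl v), fun i t => hf (Sum.inr (i, t))⟩

/-- Two maps out of a graph are homotopic if their values at the vertices are joined by paths
which are compatible with the images of the arcs up to homotopy. -/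
theorem homotopic_of_arcs [T2Space E] {Y : Type*} [TopologicalSpace Y] {f g : C(G.space, Y)}
    (y y' : G.vertices → Y) (q : ∀ v, Path (y v) (y' v))
    (a : ∀ i, Path (y (G.src i)) (y (G.tgt i))) (b : ∀ i, Path (y' (G.src i)) (y' (G.tgt i)))
    (hfv : ∀ v, f (G.vertexPoint v) = y v) (hgv : ∀ v, g (G.vertexPoint v) = y' v)
    (hfa : ∀ i t, f (G.arcPath i t) = a i t) (hgb : ∀ i t, g (G.arcPath i t) = b i t)
    (h : ∀ i, ((a i).trans (q (G.tgt i))).Homotopic ((q (G.src i)).trans (b i))) :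
    f.Homotopic g := by
  choose Q hQ0 hQ1 hQs hQt using fun i => exists_square (h i)
  -- The homotopy is constructed as a map from the graph to the space of paths in `Y`: vertices go
  -- to the paths `q`, arcs to the curried squares.
  obtain ⟨F, hFv, hFa⟩ := G.exists_map (Y := C(unitInterval, Y))
    (fun v => (q v).toContinuousMap) (fun i =>
      { toContinuousMap := (Q i).curry
        source' := ContinuousMap.ext (hQs i)
        target' := ContinuousMap.ext (hQt i) })
  refine ⟨⟨⟨fun p => F p.2 p.1, ?_⟩, fun x => ?_, fun x => ?_⟩⟩
  · exact (ContinuousMap.continuous_uncurry_of_continuous F).comp continuous_swap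
  · rcases G.cases_space x with ⟨v, rfl⟩ | ⟨i, t, rfl⟩
    · change F (G.vertexPoint v) 0 = _
      rw [hFv, hfv]; exact (q v).source
    · change F (G.arcPath i t) 0 = _
      rw [hFa, hfa]; exact hQ0 i t
  · rcases G.cases_space x with ⟨v, rfl⟩ | ⟨i, t, rfl⟩
    · change F (G.vertexPoint v) 1 = _
      rw [hFv, hgv]; exact (q v).target
    · change F (G.arcPath i t) 1 = _
      rw [hFa, hgb]; exact hQ1 i t

/-- The vertices of the graph are connected by its arcs. -/
def IsEdgeConnected : Prop :=
  ∀ A : Finset E, A ⊆ G.vertices → A.Nonempty → (∀ i, G.arc i 0 ∈ A ↔ G.arc i 1 ∈ A) →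
    A = G.vertices

/-- The indicator of `A` on vertices extends, constantly along each arc, to a continuous map to
`Bool`, which connectedness makes constant. -/
theorem isEdgeConnected_of_isConnected [T2Space E] (h : IsConnected G.space) :
    G.IsEdgeConnected := by
  classical
  rintro A hA ⟨v, hv⟩ hi
  have := isPreconnected_iff_preconnectedSpace.1 h.isPreconnected
  obtain ⟨f, hfv, -⟩ := G.exists_map (Y := Bool) (fun v => decide ((v : E) ∈ A))
    (fun i => (Path.refl (decide (G.arc i 0 ∈ A))).cast rfl (decide_eq_decide.2 (hi i).symm))
  refine Finset.Subset.antisymm hA fun w hw => ?_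
  have hloc : IsLocallyConstant f := IsLocallyConstant.iff_continuous _ |>.2 f.continuous
  have := hloc.apply_eq_of_preconnectedSpace (G.vertexPoint ⟨v, hA hv⟩) (G.vertexPoint ⟨w, hw⟩)
  rw [hfv, hfv] at this
  simpa [hv] using this

/-- A spanning tree of a graph, with the paths in the tree from its root. -/
structure SpanningTree where
  root : G.vertices
  edges : Finset (Fin G.numEdges)
  card_edges : edges.card + 1 = G.vertices.card
  path : ∀ v, Path (G.vertexPoint root) (G.vertexPoint v)
  path_mem : ∀ v t, path v t = G.vertexPoint root ∨ ∃ i ∈ edges, ∃ s, path v t = G.arcPath i s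
  homotopic : ∀ i ∈ edges, ((path (G.src i)).trans (G.arcPath i)).Homotopic (path (G.tgt i))

theorem Path.forall_trans_mem {Y : Type*} [TopologicalSpace Y] {a b c : Y} {p : Path a b}
    {q : Path b c} {P : Y → Prop} (hp : ∀ t, P (p t)) (hq : ∀ t, P (q t)) (t : unitInterval) :
    P (p.trans q t) := by
  rw [Path.trans_apply]
  split_ifs
  · exact hp _
  · exact hq _

variable {G} in
/-- Growing a tree inside a graph. -/
theorem IsEdgeConnected.exists_subtree (hG : G.IsEdgeConnected) (r : G.vertices) (k : ℕ)
    (hk : k + 1 ≤ G.vertices.card) :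
    ∃ (A : Finset G.vertices) (T : Finset (Fin G.numEdges)), A.card = k + 1 ∧ T.card = k ∧
      (∀ i ∈ T, G.src i ∈ A ∧ G.tgt i ∈ A) ∧ r ∈ A ∧
      ∃ p : ∀ v ∈ A, Path (G.vertexPoint r) (G.vertexPoint v),
        (∀ v hv t, p v hv t = G.vertexPoint r ∨ ∃ i ∈ T, ∃ s, p v hv t = G.arcPath i s) ∧
        ∀ i ∈ T, ∀ h1 h2, ((p (G.src i) h1).trans (G.arcPath i)).Homotopic (p (G.tgt i) h2) := by
  classical
  induction k with
  | zero =>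
    refine ⟨{r}, ∅, by simp, by simp, by simp, by simp,
      fun v hv => (Path.refl _).cast rfl (by rw [Finset.mem_singleton.1 hv]), ?_, by simp⟩
    intro v hv t
    exact Or.inl rfl
  | succ k ih =>
    obtain ⟨A, T, hAc, hTc, hTA, hrA, p, hp, hph⟩ := ih (by omega)
    -- the step, for an edge leaving the tree
    have step : ∀ (i : Fin G.numEdges) (w : G.vertices), w ∉ A → i ∉ T →
        ∀ pw : Path (G.vertexPoint r) (G.vertexPoint w),
        (∀ t, pw t = G.vertexPoint r ∨ ∃ j ∈ insert i T, ∃ s, pw t = G.arcPath j s) →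
        (G.src i ∈ insert w A ∧ G.tgt i ∈ insert w A) →
        (∀ p' : ∀ v ∈ insert w A, Path (G.vertexPoint r) (G.vertexPoint v),
          (∀ v (hv : v ∈ A), p' v (Finset.mem_insert_of_mem hv) = p v hv) →
          p' w (Finset.mem_insert_self _ _) = pw →
          ∀ h1 h2, ((p' (G.src i) h1).trans (G.arcPath i)).Homotopic (p' (G.tgt i) h2)) →
        ∃ (A : Finset G.vertices) (T : Finset (Fin G.numEdges)), A.card = k + 1 + 1 ∧
          T.card = k + 1 ∧
          (∀ i ∈ T, G.src i ∈ A ∧ G.tgt i ∈ A) ∧ r ∈ A ∧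
          ∃ p : ∀ v ∈ A, Path (G.vertexPoint r) (G.vertexPoint v),
            (∀ v hv t, p v hv t = G.vertexPoint r ∨ ∃ i ∈ T, ∃ s, p v hv t = G.arcPath i s) ∧
            ∀ i ∈ T, ∀ h1 h2,
              ((p (G.src i) h1).trans (G.arcPath i)).Homotopic (p (G.tgt i) h2) := by
      intro i w hw hi pw hpw hends hhom
      let p' : ∀ v ∈ insert w A, Path (G.vertexPoint r) (G.vertexPoint v) := fun v hv =>
        if h : v ∈ A then p v h else pw.cast rfl
          (by rw [(Finset.mem_insert.1 hv).resolve_right h])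
      have hp'A : ∀ v (hv : v ∈ A), p' v (Finset.mem_insert_of_mem hv) = p v hv :=
        fun v hv => dif_pos hv
      have hp'w : p' w (Finset.mem_insert_self _ _) = pw := by
        simp only [p', dif_neg hw]; rfl
      refine ⟨insert w A, insert i T, by rw [Finset.card_insert_of_notMem hw, hAc],
        by rw [Finset.card_insert_of_notMem hi, hTc], ?_, Finset.mem_insert_of_mem hrA,
        p', ?_, ?_⟩
      · intro j hj
        rcases Finset.mem_insert.1 hj with rfl | hj
        · exact hends
        · exact ⟨Finset.mem_insert_of_mem (hTA j hj).1, Finset.mem_insert_of_mem (hTA j hj).2⟩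
      · intro v hv t
        rcases Finset.mem_insert.1 hv with rfl | hv'
        · rw [hp'w]; exact hpw t
        · rw [hp'A v hv']
          rcases hp v hv' t with h | ⟨j, hj, s, h⟩
          · exact Or.inl h
          · exact Or.inr ⟨j, Finset.mem_insert_of_mem hj, s, h⟩
      · intro j hj h1 h2
        rcases Finset.mem_insert.1 hj with rfl | hj
        · exact hhom p' hp'A hp'w h1 h2
        · rw [hp'A _ (hTA j hj).1, hp'A _ (hTA j hj).2]
          exact hph j hj _ _
    have hlift : ∀ v (hv : v ∈ A) (i : Fin G.numEdges) t, p v hv t = G.vertexPoint r ∨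
        ∃ j ∈ insert i T, ∃ s, p v hv t = G.arcPath j s := by
      intro v hv i t
      rcases hp v hv t with h | ⟨j, hj, s, h⟩
      · exact Or.inl h
      · exact Or.inr ⟨j, Finset.mem_insert_of_mem hj, s, h⟩
    -- A nonempty proper set of vertices is left by some arc, which is attached to the tree in
    -- whichever direction it leaves.
    have hne : ∃ i, ¬ (G.src i ∈ A ↔ G.tgt i ∈ A) := by
      by_contra! hcl
      have := hG (A.map (Function.Embedding.subtype _))
        (fun v hv => by
          obtain ⟨w, -, rfl⟩ := Finset.mem_map.1 hv
          exact w.2)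
        ⟨r, Finset.mem_map_of_mem (Function.Embedding.subtype _) hrA⟩
        (fun i => by
          have h1 : G.arc i 0 ∈ A.map (Function.Embedding.subtype _) ↔ G.src i ∈ A := by
            simp [src, G.arc_zero_mem]
          have h2 : G.arc i 1 ∈ A.map (Function.Embedding.subtype _) ↔ G.tgt i ∈ A := by
            simp [tgt, G.arc_one_mem]
          rw [h1, h2, hcl i])
      rw [← this, Finset.card_map] at hk
      omega
    obtain ⟨i, hi⟩ := hne
    have hiT : i ∉ T := fun h => hi (iff_of_true (hTA i h).1 (hTA i h).2)
    by_cases hs : G.src i ∈ A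
    · have ht : G.tgt i ∉ A := fun h => hi (iff_of_true hs h)
      refine step i (G.tgt i) ht hiT ((p _ hs).trans (G.arcPath i)) ?_
        ⟨Finset.mem_insert_of_mem hs, Finset.mem_insert_self _ _⟩ ?_
      · exact Path.forall_trans_mem
          (P := fun x => x = G.vertexPoint r ∨ ∃ j ∈ insert i T, ∃ s, x = G.arcPath j s) (hlift _ hs i)
          fun t => Or.inr ⟨i, Finset.mem_insert_self _ _, t, rfl⟩
      · intro p' h1 h2 k1 k2
        rw [h1 _ hs, h2]
    · have ht : G.tgt i ∈ A := by
        by_contra h; exact hi (iff_of_false hs h)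
      refine step i (G.src i) hs hiT ((p _ ht).trans (G.arcPath i).symm) ?_
        ⟨Finset.mem_insert_self _ _, Finset.mem_insert_of_mem ht⟩ ?_
      · exact Path.forall_trans_mem
          (P := fun x => x = G.vertexPoint r ∨ ∃ j ∈ insert i T, ∃ s, x = G.arcPath j s) (hlift _ ht i)
          fun t => Or.inr ⟨i, Finset.mem_insert_self _ _, unitInterval.symm t, rfl⟩
      · intro p' h1 h2 k1 k2
        rw [h1 _ ht, h2, ← Path.Homotopic.Quotient.eq]
        simp

variable {G} in
theorem IsEdgeConnected.nonempty_spanningTree (hG : G.IsEdgeConnected) (hne : G.vertices.Nonempty) :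
    Nonempty G.SpanningTree := by
  have hpos := hne.card_pos
  obtain ⟨A, T, hA, hT, -, -, p, hp, hph⟩ := hG.exists_subtree ⟨_, hne.choose_spec⟩
    (G.vertices.card - 1) (by omega)
  have hall : ∀ v, v ∈ A := by
    have : A = Finset.univ := Finset.eq_univ_of_card A (by simp; omega)
    simp [this]
  exact ⟨⟨_, T, by omega, fun v => p v (hall v), fun v t => hp v _ t, fun i hi => hph i hi _ _⟩⟩

end Maps

/-! ### Spanning trees and the cycle rank -/

section Betti

variable {E : Type*} [MetricSpace E] {G : GeometricGraph E}

/-- The number of edges outside of a spanning tree is the first Betti number. -/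
theorem SpanningTree.betti_add_card (hG : G.IsEdgeConnected) (τ : G.SpanningTree) :
    G.betti + τ.edges.card = G.numEdges := by
  classical
  have hrk := LinearMap.finrank_range_add_finrank_ker G.boundaryMap
  rw [← betti_eq, Module.finrank_finsupp_self, Fintype.card_fin] at hrk
  -- The boundaries and the line spanned by the root are complementary in the chains on the
  -- vertices: the augmentation makes them independent, and connectedness makes them span. So the
  -- boundary map has rank one less than the number of vertices.
  let R := LinearMap.range G.boundaryMap
  let D : Submodule (ZMod 2) (E →₀ ZMod 2) := Submodule.span (ZMod 2) {Finsupp.single (τ.root : E) 1}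
  let aug : (E →₀ ZMod 2) →ₗ[ZMod 2] ZMod 2 := Finsupp.linearCombination (ZMod 2) fun _ => 1
  have hRle : R ≤ LinearMap.ker aug := by
    rintro _ ⟨z, rfl⟩
    have : aug ∘ₗ G.boundaryMap = 0 := by
      refine Finsupp.lhom_ext' fun i => LinearMap.ext_ring ?_
      simp only [LinearMap.comp_apply, Finsupp.lsingle_apply, boundaryMap_single, map_add, aug,
        Finsupp.linearCombination_single, one_smul, LinearMap.zero_apply]
      exact CharTwo.add_self_eq_zero 1
    exact LinearMap.congr_fun this z
  have hinf : R ⊓ D = ⊥ := by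
    rw [eq_bot_iff]
    rintro z ⟨hz, hzD⟩
    obtain ⟨c, rfl⟩ := Submodule.mem_span_singleton.1 hzD
    have := hRle hz
    rw [LinearMap.mem_ker, map_smul] at this
    have h1 : aug (Finsupp.single (τ.root : E) 1) = 1 := by simp [aug]
    rw [h1, smul_eq_mul, mul_one] at this
    simp [this]
  have hsup : R ⊔ D = Finsupp.supported (ZMod 2) (ZMod 2) (G.vertices : Set E) := by
    apply le_antisymm
    · refine sup_le ?_ ?_
      · rintro _ ⟨z, rfl⟩
        induction z using Finsupp.induction_linear with
        | zero => rw [map_zero]; exact Submodule.zero_mem _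
        | add a b ha hb => rw [map_add]; exact Submodule.add_mem _ ha hb
        | single i a =>
          rw [← mul_one a, ← smul_eq_mul, ← Finsupp.smul_single, map_smul, boundaryMap_single]
          exact Submodule.smul_mem _ _ (Submodule.add_mem _
            (Finsupp.single_mem_supported _ _ (G.arc_zero_mem i))
            (Finsupp.single_mem_supported _ _ (G.arc_one_mem i)))
      · rw [Submodule.span_le, Set.singleton_subset_iff]
        exact Finsupp.single_mem_supported _ _ τ.root.2
    -- The vertices whose basis vector lies in `R ⊔ D` include the root and are closed under passing
    -- along arcs, so they are all the vertices.
    · have hA := hG (G.vertices.filter fun v => Finsupp.single v 1 ∈ R ⊔ D)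
        (Finset.filter_subset _ _)
        ⟨τ.root, Finset.mem_filter.2 ⟨τ.root.2,
          Submodule.mem_sup_right (Submodule.mem_span_singleton_self _)⟩⟩
        (fun i => by
          have hb : Finsupp.single (G.arc i 0) 1 + Finsupp.single (G.arc i 1) 1 ∈ R ⊔ D :=
            Submodule.mem_sup_left ⟨_, G.boundaryMap_single i⟩
          simp only [Finset.mem_filter, G.arc_zero_mem, G.arc_one_mem, true_and]
          exact ⟨fun h => (Submodule.add_mem_iff_right _ h).1 hb,
            fun h => (Submodule.add_mem_iff_left _ h).1 hb⟩)
      rw [Finsupp.supported_eq_span_single, Submodule.span_le]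
      rintro _ ⟨v, hv, rfl⟩
      rw [Finset.mem_coe, ← hA] at hv
      exact (Finset.mem_filter.1 hv).2
  have hfdR : FiniteDimensional (ZMod 2) R := LinearMap.finiteDimensional_range _
  have hfin := Submodule.finrank_sup_add_finrank_inf_eq R D
  have hcard : Module.finrank (ZMod 2)
      (Finsupp.supported (ZMod 2) (ZMod 2) (G.vertices : Set E)) = G.vertices.card := by
    rw [(Finsupp.supportedEquivFinsupp (G.vertices : Set E)).finrank_eq,
      Module.finrank_finsupp_self]
    simp
  rw [hinf, hsup, finrank_bot, hcard, finrank_span_singleton (by simp)] at hfin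
  have := τ.card_edges
  change Module.finrank (ZMod 2) R + _ = _ at hrk
  omega

end Betti

/-! ### Homotopy equivalences from matched spanning trees -/

section Equivalence

variable {E E' : Type*} [MetricSpace E] [MetricSpace E'] {G : GeometricGraph E}
  {G' : GeometricGraph E'}

/-- The loop at the root which runs through an arc. -/
def SpanningTree.loop (τ : G.SpanningTree) (i : Fin G.numEdges) :
    Path (G.vertexPoint τ.root) (G.vertexPoint τ.root) :=
  ((τ.path (G.src i)).trans (G.arcPath i)).trans (τ.path (G.tgt i)).symm

/-- `f` collapses the tree `τ` to the root of `τ'` and sends the other arcs to the loops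
corresponding to them under `σ`. -/
structure IsCollapse (τ : G.SpanningTree) (τ' : G'.SpanningTree)
    (σ : {i // i ∉ τ.edges} ≃ {j // j ∉ τ'.edges}) (f : C(G.space, G'.space)) : Prop where
  vertex : ∀ v, f (G.vertexPoint v) = G'.vertexPoint τ'.root
  tree : ∀ i ∈ τ.edges, ∀ t, f (G.arcPath i t) = G'.vertexPoint τ'.root
  loop : ∀ (i : {i // i ∉ τ.edges}) t, f (G.arcPath i t) = τ'.loop (σ i) t

theorem exists_isCollapse (τ : G.SpanningTree) (τ' : G'.SpanningTree)
    (σ : {i // i ∉ τ.edges} ≃ {j // j ∉ τ'.edges}) : ∃ f, IsCollapse τ τ' σ f := by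
  obtain ⟨f, hv, ha⟩ := G.exists_map (fun _ => G'.vertexPoint τ'.root)
    (fun i => if h : i ∈ τ.edges then Path.refl _ else τ'.loop (σ ⟨i, h⟩))
  refine ⟨f, hv, fun i hi t => ?_, fun i t => ?_⟩
  · rw [ha, dif_pos hi]; rfl
  · rw [ha, dif_neg i.2]

theorem IsCollapse.path_apply {τ : G.SpanningTree} {τ' : G'.SpanningTree}
    {σ : {i // i ∉ τ.edges} ≃ {j // j ∉ τ'.edges}} {f : C(G.space, G'.space)}
    (hf : IsCollapse τ τ' σ f) (v : G.vertices) (t : unitInterval) :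
    f (τ.path v t) = G'.vertexPoint τ'.root := by
  rcases τ.path_mem v t with h | ⟨i, hi, s, h⟩
  · rw [h, hf.vertex]
  · rw [h, hf.tree i hi]

/-- The homotopy moves the root to each vertex along the tree path. On a tree arc, compatibility is
the relation `homotopic` of the tree. On any other arc, the composite traverses its loop between two
constant pieces, the images of tree paths, and the return path of the loop cancels. -/
theorem IsCollapse.comp_homotopic_id {τ : G.SpanningTree} {τ' : G'.SpanningTree}
    {σ : {i // i ∉ τ.edges} ≃ {j // j ∉ τ'.edges}} {f : C(G.space, G'.space)}
    {g : C(G'.space, G.space)} (hf : IsCollapse τ τ' σ f) (hg : IsCollapse τ' τ σ.symm g) :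
    (g.comp f).Homotopic (ContinuousMap.id _) := by
  refine G.homotopic_of_arcs (fun _ => G.vertexPoint τ.root) G.vertexPoint τ.path
    (fun i => if i ∈ τ.edges then Path.refl _ else
      ((Path.refl _).trans (τ.loop i)).trans (Path.refl _)) G.arcPath
    (fun v => ?_) (fun _ => rfl) (fun i t => ?_) (fun _ _ => rfl) fun i => ?_
  · rw [ContinuousMap.comp_apply, hf.vertex, hg.vertex]
  · rw [ContinuousMap.comp_apply]
    by_cases hi : i ∈ τ.edges
    · rw [hf.tree i hi, hg.vertex, if_pos hi]; rfl
    · rw [if_neg hi]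
      have h1 := hf.loop ⟨i, hi⟩ t
      rw [h1, SpanningTree.loop, Path.trans_apply, Path.trans_apply (Path.trans _ _)]
      split_ifs with k1
      · rw [Path.trans_apply, Path.trans_apply (Path.refl _)]
        split_ifs with k2
        · exact hg.path_apply _ _
        · rw [hg.loop, Equiv.symm_apply_apply]
      · rw [Path.symm_apply]
        exact hg.path_apply _ _
  · rw [← Path.Homotopic.Quotient.eq]
    split_ifs with hi
    · have := Path.Homotopic.Quotient.eq.2 (τ.homotopic i hi)
      simp only [Path.Homotopic.Quotient.mk_trans, Path.Homotopic.Quotient.mk_refl,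
        Path.Homotopic.Quotient.refl_trans] at this ⊢
      exact this.symm
    · simp [SpanningTree.loop]

/-- Connected finite graphs with the same first Betti number are homotopy equivalent. -/
theorem nonempty_homotopyEquiv (hG : G.IsEdgeConnected) (hne : G.vertices.Nonempty)
    (hG' : G'.IsEdgeConnected) (hne' : G'.vertices.Nonempty) (h : G.betti = G'.betti) :
    Nonempty (ContinuousMap.HomotopyEquiv G.space G'.space) := by
  obtain ⟨τ⟩ := hG.nonempty_spanningTree hne
  obtain ⟨τ'⟩ := hG'.nonempty_spanningTree hne'
  have h1 := τ.betti_add_card hG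
  have h2 := τ'.betti_add_card hG'
  have σ : {i // i ∉ τ.edges} ≃ {j // j ∉ τ'.edges} := by
    refine Fintype.equivOfCardEq ?_
    rw [Fintype.card_subtype_compl, Fintype.card_subtype_compl]
    simp only [Fintype.card_fin, Fintype.card_coe]
    omega
  obtain ⟨f, hf⟩ := exists_isCollapse τ τ' σ
  obtain ⟨g, hg⟩ := exists_isCollapse τ' τ σ.symm
  exact ⟨⟨f, g, hf.comp_homotopic_id hg, hg.comp_homotopic_id hf⟩⟩

end Equivalence

end GeometricGraph

/-! ### The reconstructed graph -/

section GraphChains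

open Classical

variable {V : Type*}

theorem chain_add_self (z : Finset V →₀ ZMod 2) : z + z = 0 := by
  ext σ
  exact CharTwo.add_self_eq_zero _

theorem chain_add_add_cancel (a b c : Finset V →₀ ZMod 2) : a + b + (b + c) = a + c := by
  rw [add_assoc, ← add_assoc b, chain_add_self, zero_add]

/-- The edges of a graph as finite sets of vertices. -/
def edgeFinsets (H : SimpleGraph V) : Set (Finset V) := {σ | ∃ x y, H.Adj x y ∧ σ = {x, y}}

theorem edgeFinsets_mono {H H' : SimpleGraph V} (h : H ≤ H') : edgeFinsets H ⊆ edgeFinsets H' :=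
  fun _ ⟨x, y, hxy, e⟩ => ⟨x, y, h hxy, e⟩

theorem pair_mem_edgeFinsets {H : SimpleGraph V} {x y : V} :
    ({x, y} : Finset V) ∈ edgeFinsets H ↔ H.Adj x y := by
  refine ⟨fun ⟨a, b, hab, e⟩ => ?_, fun h => ⟨x, y, h, rfl⟩⟩
  have h1 : s(x, y) = s(a, b) := by
    refine Sym2.ext fun z => ?_
    have : z ∈ ({x, y} : Finset V) ↔ z ∈ ({a, b} : Finset V) := by rw [e]
    simpa using this
  rw [← SimpleGraph.mem_edgeSet, h1]
  exact hab

/-- The boundary of a path in a graph. -/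
theorem exists_chain_of_reachable {H : SimpleGraph V} {u w : V} (h : H.Reachable u w) :
    ∃ c ∈ chains (edgeFinsets H) 2,
      boundary c = Finsupp.single {u} 1 + Finsupp.single {w} 1 := by
  obtain ⟨q⟩ := h
  induction q with
  | nil => exact ⟨0, Submodule.zero_mem _, by rw [map_zero, chain_add_self]⟩
  | @cons a b _ hab q ih =>
    obtain ⟨c, hc, hb⟩ := ih
    refine ⟨Finsupp.single {a, b} 1 + c, Submodule.add_mem _
      (single_mem_chains (pair_mem_edgeFinsets.2 hab) (Finset.card_pair hab.ne) 1) hc, ?_⟩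
    rw [map_add, hb, boundary_edge hab.ne, chain_add_add_cancel]

/-- The first Betti number of a graph is the dimension of its space of simplicial cycles. -/
theorem graphBetti_eq (H : SimpleGraph V) :
    graphBetti H = Module.finrank (ZMod 2) (cycles (edgeFinsets H) 2) := by
  let D : (H.edgeSet →₀ ZMod 2) →ₗ[ZMod 2] (V →₀ ZMod 2) :=
    Finsupp.linearCombination (ZMod 2) (fun i : H.edgeSet => Sym2.lift
      ⟨fun a b : V => (Finsupp.single a 1 + Finsupp.single b 1 : V →₀ ZMod 2),
        fun _ _ => add_comm _ _⟩ (i : Sym2 V))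
  let P : (H.edgeSet →₀ ZMod 2) →ₗ[ZMod 2] (Finset V →₀ ZMod 2) :=
    Finsupp.lmapDomain _ _ fun e : H.edgeSet => (e : Sym2 V).toFinset
  let J : (V →₀ ZMod 2) →ₗ[ZMod 2] (Finset V →₀ ZMod 2) :=
    Finsupp.lmapDomain _ _ fun v => {v}
  have hP : Function.Injective P := Finsupp.mapDomain_injective fun e e' h => by
    refine Subtype.ext (Sym2.ext fun z => ?_)
    have : z ∈ (e : Sym2 V).toFinset ↔ z ∈ (e' : Sym2 V).toFinset := by rw [show
      (e : Sym2 V).toFinset = (e' : Sym2 V).toFinset from h]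
    simpa [Sym2.mem_toFinset] using this
  have hJ : Function.Injective J := Finsupp.mapDomain_injective Finset.singleton_injective
  have hPs : ∀ x y (h : H.Adj x y), P (Finsupp.single ⟨s(x, y), h⟩ 1) =
      Finsupp.single {x, y} 1 := fun x y h => by
    simp only [P, Finsupp.lmapDomain_apply, Finsupp.mapDomain_single, Sym2.toFinset_mk_eq]
  -- `P` and `J` rename edges and vertices as finite sets. Both are injective, so they carry the
  -- kernel of `D` isomorphically onto the simplicial cycles.
  have hcomm : boundary ∘ₗ P = J ∘ₗ D := by
    refine Finsupp.lhom_ext' fun ⟨e, he⟩ => LinearMap.ext_ring ?_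
    induction e with
    | _ x y =>
      simp only [LinearMap.comp_apply, Finsupp.lsingle_apply]
      rw [hPs x y he, boundary_edge (SimpleGraph.Adj.ne he)]
      simp only [D, J, Finsupp.linearCombination_single, one_smul, Sym2.lift_mk, map_add,
        Finsupp.lmapDomain_apply, Finsupp.mapDomain_single]
  have hmem : ∀ z, boundary (P z) = J (D z) := LinearMap.congr_fun hcomm
  have hrange : LinearMap.range P = chains (edgeFinsets H) 2 := by
    apply le_antisymm
    · rintro _ ⟨z, rfl⟩
      induction z using Finsupp.induction_linear with
      | zero => rw [map_zero]; exact Submodule.zero_mem _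
      | add a b ha hb => rw [map_add]; exact Submodule.add_mem _ ha hb
      | single e a =>
        obtain ⟨e, he⟩ := e
        induction e with
        | _ x y =>
          rw [← mul_one a, ← smul_eq_mul, ← Finsupp.smul_single, map_smul, hPs x y he]
          exact Submodule.smul_mem _ _ (single_mem_chains (pair_mem_edgeFinsets.2 he)
            (Finset.card_pair (SimpleGraph.Adj.ne he)) 1)
    · rw [chains_eq_span, Submodule.span_le]
      rintro _ ⟨_, ⟨⟨x, y, h, rfl⟩, -⟩, rfl⟩
      exact ⟨_, hPs x y h⟩
  have hmap : (LinearMap.ker D).map P = cycles (edgeFinsets H) 2 := by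
    ext w
    constructor
    · rintro ⟨z, hz, rfl⟩
      refine ⟨hrange ▸ ⟨z, rfl⟩, ?_⟩
      rw [SetLike.mem_coe, LinearMap.mem_ker, hmem, LinearMap.mem_ker.1 hz, map_zero]
    · rintro ⟨hw, hw0⟩
      rw [SetLike.mem_coe, ← hrange] at hw
      obtain ⟨z, rfl⟩ := hw
      refine ⟨z, hJ ?_, rfl⟩
      rw [← hmem, map_zero]
      exact hw0
  rw [← hmap, ← (Submodule.equivMapOfInjective P hP (LinearMap.ker D)).finrank_eq]
  rfl

end GraphChains

/-! ### Two-level filtrations: critical edges, the forest and the output graph -/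

section TwoLevel

open Classical

variable {V : Type*} {N : ℕ} {S : Fin N → Finset V} {f : V → ℝ} {δ : ℝ} {m : ℕ}

/-- The rest of the cycle precedes its last simplex `S j` and, modulo 2, has the same boundary as `S
j`. Hence the second simplex of a pair is never the last simplex of a cycle. -/
theorem IsSimplexwise.boundary_mem_of_lead {n k : ℕ} {j : Fin N} {w : Finset V →₀ ZMod 2}
    (hw : w ∈ chains (prefixComplex S k) (n + 1)) (hw0 : boundary w = 0) (hj : w (S j) ≠ 0)
    (hlast : ∀ i, j < i → w (S i) = 0) :
    boundary (Finsupp.single (S j) 1) ∈ boundaries (prefixComplex S j) n := by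
  have hone : ∀ a : ZMod 2, a ≠ 0 → a = 1 := by decide
  have hcard : (S j).card = n + 1 := (hw (Finsupp.mem_support_iff.2 hj)).2
  have hjk : S j ∈ prefixComplex S k := (hw (Finsupp.mem_support_iff.2 hj)).1
  refine ⟨Finsupp.single (S j) 1 - w, mem_chains_prefix_of_forall
    (Submodule.sub_mem _ (single_mem_chains hjk hcard 1) hw) fun i hi => ?_, ?_⟩
  · rw [Finsupp.sub_apply]
    rcases hi.eq_or_lt with h | h
    · rw [show i = j from Fin.ext h.symm, hone _ hj, Finsupp.single_eq_same, sub_self]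
    · by_cases hij : S j = S i
      · exact absurd ((congrArg w hij).trans (hlast i h)) hj
      · rw [Finsupp.single_eq_of_ne' hij, hlast i h, sub_zero]
  · rw [map_sub, hw0, sub_zero]

/-- The combinatorial situation of the reconstruction theorem: the first `m` simplices form a
connected subcomplex, the whole complex is connected without homology in dimension one, and
differences of values within one level are at most `δ`, between the levels more than `δ`. -/
structure IsTwoLevel (S : Fin N → Finset V) (f : V → ℝ) (δ : ℝ) (m : ℕ) : Prop extends
    IsSimplexwise S where
  le_of_lt : ∀ i j : Fin N, (j : ℕ) < m → i < j →
    simplexValue f (S j) - simplexValue f (S i) ≤ δ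
  le_of_ge : ∀ i j : Fin N, m ≤ i → i < j → simplexValue f (S j) - simplexValue f (S i) ≤ δ
  lt_of_lt_of_ge : ∀ i j : Fin N, (i : ℕ) < m → m ≤ j →
    δ < simplexValue f (S j) - simplexValue f (S i)
  acyclic : cycles (Set.range S) 2 ≤ boundaries (Set.range S) 2
  connected : ∀ b : V → ZMod 2, (∀ u v, u ≠ v → {u, v} ∈ Set.range S → b u = b v) →
    ∀ u v, {u} ∈ Set.range S → {v} ∈ Set.range S → b u = b v
  prefix_connected : ∀ b : V → ZMod 2,
    (∀ u v, u ≠ v → {u, v} ∈ prefixComplex S m → b u = b v) →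
    ∀ u v, {u} ∈ prefixComplex S m → {v} ∈ prefixComplex S m → b u = b v

namespace IsTwoLevel

/-- Vertex-edge pairs have small persistence. -/
theorem le_of_persistencePair_vertex (h : IsTwoLevel S f δ m) {i j : Fin N}
    (hp : PersistencePair S i j) (hi : (S i).card = 1) :
    simplexValue f (S j) - simplexValue f (S i) ≤ δ := by
  have hS := h.toIsSimplexwise
  by_cases hjm : (j : ℕ) < m
  · exact h.le_of_lt i j hjm hp.1
  by_cases him : m ≤ (i : ℕ)
  · exact h.le_of_ge i j him hp.1
  exfalso
  obtain ⟨h1, h2⟩ := hS.persistencePair_iff.1 hp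
  rw [hi] at h1 h2
  obtain ⟨v, hv⟩ := Finset.card_eq_one.1 hi
  -- In a pair crossing the levels, a vertex with a predecessor is excluded since the first level is
  -- connected: their sum bounds there already. The very first vertex is excluded since a chain led
  -- by it is that vertex alone, which has augmentation one.
  by_cases hk : ∃ k, k < i ∧ (S k).card = 1
  · obtain ⟨k, hki, hk⟩ := hk
    obtain ⟨w, hw⟩ := Finset.card_eq_one.1 hk
    apply h2
    refine leads_mono S (boundaries_mono (prefixComplex_mono S (not_lt.1 hjm)) 1) ?_
    have hne : S k ≠ S i := fun e => hki.ne (hS.injective e)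
    refine ⟨Finsupp.single (S i) 1 + Finsupp.single (S k) 1, ?_, ?_, fun r hr => ?_⟩
    · by_contra hnot
      -- A functional killing boundaries is constant along edges, hence has equal values on the two
      -- vertices and vanishes on their sum.
      obtain ⟨l, hl1, hl2⟩ := Submodule.exists_le_ker_of_notMem hnot
      apply hl1
      have hb := h.prefix_connected (fun x => l (Finsupp.single {x} 1)) (fun x y hxy hL => by
        have := hl2 (Submodule.mem_map_of_mem (single_mem_chains hL (Finset.card_pair hxy) 1))
        rw [boundary_edge hxy, LinearMap.mem_ker, map_add] at this
        exact CharTwo.add_eq_zero.1 this) v w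
        (hv ▸ hS.mem_prefixComplex.2 (not_le.1 him))
        (hw ▸ hS.mem_prefixComplex.2 ((Fin.lt_def.1 hki).trans (not_le.1 him)))
      rw [map_add, hv, hw]
      exact CharTwo.add_eq_zero.2 hb
    · rw [Finsupp.add_apply, Finsupp.single_eq_same, Finsupp.single_eq_of_ne' hne, add_zero]
      exact one_ne_zero
    · rw [Finsupp.add_apply, Finsupp.single_eq_of_ne' fun e => hr.ne (hS.injective e),
        Finsupp.single_eq_of_ne' fun e => (hki.trans hr).ne (hS.injective e), add_zero]
  · push Not at hk
    obtain ⟨x, hx, hxi, hxk⟩ := h1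
    have hxc := hS.boundaries_le_cycles _ le_rfl hx
    have hx1 : x = Finsupp.single (S i) (x (S i)) := by
      ext σ
      by_cases hσ : σ = S i
      · rw [hσ, Finsupp.single_eq_same]
      · rw [Finsupp.single_eq_of_ne hσ]
        by_contra h0
        obtain ⟨⟨r, -, rfl⟩, hr⟩ := hxc.1 (Finsupp.mem_support_iff.2 h0)
        rcases lt_trichotomy r i with h3 | h3 | h3
        · exact hk r h3 hr
        · exact hσ (by rw [h3])
        · exact h0 (hxk r h3)
    have haug : Finsupp.linearCombination (ZMod 2) (fun _ : Finset V => (1 : ZMod 2)) ∈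
        (boundaries (prefixComplex S (j + 1)) 1).dualAnnihilator := by
      rw [mem_dualAnnihilator_boundaries]
      intro σ _ hc
      obtain ⟨a, b, hab, rfl⟩ := Finset.card_eq_two.1 hc
      rw [boundary_edge hab, map_add, Finsupp.linearCombination_single,
        Finsupp.linearCombination_single]
      exact CharTwo.add_self_eq_zero _
    have := (Submodule.mem_dualAnnihilator _).1 haug x hx
    rw [hx1, Finsupp.linearCombination_single, smul_eq_mul, mul_one] at this
    exact hxi this

/-- The edges of the forest are the second simplices of vertex-edge pairs. -/
theorem forest_adj (h : IsTwoLevel S f δ m) {u v : V} : (forest S f δ).Adj u v ↔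
    u ≠ v ∧ ∃ i j, PersistencePair S i j ∧ (S i).card = 1 ∧ S j = {u, v} := by
  have hS := h.toIsSimplexwise
  rw [forest, SimpleGraph.fromEdgeSet_adj]
  constructor
  · rintro ⟨⟨u', v', e, i, j, hp, h1, -, hj, -⟩, hne⟩
    refine ⟨hne, i, j, hp, h1, ?_⟩
    rw [hj]
    rcases Sym2.eq_iff.1 e with ⟨rfl, rfl⟩ | ⟨rfl, rfl⟩
    · rfl
    · exact Finset.pair_comm _ _
  · rintro ⟨hne, i, j, hp, h1, hj⟩
    refine ⟨⟨u, v, rfl, i, j, hp, h1, ?_, hj, h.le_of_persistencePair_vertex hp h1⟩, hne⟩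
    rw [hS.card_of_persistencePair hp, h1]

/-- An edge whose boundary is not yet a boundary is the second simplex of a vertex-edge pair and
lies in the forest. Otherwise earlier edges join its endpoints, and induction replaces those by
forest paths; the indicator `b` of a component detects this. -/
theorem forest_reachable_of_edge (h : IsTwoLevel S f δ m) (j : Fin N) :
    ∀ u v, u ≠ v → S j = {u, v} → (forest S f δ).Reachable u v := by
  have hS := h.toIsSimplexwise
  induction j using WellFoundedLT.induction with
  | _ j ih =>
  intro u v huv hj
  have hc : (S j).card = 1 + 1 := by rw [hj, Finset.card_pair huv]
  by_cases hb : boundary (Finsupp.single (S j) 1) ∈ boundaries (prefixComplex S j) 1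
  · let b : V → ZMod 2 := fun x => if (forest S f δ).Reachable u x then 1 else 0
    have hl : Finsupp.linearCombination (ZMod 2) (fun σ : Finset V => ∑ x ∈ σ, b x) ∈
        (boundaries (prefixComplex S j) 1).dualAnnihilator := by
      rw [mem_dualAnnihilator_boundaries]
      rintro _ ⟨k, hk, rfl⟩ hkc
      obtain ⟨x, y, hxy, e⟩ := Finset.card_eq_two.1 hkc
      have hr := ih k (Fin.lt_def.2 hk) x y hxy e
      have hbxy : b x = b y := by
        have : (forest S f δ).Reachable u x ↔ (forest S f δ).Reachable u y :=
          ⟨fun h => h.trans hr, fun h => h.trans hr.symm⟩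
        simp only [b, this]
      rw [e, boundary_edge hxy, map_add, Finsupp.linearCombination_single,
        Finsupp.linearCombination_single, Finset.sum_singleton, Finset.sum_singleton, hbxy]
      exact CharTwo.add_self_eq_zero _
    have := (Submodule.mem_dualAnnihilator _).1 hl _ hb
    rw [hj, boundary_edge huv, map_add, Finsupp.linearCombination_single,
      Finsupp.linearCombination_single, Finset.sum_singleton, Finset.sum_singleton,
      one_smul, one_smul, CharTwo.add_eq_zero] at this
    by_contra hnr
    simp [b, hnr] at this
  · obtain ⟨i, hp, hi⟩ := hS.exists_persistencePair_right le_rfl hc hb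
    exact (h.forest_adj.2 ⟨huv, i, j, hp, hi, hj⟩).reachable

/-- The component of `u` is closed under the edges of a connected complex. Thus there is only one
component, and only one sink. -/
theorem forest_reachable (h : IsTwoLevel S f δ m) {u v : V} (hu : {u} ∈ Set.range S)
    (hv : {v} ∈ Set.range S) : (forest S f δ).Reachable u v := by
  have := h.connected (fun x => if (forest S f δ).Reachable u x then 1 else 0)
    (fun x y hxy ⟨j, hj⟩ => by
      have hr := h.forest_reachable_of_edge j x y hxy hj
      have : (forest S f δ).Reachable u x ↔ (forest S f δ).Reachable u y :=
        ⟨fun h => h.trans hr, fun h => h.trans hr.symm⟩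
      simp only [this]) u v hu hv
  by_contra hnr
  simp [hnr] at this

/-- The indices of the edges which are created in the first level and become boundaries in the
second. -/
def critical (S : Fin N → Finset V) (m : ℕ) : Set (Fin N) :=
  {i | (i : ℕ) < m ∧ (S i).card = 2 ∧ ∃ j : Fin N, m ≤ j ∧ PersistencePair S i j}

/-- The edges of persistence larger than `δ` are the critical ones. -/
theorem mem_critical_iff (h : IsTwoLevel S f δ m) {i : Fin N} (hi : (S i).card = 2) :
    i ∈ critical S m ↔ ∃ p : WithTop ℝ, HasPersistence S f i p ∧ (δ : WithTop ℝ) < p := by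
  have hS := h.toIsSimplexwise
  constructor
  · rintro ⟨him, -, j, hmj, hp⟩
    exact ⟨_, Or.inl ⟨j, hp, rfl⟩, WithTop.coe_lt_coe.2 (h.lt_of_lt_of_ge i j him hmj)⟩
  · rintro ⟨p, ⟨j, hp, rfl⟩ | ⟨j, hp, rfl⟩ | ⟨hno, -⟩, hδ⟩
    · have hδ' := WithTop.coe_lt_coe.1 hδ
      refine ⟨?_, hi, j, ?_, hp⟩
      · by_contra him
        exact (h.le_of_ge i j (not_lt.1 him) hp.1).not_gt hδ'
      · by_contra hmj
        exact (h.le_of_lt i j (not_le.1 hmj) hp.1).not_gt hδ'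
    · have hδ' := WithTop.coe_lt_coe.1 hδ
      have := hS.card_of_persistencePair hp
      exact absurd hδ' (h.le_of_persistencePair_vertex hp (by omega)).not_gt
    -- An edge which creates a cycle is paired later, since cycles bound in the whole complex; an
    -- edge which does not is the second simplex of a pair. So no edge is unpaired.
    · exfalso
      by_cases hb : boundary (Finsupp.single (S i) 1) ∈ boundaries (prefixComplex S i) 1
      · obtain ⟨c, hc, hcb⟩ := hb
        have hc0 : ∀ k : Fin N, i ≤ k → c (S k) = 0 := fun k hk =>
          hS.apply_eq_zero_of_mem_chains_prefix hc hk
        have hz : i ∈ leads S (cycles (Set.range S) 2) := by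
          refine ⟨Finsupp.single (S i) 1 - c, ⟨Submodule.sub_mem _
            (single_mem_chains (Set.mem_range_self i) hi 1)
            (chains_mono (prefixComplex_subset_range S i) 2 hc), ?_⟩, ?_, fun k hk => ?_⟩
          · rw [SetLike.mem_coe, LinearMap.mem_ker, map_sub, hcb, sub_self]
          · rw [Finsupp.sub_apply, hc0 i le_rfl, Finsupp.single_eq_same, sub_zero]
            exact one_ne_zero
          · rw [Finsupp.sub_apply, hc0 k hk.le,
              Finsupp.single_eq_of_ne' fun e => hk.ne (hS.injective e), sub_zero]
        have h1 := leads_mono S h.acyclic hz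
        rw [← prefixComplex_length, ← hi] at h1
        obtain ⟨j, -, -, hp⟩ := hS.exists_persistencePair_left (a := 0) le_rfl h1 (by
          rintro ⟨w, hw, h2, -⟩
          have := (hS.boundaries_le_cycles 0 (by omega) hw).1 (Finsupp.mem_support_iff.2 h2)
          obtain ⟨⟨k, hk, -⟩, -⟩ := this
          omega)
        exact (hno j).1 hp
      · obtain ⟨j, hp, -⟩ := hS.exists_persistencePair_right le_rfl hi hb
        exact (hno j).2 hp

variable {sink : V → V}

theorem outputGraph_adj (h : IsTwoLevel S f δ m) {x y : V} :
    (outputGraph S f δ sink).Adj x y ↔ x ≠ y ∧ ∃ i u v, u ≠ v ∧ S i = {u, v} ∧ i ∈ critical S m ∧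
      (s(x, y) = s(u, v) ∨ ∃ q : (forest S f δ).Walk u (sink u), q.IsPath ∧ s(x, y) ∈ q.edges) := by
  rw [outputGraph, SimpleGraph.fromEdgeSet_adj, and_comm]
  refine and_congr_right fun _ => ?_
  constructor
  · rintro ⟨i, u, v, p, huv, hi, hp, hδ, hq⟩
    exact ⟨i, u, v, huv, hi, (h.mem_critical_iff (by rw [hi, Finset.card_pair huv])).2
      ⟨p, hp, hδ⟩, hq⟩
  · rintro ⟨i, u, v, huv, hi, hc, hq⟩
    obtain ⟨p, hp, hδ⟩ := (h.mem_critical_iff (by rw [hi, Finset.card_pair huv])).1 hc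
    exact ⟨i, u, v, p, huv, hi, hp, hδ, hq⟩

theorem outputGraph_adj_of_critical (h : IsTwoLevel S f δ m) {i : Fin N}
    (hc : i ∈ critical S m) {u v : V} (huv : u ≠ v) (hi : S i = {u, v}) :
    (outputGraph S f δ sink).Adj u v :=
  h.outputGraph_adj.2 ⟨huv, i, u, v, huv, hi, hc, Or.inl rfl⟩

/-- Every edge of the reconstructed graph is critical or belongs to the forest. -/
theorem critical_or_forest_adj (h : IsTwoLevel S f δ m) {x y : V}
    (hxy : (outputGraph S f δ sink).Adj x y) :
    (∃ i ∈ critical S m, S i = {x, y}) ∨ (forest S f δ).Adj x y := by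
  obtain ⟨hne, i, u, v, huv, hi, hc, e | ⟨q, -, hq⟩⟩ := h.outputGraph_adj.1 hxy
  · left
    refine ⟨i, hc, ?_⟩
    rw [hi]
    rcases Sym2.eq_iff.1 e with ⟨rfl, rfl⟩ | ⟨rfl, rfl⟩
    · rfl
    · exact Finset.pair_comm _ _
  · exact Or.inr (q.adj_of_mem_edges hq)

theorem outputGraph_pair_mem_range (h : IsTwoLevel S f δ m) {x y : V}
    (hxy : (outputGraph S f δ sink).Adj x y) : ({x, y} : Finset V) ∈ Set.range S := by
  rcases h.critical_or_forest_adj hxy with ⟨i, -, hi⟩ | hT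
  · exact ⟨i, hi⟩
  · obtain ⟨-, -, j, -, -, hj⟩ := h.forest_adj.1 hT
    exact ⟨j, hj⟩

theorem singleton_mem_range (h : IsTwoLevel S f δ m) {i : Fin N} {v : V} (hv : v ∈ S i) :
    {v} ∈ Set.range S :=
  h.down_closed i _ (by simpa using hv) (by simp)

/-- The paths in the forest from critical edges to the sinks belong to the reconstructed graph. -/
theorem reachable_sink_of_critical (h : IsTwoLevel S f δ m)
    (hsink : IsSinkMap (Set.range S) f (forest S f δ) sink) {i : Fin N} (hc : i ∈ critical S m)
    {u v : V} (huv : u ≠ v) (hi : S i = {u, v}) :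
    (outputGraph S f δ sink ⊓ forest S f δ).Reachable u (sink u) := by
  obtain ⟨q, hq⟩ := (hsink.reachable u
    (h.singleton_mem_range (i := i) (by rw [hi]; simp))).exists_isPath
  -- Staying in the intersection with the forest records that the path avoids critical edges, as
  -- needed for the coordinates of fundamental cycles.
  refine ⟨q.transfer _ fun e he => ?_⟩
  induction e with
  | _ x y =>
    have hT := q.adj_of_mem_edges he
    exact ⟨h.outputGraph_adj.2 ⟨hT.ne, i, u, v, huv, hi, hc, Or.inr ⟨q, hq, he⟩⟩, hT⟩

theorem sink_eq (h : IsTwoLevel S f δ m)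
    (hsink : IsSinkMap (Set.range S) f (forest S f δ) sink) {u v : V} (hu : {u} ∈ Set.range S)
    (hv : {v} ∈ Set.range S) : sink u = sink v :=
  hsink.eq_of_reachable u v hu (h.forest_reachable hu hv)

/-- The vertices of the reconstructed graph are connected to the sink. -/
theorem outputGraph_reachable_sink (h : IsTwoLevel S f δ m)
    (hsink : IsSinkMap (Set.range S) f (forest S f δ) sink) {x y : V}
    (hxy : (outputGraph S f δ sink).Adj x y) : (outputGraph S f δ sink).Reachable x (sink x) := by
  obtain ⟨j, hj⟩ := h.outputGraph_pair_mem_range hxy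
  have hx : {x} ∈ Set.range S := h.singleton_mem_range (i := j) (by rw [hj]; simp)
  obtain ⟨hne, i, u, v, huv, hi, hc, e | ⟨q, hq, hqe⟩⟩ := h.outputGraph_adj.1 hxy
  · rcases Sym2.eq_iff.1 e with ⟨rfl, rfl⟩ | ⟨rfl, rfl⟩
    · exact (h.reachable_sink_of_critical hsink hc huv hi).mono inf_le_left
    · exact (h.reachable_sink_of_critical hsink hc huv.symm
        (hi.trans (Finset.pair_comm _ _))).mono inf_le_left
  · have hu : {u} ∈ Set.range S := h.singleton_mem_range (i := i) (by rw [hi]; simp)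
    rw [h.sink_eq hsink hx hu]
    have hxq := q.fst_mem_support_of_mem_edges hqe
    refine ⟨(q.dropUntil x hxq).transfer _ fun e he => ?_⟩
    have he' := q.edges_dropUntil_subset_edges hxq he
    induction e with
    | _ a b =>
      exact h.outputGraph_adj.2 ⟨(q.adj_of_mem_edges he').ne, i, u, v, huv, hi, hc,
        Or.inr ⟨q, hq, he'⟩⟩

/-- A critical edge is the last edge of a cycle, so its boundary is a boundary of earlier edges; for
a forest edge this fails. -/
theorem forest_notAdj_of_critical (h : IsTwoLevel S f δ m) {i : Fin N} (hc : i ∈ critical S m) :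
    S i ∉ edgeFinsets (forest S f δ) := by
  rintro ⟨x, y, hxy, e⟩
  have hS := h.toIsSimplexwise
  obtain ⟨-, k, j, hp, hk, hj⟩ := h.forest_adj.1 hxy
  obtain rfl : i = j := hS.injective (e.trans hj.symm)
  have h1 := hS.boundary_notMem_of_persistencePair hp
  rw [hk] at h1
  obtain ⟨-, hci, j, -, hp'⟩ := hc
  obtain ⟨⟨w, hw, hw1, hw2⟩, -⟩ := hS.persistencePair_iff.1 hp'
  rw [hci] at hw
  have hw' := hS.boundaries_le_cycles _ (by omega) hw
  exact h1 (IsSimplexwise.boundary_mem_of_lead hw'.1 hw'.2 hw1 hw2)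

/-- The first Betti number of the reconstructed graph is the number of critical edges. -/
theorem graphBetti_outputGraph (h : IsTwoLevel S f δ m)
    (hsink : IsSinkMap (Set.range S) f (forest S f δ) sink) :
    graphBetti (outputGraph S f δ sink) = (critical S m).ncard := by
  have hS := h.toIsSimplexwise
  rw [graphBetti_eq]
  set H := outputGraph S f δ sink with hH
  have hrange : edgeFinsets H ⊆ Set.range S := by
    rintro _ ⟨x, y, hxy, rfl⟩
    exact h.outputGraph_pair_mem_range hxy
  -- `R` reads the coefficients at critical edges. It is injective because the last edge of a
  -- nonzero cycle is not in the forest, hence critical.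
  let R : cycles (edgeFinsets H) 2 →ₗ[ZMod 2] (critical S m → ZMod 2) :=
    LinearMap.pi (fun i => Finsupp.lapply (S i)) ∘ₗ (cycles (edgeFinsets H) 2).subtype
  have hinj : Function.Injective R := by
    rw [← LinearMap.ker_eq_bot, eq_bot_iff]
    rintro ⟨w, hw⟩ hR
    rw [Submodule.mem_bot]
    by_contra hne
    have hne' : ∃ j, w (S j) ≠ 0 := by
      by_contra! h0
      apply hne
      refine Subtype.ext (Finsupp.ext fun σ => ?_)
      by_contra hσ
      obtain ⟨j, rfl⟩ := hrange (hw.1 (Finsupp.mem_support_iff.2 hσ)).1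
      exact hσ (h0 j)
    obtain ⟨j, hj⟩ := (Set.toFinite {j | w (S j) ≠ 0}).exists_maximal hne'
    have hlast : ∀ i, j < i → w (S i) = 0 := by
      intro i hi
      by_contra h0
      exact (hj.2 h0 hi.le).not_gt hi
    have hnc : j ∉ critical S m := fun hc => hj.1 (congrFun hR ⟨j, hc⟩)
    obtain ⟨⟨x, y, hxy, e⟩, -⟩ := hw.1 (Finsupp.mem_support_iff.2 hj.1)
    rcases h.critical_or_forest_adj hxy with ⟨i, hi, hie⟩ | hT
    · exact hnc (hS.injective (hie.trans e.symm) ▸ hi)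
    · obtain ⟨-, k, j', hp, hk, hj'⟩ := h.forest_adj.1 hT
      obtain rfl : j = j' := hS.injective (e.trans hj'.symm)
      have h1 := hS.boundary_notMem_of_persistencePair hp
      rw [hk] at h1
      have hwN : w ∈ chains (prefixComplex S N) 2 := by
        rw [prefixComplex_length]
        exact chains_mono hrange 2 hw.1
      exact h1 (IsSimplexwise.boundary_mem_of_lead hwN hw.2 hj.1 hlast)
  have hsurj : Function.Surjective R := by
    have hbasis : ∀ i : critical S m, Pi.single i 1 ∈ LinearMap.range R := by
      rintro ⟨i, hi⟩
      obtain ⟨u, v, huv, e⟩ := Finset.card_eq_two.1 hi.2.1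
      have hu : {u} ∈ Set.range S := h.singleton_mem_range (i := i) (by rw [e]; simp)
      have hv : {v} ∈ Set.range S := h.singleton_mem_range (i := i) (by rw [e]; simp)
      obtain ⟨a, ha, hab⟩ := exists_chain_of_reachable
        (h.reachable_sink_of_critical hsink hi huv e)
      obtain ⟨b, hb, hbb⟩ := exists_chain_of_reachable
        (h.reachable_sink_of_critical hsink hi huv.symm (e.trans (Finset.pair_comm _ _)))
      rw [h.sink_eq hsink hv hu] at hbb
      have hzero : ∀ c ∈ chains (edgeFinsets (H ⊓ forest S f δ)) 2, ∀ k ∈ critical S m,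
          c (S k) = 0 := by
        intro c hc k hk
        by_contra h0
        exact h.forest_notAdj_of_critical hk
          (edgeFinsets_mono inf_le_right (hc (Finsupp.mem_support_iff.2 h0)).1)
      have hHle := chains_mono (edgeFinsets_mono (inf_le_left : H ⊓ forest S f δ ≤ H)) 2
      -- The fundamental cycle of a critical edge: the edge with the forest paths from its endpoints
      -- to their common sink.
      have hcyc : Finsupp.single (S i) 1 + (a + b) ∈ cycles (edgeFinsets H) 2 := by
        refine ⟨Submodule.add_mem _ (single_mem_chains ?_ hi.2.1 1)
          (Submodule.add_mem _ (hHle ha) (hHle hb)), ?_⟩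
        · rw [e, pair_mem_edgeFinsets]
          exact h.outputGraph_adj_of_critical hi huv e
        · rw [SetLike.mem_coe, LinearMap.mem_ker, map_add, map_add, hab, hbb, e,
            boundary_edge huv, add_comm (Finsupp.single ({v} : Finset V) 1) (Finsupp.single {sink u} 1),
            chain_add_add_cancel, chain_add_self]
      refine ⟨⟨_, hcyc⟩, ?_⟩
      ext ⟨k, hk⟩
      change (Finsupp.single (S i) 1 + (a + b) : Finset V →₀ ZMod 2) (S k) = _
      rw [Finsupp.add_apply, Finsupp.add_apply, hzero a ha k hk, hzero b hb k hk, add_zero,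
        add_zero]
      by_cases hik : i = k
      · subst hik; simp
      · rw [Finsupp.single_eq_of_ne' fun e => hik (hS.injective e),
          Pi.single_eq_of_ne fun e => hik (congrArg Subtype.val e).symm]
    intro y
    have : y = ∑ i, y i • (Pi.single i 1 : critical S m → ZMod 2) := by
      ext k
      simp [Finset.sum_apply, Pi.single_apply]
    rw [this]
    exact Submodule.sum_mem _ fun i _ => Submodule.smul_mem _ _ (hbasis i)
  rw [(LinearEquiv.ofBijective R ⟨hinj, hsurj⟩).finrank_eq, Module.finrank_fintype_fun_eq_card,
    ← Nat.card_eq_fintype_card, Nat.card_coe_set_eq]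

end IsTwoLevel

end TwoLevel

/-! ### Straight-line graphs -/

section StraightLine

variable {E : Type*} [NormedAddCommGroup E] [NormedSpace ℝ E]
  {K : Geometry.SimplicialComplex ℝ E}

theorem firstBetti_comp_equiv {ι κ V : Type*} (e : ι ≃ κ) (ends : κ → Sym2 V) :
    firstBetti (ends ∘ e) = firstBetti ends := by
  refine LinearEquiv.finrank_eq (LinearEquiv.ofSubmodules (Finsupp.domLCongr e) _ _ ?_)
  ext z
  obtain ⟨z, rfl⟩ := (Finsupp.domLCongr (R := ZMod 2) (M := ZMod 2) e).surjective z
  rw [Submodule.mem_map_equiv, LinearEquiv.symm_apply_apply, LinearMap.mem_ker, LinearMap.mem_ker,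
    Finsupp.domLCongr_apply, Finsupp.domCongr_apply, Finsupp.linearCombination_equivMapDomain]
  rfl

theorem lineMap_mem_convexHull_pair [DecidableEq E] (u v : E) (t : unitInterval) :
    AffineMap.lineMap u v (t : ℝ) ∈ convexHull ℝ (({u, v} : Finset E) : Set E) := by
  rw [Finset.coe_pair, convexHull_pair, segment_eq_image_lineMap]
  exact ⟨t, t.2, rfl⟩

/-- A point in the interior of an edge of a complex lies only in simplices containing the edge. -/
theorem pair_subset_of_lineMap_mem [DecidableEq E] {u v : E} (huv : u ≠ v)
    (hK : ({u, v} : Finset E) ∈ K.faces) {s : Finset E} (hs : s ∈ K.faces) {t : unitInterval}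
    (ht : t ∈ Set.Ioo (0 : unitInterval) 1)
    (h : AffineMap.lineMap u v (t : ℝ) ∈ convexHull ℝ (s : Set E)) : u ∈ s ∧ v ∈ s := by
  have hmem := K.inter_subset_convexHull hK hs ⟨lineMap_mem_convexHull_pair u v t, h⟩
  have ht0 : (t : ℝ) ≠ 0 := fun h0 => ht.1.ne' (Subtype.ext h0)
  have ht1 : (t : ℝ) ≠ 1 := fun h1 => ht.2.ne (Subtype.ext h1)
  -- If `s` missed one endpoint, the interior point would lie in the hull of the other endpoint
  -- alone.
  have key : ∀ w, ((({u, v} : Finset E) : Set E) ∩ s) ⊆ {w} → AffineMap.lineMap u v (t : ℝ) = w := by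
    intro w hw
    simpa using convexHull_mono hw hmem
  have hinj := AffineMap.lineMap_injective ℝ huv
  constructor
  · by_contra hu
    have := key v (by
      rintro x ⟨hx, hxs⟩
      simp only [Finset.coe_pair, Set.mem_insert_iff, Set.mem_singleton_iff] at hx
      rcases hx with rfl | rfl
      · exact absurd hxs hu
      · rfl)
    exact ht1 (hinj (this.trans (AffineMap.lineMap_apply_one u v).symm))
  · by_contra hv
    have := key u (by
      rintro x ⟨hx, hxs⟩
      simp only [Finset.coe_pair, Set.mem_insert_iff, Set.mem_singleton_iff] at hx
      rcases hx with rfl | rfl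
      · rfl
      · exact absurd hxs hv)
    exact ht0 (hinj (this.trans (AffineMap.lineMap_apply_zero u v).symm))

/-- A graph formed by edges of a finite complex is a geometric graph. -/
theorem exists_geometricGraph [DecidableEq E] (hK : K.faces.Finite) (H : SimpleGraph E)
    (hH : ∀ u v, H.Adj u v → ({u, v} : Finset E) ∈ K.faces) :
    ∃ G : GeometricGraph E, G.space = edgeSpace H ∧ G.betti = graphBetti H ∧
      (∀ v, v ∈ G.vertices ↔ ∃ w, H.Adj v w) ∧
      ∀ u v, H.Adj u v → ∃ i, s(G.arc i 0, G.arc i 1) = s(u, v) := by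
  classical
  have hfinE : H.edgeSet.Finite := by
    refine Set.Finite.of_finite_image (f := Sym2.toFinset) (hK.subset ?_) ?_
    · rintro _ ⟨e, he, rfl⟩
      induction e with
      | _ u v =>
        rw [Sym2.toFinset_mk_eq]
        exact hH u v he
    · intro e _ e' _ h
      refine Sym2.ext fun z => ?_
      rw [← Sym2.mem_toFinset, ← Sym2.mem_toFinset]
      exact iff_of_eq (congrArg (z ∈ ·) h)
  have hfinV : {v | ∃ w, H.Adj v w}.Finite := by
    refine (hK.preimage (f := fun v : E => ({v} : Finset E))
      (Finset.singleton_injective.injOn)).subset ?_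
    rintro v ⟨w, hvw⟩
    exact singleton_mem_of_mem (hH v w hvw) (by simp)
  have : Finite H.edgeSet := hfinE
  let eq := (Finite.equivFin H.edgeSet).symm
  let a : Fin (Nat.card H.edgeSet) → E := fun i => (eq i : Sym2 E).out.1
  let b : Fin (Nat.card H.edgeSet) → E := fun i => (eq i : Sym2 E).out.2
  have hab : ∀ i, s(a i, b i) = eq i := fun i => Quot.out_eq (eq i : Sym2 E)
  have hadj : ∀ i, H.Adj (a i) (b i) := fun i => by
    rw [← SimpleGraph.mem_edgeSet, hab]
    exact (eq i).2
  have hsurj : ∀ u v, H.Adj u v → ∃ i, s(a i, b i) = s(u, v) := fun u v h =>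
    ⟨eq.symm ⟨s(u, v), h⟩, by rw [hab, Equiv.apply_symm_apply]⟩
  let G : GeometricGraph E :=
    { vertices := hfinV.toFinset
      numEdges := Nat.card H.edgeSet
      arc := fun i => ⟨fun t => AffineMap.lineMap (a i) (b i) (t : ℝ), by
        simp only [AffineMap.lineMap_apply]; fun_prop⟩
      arc_zero_mem := fun i => by simpa using ⟨_, hadj i⟩
      arc_one_mem := fun i => by simpa using ⟨_, (hadj i).symm⟩
      arc_notMem := by
        intro i t ht hv
        simp only [Set.Finite.mem_toFinset, Set.mem_ofPred_eq, ContinuousMap.coe_mk] at hv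
        obtain ⟨w, hw⟩ := hv
        have := pair_subset_of_lineMap_mem (hadj i).ne (hH _ _ (hadj i))
          (singleton_mem_of_mem (hH _ _ hw) (Finset.mem_insert_self _ _)) ht (by simp)
        rw [Finset.mem_singleton, Finset.mem_singleton] at this
        exact (hadj i).ne (this.1.trans this.2.symm)
      arc_injective := by
        intro i j s hs t ht hst
        simp only [ContinuousMap.coe_mk] at hst
        have h1 := pair_subset_of_lineMap_mem (hadj i).ne (hH _ _ (hadj i)) (hH _ _ (hadj j)) hs
          (by rw [hst]; exact lineMap_mem_convexHull_pair _ _ _)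
        have hij : i = j := by
          apply eq.injective
          apply Subtype.ext
          rw [← hab, ← hab, Sym2.eq_iff]
          have hne := (hadj i).ne
          simp only [Finset.mem_insert, Finset.mem_singleton] at h1
          grind
        subst hij
        exact ⟨rfl, Subtype.ext (AffineMap.lineMap_injective ℝ (hadj i).ne hst)⟩ }
  have h0 : ∀ i, G.arc i 0 = a i := fun i => by simp [G]
  have h1 : ∀ i, G.arc i 1 = b i := fun i => by simp [G]
  have hrange : ∀ i, Set.range (G.arc i) = segment ℝ (a i) (b i) := fun i => by
    rw [segment_eq_image_lineMap]
    ext x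
    constructor
    · rintro ⟨t, rfl⟩
      exact ⟨t, t.2, rfl⟩
    · rintro ⟨t, ht, rfl⟩
      exact ⟨⟨t, ht⟩, rfl⟩
  refine ⟨G, ?_, ?_, fun v => by simp [G], fun u v h => ?_⟩
  · ext x
    constructor
    · rintro (hx | hx)
      · obtain ⟨w, hw⟩ : ∃ w, H.Adj x w := by simpa [G] using hx
        exact ⟨x, w, hw, left_mem_segment ℝ x w⟩
      · obtain ⟨i, hi⟩ := Set.mem_iUnion.1 hx
        rw [hrange] at hi
        exact ⟨a i, b i, hadj i, hi⟩
    · rintro ⟨u, v, huv, hx⟩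
      obtain ⟨i, hi⟩ := hsurj u v huv
      refine Or.inr (Set.mem_iUnion.2 ⟨i, ?_⟩)
      rw [hrange]
      rcases Sym2.eq_iff.1 hi with ⟨e1, e2⟩ | ⟨e1, e2⟩
      · rwa [e1, e2]
      · rwa [e1, e2, segment_symm]
  · rw [graphBetti, ← firstBetti_comp_equiv eq, GeometricGraph.betti]
    congr 1
    funext i
    rw [h0, h1, hab]
    rfl
  · obtain ⟨i, hi⟩ := hsurj u v h
    exact ⟨i, by rw [h0, h1, hi]⟩

end StraightLine

/-! ### The main theorem -/

section Main

variable {d N : ℕ} {K L : Geometry.SimplicialComplex ℝ (EuclideanSpace ℝ (Fin d))}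
  {S : Fin N → Finset (EuclideanSpace ℝ (Fin d))}

theorem IsLowerStarFiltration.isSimplexwise {f : EuclideanSpace ℝ (Fin d) → ℝ}
    (hS : IsLowerStarFiltration K.faces f S) : IsSimplexwise S where
  injective := hS.injective
  face_lt := hS.face_lt
  nonempty i := K.nonempty_of_mem_faces (hS.range_eq ▸ Set.mem_range_self i)
  down_closed i τ hτ hne := by
    rw [hS.range_eq]
    exact K.down_closed (hS.range_eq ▸ Set.mem_range_self i) hτ hne

/-- A lower set of indices of a finite sequence is an initial segment. -/
theorem exists_forall_iff_lt {P : Fin N → Prop} (h : ∀ i j, i ≤ j → P j → P i) :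
    ∃ m : ℕ, ∀ i : Fin N, P i ↔ (i : ℕ) < m := by
  by_cases hall : ∀ i, P i
  · exact ⟨N, fun i => iff_of_true (hall i) i.2⟩
  · push Not at hall
    obtain ⟨j, hj⟩ := (Set.toFinite {i | ¬ P i}).exists_minimal hall
    refine ⟨j, fun i => ⟨fun hi => ?_, fun hi => ?_⟩⟩
    · by_contra hij
      exact hj.1 (h j i (Fin.le_def.2 (not_lt.1 hij)) hi)
    · by_contra hPi
      have hle : j ≤ i := hj.2 hPi (Fin.le_def.2 hi.le)
      exact absurd (Fin.le_def.1 hle) (not_le.2 hi)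

theorem simplexValue_eq {V : Type*} {f : V → ℝ} {σ : Finset V} (h : σ.Nonempty) :
    simplexValue f σ = σ.sup' h f := dif_pos h

/-- The lower-star filtration of an approximation first enumerates the neighbourhood of the graph,
and has two separated levels. -/
theorem exists_isTwoLevel (hK : K.space = unitCube d)
    {G : GeometricGraph (EuclideanSpace ℝ (Fin d))} (hG : IsConnected G.space)
    {ρ : EuclideanSpace ℝ (Fin d) → ℝ} {β ν ω δ : ℝ}
    (hρ : IsApproximation K L ρ G.space β ν ω) (hδ : δ ∈ Set.Ico ν (β - ν))
    (hS : IsLowerStarFiltration K.faces (fun x => -ρ x) S) :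
    ∃ m : ℕ, prefixComplex S m = L.faces ∧ IsTwoLevel S (fun x => -ρ x) δ m := by
  classical
  have hSw := hS.isSimplexwise
  have hKfin : K.faces.Finite := hS.range_eq ▸ Set.finite_range S
  have hLfin : L.faces.Finite := hKfin.subset hρ.subcomplex
  have hmemK : ∀ i, S i ∈ K.faces := fun i => hS.range_eq ▸ Set.mem_range_self i
  have hvK : ∀ {i v}, v ∈ S i → v ∈ K.vertices := fun {i v} hv =>
    singleton_mem_of_mem (hmemK i) hv
  have hvL : ∀ {σ v}, σ ∈ L.faces → v ∈ σ → v ∈ L.vertices := fun hσ hv =>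
    singleton_mem_of_mem hσ hv
  -- $\Omega$ has a vertex because $G$ is nonempty, and its density lies in $[\beta,\beta+\nu]$.
  have hν : 0 ≤ ν := by
    obtain ⟨x, hx⟩ := hG.nonempty
    obtain ⟨σ, hσ, -⟩ := Geometry.SimplicialComplex.mem_space_iff.1 (hρ.subset_space hx)
    obtain ⟨v, hv⟩ := L.nonempty_of_mem_faces hσ
    have := hρ.density_inside v (hvL hσ hv)
    linarith [this.1, this.2]
  have hgap := hρ.gap
  -- the simplices of the neighbourhood come first
  have hlower : ∀ i j, i ≤ j → S j ∈ L.faces → S i ∈ L.faces := by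
    intro i j hij hj
    refine hρ.full _ (hmemK i) fun v hv => ?_
    by_contra hvL'
    have h1 := hρ.density_outside v (hvK hv) hvL'
    obtain ⟨n, vs, hinj, hrange, hmono, hord⟩ := hS.exists_order
    obtain ⟨a, rfl⟩ : v ∈ Set.range vs := by
      rw [hrange]; exact hvK hv
    obtain ⟨b, hab, hb⟩ := hord i j hij a hv
    have h2 := hρ.density_inside _ (hvL hj hb)
    have h3 := hmono hab
    simp only at h3
    linarith [h1.1, h1.2, h2.1, h2.2]
  obtain ⟨m, hmL⟩ := exists_forall_iff_lt hlower
  have hpre : prefixComplex S m = L.faces := by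
    ext σ
    constructor
    · rintro ⟨i, hi, rfl⟩
      exact (hmL i).2 hi
    · intro hσ
      obtain ⟨i, rfl⟩ : σ ∈ Set.range S := by rw [hS.range_eq]; exact hρ.subcomplex hσ
      exact ⟨i, (hmL i).1 hσ, rfl⟩
  -- the values in the two levels
  have hval1 : ∀ i : Fin N, (i : ℕ) < m → -(β + ν) ≤ simplexValue (fun x => -ρ x) (S i) ∧
      simplexValue (fun x => -ρ x) (S i) ≤ -β := by
    intro i hi
    have hiL := (hmL i).2 hi
    rw [simplexValue_eq (hSw.nonempty i)]
    constructor
    · obtain ⟨v, hv⟩ := hSw.nonempty i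
      refine le_trans ?_ (Finset.le_sup' (fun x => -ρ x) hv)
      linarith [(hρ.density_inside v (hvL hiL hv)).2]
    · refine Finset.sup'_le _ _ fun v hv => ?_
      linarith [(hρ.density_inside v (hvL hiL hv)).1]
  have hval2 : ∀ i : Fin N, m ≤ (i : ℕ) → -ν ≤ simplexValue (fun x => -ρ x) (S i) ∧
      simplexValue (fun x => -ρ x) (S i) ≤ 0 := by
    intro i hi
    rw [simplexValue_eq (hSw.nonempty i)]
    constructor
    -- By fullness, a simplex outside $\Omega$ has a vertex outside, and that vertex bounds the
    -- maximum from below.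
    · have : ∃ v ∈ S i, v ∉ L.vertices := by
        by_contra! hall
        exact absurd ((hmL i).1 (hρ.full _ (hmemK i) hall)) (not_lt.2 hi)
      obtain ⟨v, hv, hvn⟩ := this
      refine le_trans ?_ (Finset.le_sup' (fun x => -ρ x) hv)
      linarith [(hρ.density_outside v (hvK hv) hvn).2]
    · refine Finset.sup'_le _ _ fun v hv => ?_
      by_cases hvn : v ∈ L.vertices
      · linarith [(hρ.density_inside v hvn).1]
      · linarith [(hρ.density_outside v (hvK hv) hvn).1]
  have hconv : Convex ℝ K.space := by
    rw [hK]
    intro x hx y hy a b ha hb hab i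
    have := (convex_Icc (0 : ℝ) 1) (hx i) (hy i) ha hb hab
    simpa using this
  -- Each level has width at most `ν ≤ δ`, and the gap between the levels is at least `β - ν > δ`.
  refine ⟨m, hpre, ⟨hSw, ?_, ?_, ?_, ?_, ?_, ?_⟩⟩
  · intro i j hj hij
    linarith [(hval1 i ((Fin.lt_def.1 hij).trans hj)).1, (hval1 j hj).2, hδ.1]
  · intro i j hi hij
    linarith [(hval2 i hi).1, (hval2 j (hi.trans (Fin.lt_def.1 hij).le)).2, hδ.1]
  · intro i j hi hj
    linarith [(hval1 i hi).2, (hval2 j hj).1, hδ.2]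
  · rw [hS.range_eq]
    exact cycles_two_le_boundaries_of_convex hKfin hconv
  · rw [hS.range_eq]
    intro b hb u v hu hv
    refine eq_of_forall_edge hKfin hconv.isPreconnected b (fun x y hxy hs => hb x y hxy ?_) hu hv
    convert hs
  · rw [hpre]
    intro b hb u v hu hv
    refine eq_of_forall_edge hLfin (hρ.retract.isPreconnected hG.isPreconnected) b
      (fun x y hxy hs => hb x y hxy ?_) hu hv
    convert hs

/-- The critical edges are counted by the first Betti number of the graph. -/
theorem ncard_critical {m : ℕ} {f : EuclideanSpace ℝ (Fin d) → ℝ} {δ : ℝ}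
    {G : GeometricGraph (EuclideanSpace ℝ (Fin d))}
    (hr : DeformationRetractsTo L.space G.space) (hpre : prefixComplex S m = L.faces)
    (h : IsTwoLevel S f δ m) : (IsTwoLevel.critical S m).ncard = G.betti := by
  have hSw := h.toIsSimplexwise
  have hsub : L.faces ⊆ Set.range S := hpre ▸ prefixComplex_subset_range S m
  have hfd := finiteDimensional_of_le_supported (Set.finite_range S) (cycles_le_supported hsub 2)
  have h1 := hSw.ncard_persistencePair (m := m) (n := 2) (by omega) h.acyclic
  have hle := hSw.boundaries_le_cycles m (n := 2) (by omega)
  rw [hpre] at h1 hle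
  have h2 := betti_add_finrank_boundaries ((Set.finite_range S).subset hsub) hr hle
  change (IsTwoLevel.critical S m).ncard + _ = _ at h1
  omega

end Main

end GraphReconstruction

end

theorem mainTheorem2 {d N : ℕ}
    (K L : Geometry.SimplicialComplex ℝ (EuclideanSpace ℝ (Fin d)))
    (hK : K.space = GraphReconstruction.unitCube d)
    (G : GraphReconstruction.GeometricGraph (EuclideanSpace ℝ (Fin d)))
    (hG : IsConnected G.space)
    (ρ : EuclideanSpace ℝ (Fin d) → ℝ) (β ν ω δ : ℝ)
    (hρ : GraphReconstruction.IsApproximation K L ρ G.space β ν ω)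
    (hδ : δ ∈ Set.Ico ν (β - ν))
    (S : Fin N → Finset (EuclideanSpace ℝ (Fin d)))
    (hS : GraphReconstruction.IsLowerStarFiltration K.faces (fun x => -ρ x) S)
    (sink : EuclideanSpace ℝ (Fin d) → EuclideanSpace ℝ (Fin d))
    (hsink : GraphReconstruction.IsSinkMap K.faces (fun x => -ρ x)
      (GraphReconstruction.forest S (fun x => -ρ x) δ) sink) :
    {e | e ∈ L.faces ∧ e.card = 2 ∧ ∃ i j, GraphReconstruction.PersistencePair S i j ∧
        S i = e ∧ (S j).card = 3 ∧ S j ∉ L.faces}.ncard = G.betti ∧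
    GraphReconstruction.graphBetti
      (GraphReconstruction.outputGraph S (fun x => -ρ x) δ sink) = G.betti ∧
    (1 ≤ G.betti → Nonempty (ContinuousMap.HomotopyEquiv
      (GraphReconstruction.edgeSpace
        (GraphReconstruction.outputGraph S (fun x => -ρ x) δ sink))
      G.space)) := by
  open GraphReconstruction in
  classical
  obtain ⟨m, hpre, h⟩ := exists_isTwoLevel hK hG hρ hδ hS
  have hSw := h.toIsSimplexwise
  have hcrit := ncard_critical hρ.retract hpre h
  have hmL : ∀ i, S i ∈ L.faces ↔ (i : ℕ) < m := fun i => by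
    rw [← hpre, hSw.mem_prefixComplex]
  rw [← hS.range_eq] at hsink
  have hbetti := h.graphBetti_outputGraph hsink
  refine ⟨?_, hbetti.trans hcrit, fun hg => ?_⟩
  -- Critical edges are indexed by position; lying outside $\Omega$ means having position at least
  -- `m`, and the partner of an edge is automatically a triangle.
  · rw [← hcrit, ← Set.ncard_image_of_injective _ hSw.injective]
    congr 1
    ext e
    constructor
    · rintro ⟨he, hc, i, j, hp, rfl, -, hj⟩
      exact ⟨i, ⟨(hmL i).1 he, hc, j, not_lt.1 fun hlt => hj ((hmL j).2 hlt), hp⟩, rfl⟩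
    · rintro ⟨i, ⟨hi, hc, j, hj, hp⟩, rfl⟩
      refine ⟨(hmL i).2 hi, hc, i, j, hp, rfl, ?_, fun hjL => absurd ((hmL j).1 hjL) (not_lt.2 hj)⟩
      rw [hSw.card_of_persistencePair hp, hc]
  · set H := outputGraph S (fun x => -ρ x) δ sink with hH
    have hKfin : K.faces.Finite := hS.range_eq ▸ Set.finite_range S
    obtain ⟨G', hsp, hb, hv, harc⟩ := exists_geometricGraph hKfin H (fun u v huv => by
      have := h.outputGraph_pair_mem_range huv
      rw [hS.range_eq] at this
      convert this)
    have hvr : ∀ {x w}, H.Adj x w → {x} ∈ Set.range S := fun {x w} hxw => by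
      obtain ⟨i, hi⟩ := h.outputGraph_pair_mem_range hxw
      exact h.singleton_mem_range (i := i) (by rw [hi]; simp)
    have hreach : ∀ x ∈ G'.vertices, ∀ y ∈ G'.vertices, H.Reachable x y := by
      intro x hx y hy
      obtain ⟨w, hw⟩ := (hv x).1 hx
      obtain ⟨z, hz⟩ := (hv y).1 hy
      have h1 := h.outputGraph_reachable_sink hsink hw
      have h2 := h.outputGraph_reachable_sink hsink hz
      rw [h.sink_eq hsink (hvr hw) (hvr hz)] at h1
      exact h1.trans h2.symm
    have hconn : G'.IsEdgeConnected := by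
      rintro A hA ⟨x, hx⟩ hcl
      refine Finset.Subset.antisymm hA fun y hy => ?_
      have hadj : ∀ u v, H.Adj u v → (u ∈ A ↔ v ∈ A) := by
        intro u v huv
        obtain ⟨i, hi⟩ := harc u v huv
        have := hcl i
        rcases Sym2.eq_iff.1 hi with ⟨e1, e2⟩ | ⟨e1, e2⟩
        · rwa [e1, e2] at this
        · rw [e1, e2] at this; exact this.symm
      obtain ⟨q⟩ := hreach x (hA hx) y hy
      clear hy
      induction q with
      | nil => exact hx
      | cons huv q ih => exact ih ((hadj _ _ huv).1 hx)
    -- This uses `1 ≤ G.betti`: without a critical edge the output graph would be empty.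
    have hne' : G'.vertices.Nonempty := by
      have : (IsTwoLevel.critical S m).Nonempty := by
        rw [← Set.ncard_pos, hcrit]; exact hg
      obtain ⟨i, hi⟩ := this
      obtain ⟨u, v, huv, e⟩ := Finset.card_eq_two.1 hi.2.1
      refine ⟨u, (hv u).2 ⟨v, h.outputGraph_adj_of_critical hi huv ?_⟩⟩
      convert e
    have hne : G.vertices.Nonempty := by
      obtain ⟨x, hx | hx⟩ := hG.nonempty
      · exact ⟨x, hx⟩
      · obtain ⟨i, -⟩ := Set.mem_iUnion.1 hx
        exact ⟨_, G.arc_zero_mem i⟩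
    have := GeometricGraph.nonempty_homotopyEquiv hconn hne' (G.isEdgeConnected_of_isConnected hG)
      hne (hb.trans (hbetti.trans hcrit))
    rwa [hsp] at this
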